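/- **Soundness of Type Inference (implicit refinement types).** *Syntax.* Fix a background theory: base types $b::=\mathtt{int}\mid\mathtt{bool}\mid\cdots$ (non-empty carriers), constants $\mathtt{false},\mathtt{true}$, integer literals, $\wedge,\vee,+,-,=_b,\le$ and possibly further interpreted first-order symbols. A *predicate* $r$ is a quantifier-free first-order term over base-type variables and these constants. A *proposition* $p$ is a predicate, an application $\kappa(\bar e)$ of a predicate variable with sorted parameters, or a conjunction of propositions. Constraints: $c::=\exists x{:}b.\,c\mid\forall x{:}b.\,p\Rightarrow c\mid c\wedge c\mid p$. Types: $t::=\{v{:}b\mid p\}\mid x{:}t\to t\mid[x{:}t]\to t\mid[x{:}t].\,t\mid\alpha\mid\forall\alpha.t$ (refined base, function, implicit function, implicit pair, polymorphic types); $\tau$ ranges over unrefined types. Expressions: $e::=k\mid x\mid\lambda x{:}\tau.e\mid\lambda x{:}t.e\mid e\,e\mid\mathtt{let}\,x{:}\tau=e\,\mathtt{in}\,e\mid\mathtt{let}\,x{:}t=e\,\mathtt{in}\,e\mid\Lambda\alpha.e\mid e[\tau]\mid\lambda[x{:}t].e\mid\mathtt{unpack}\,(x,y)=e\,\mathtt{in}\,e$,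 where $k$ is a constant or a further primitive operation. Contexts $\Gamma$ list corporeal binders $x{:}t$, ghost binders $[x{:}t]$ and type variables. $\lfloor\Gamma\rfloor$ makes all ghosts corporeal. The erasure $|t|$ is $|\{v{:}b\mid p\}|=b$, $|x{:}t\to u|=|t|\to|u|$, $|[x{:}t]\to u|=|[x{:}t].u|=|u|$, $|\alpha|=\alpha$, $|\forall\alpha.t|=\forall\alpha.|t|$. Bound variables are renamed freely and chosen fresh. The type $ty(k)$ of an interpreted constant is $x_1{:}b_1\to\cdots\to\{v{:}b\mid v=k\,x_1\cdots x_n\}$; a further primitive has any given closed well-formed type. *Well-formedness.* $\Gamma\vdash t$ holds if each refinement of $t$ is a well-sorted boolean predicate without $\kappa$'s over the erased variables in scope, type variables are bound, and the domains of implicit functions and pairs are refined base types. $\Gamma$ is well-formed if its binders are distinct and each type is well-formed in what precedes it. *Logic.* $c\{r/x\}$ deletes the binder $\exists x$ (found under $\forall,\exists,\wedge$) and substitutes $r$ for $x$ in its scope; $c[\lambda\bar x.r/\kappa]$ replaces each $\kappa(\bar e)$ by $r[\bar e/\bar x]$. $\Psi$ is a list of bindings $r/x$, $\Delta$ a list of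 bindings $\lambda\bar x.r/\kappa$. $\Delta;\Psi\models c$ is generated by: $\Delta;\Psi,r/x\models c$ if $\Delta;\Psi\models c\{r/x\}$; $\Delta,\lambda\bar x.r/\kappa;\bullet\models c$ if $\Delta;\bullet\models c[\lambda\bar x.r/\kappa]$; $\bullet;\bullet\models c$ if $c$ has no existential binder and no $\kappa$ and is a well-sorted sentence (closed formula) true in the theory. Put $(x{:}\{v{:}b\mid p\})\Rightarrow c:=\forall x{:}b.\,p[x/v]\Rightarrow c$ and $\exists(x{:}\{v{:}b\mid p\}).c:=\exists x{:}b.(p[x/v]\wedge c)$; for other types both are $c$. The embedding is $[\![\bullet]\!](c)=c$, $[\![\Gamma,x{:}t]\!](c)=[\![\Gamma,[x{:}t]]\!](c)=[\![\Gamma]\!]((x{:}t)\Rightarrow c)$, $[\![\Gamma,\alpha]\!](c)=[\![\Gamma]\!](c)$. *Declarative judgments* $\Gamma\vdash e:t$, $\Gamma\vdash t;e\Rightarrow t'$ (application), $\Gamma\vdash t_1<:t_2$, mutually inductive. Subtyping: - $\{v{:}b\mid p_1\}<:\{v{:}b\mid p_2\}$ if $\bullet;\bullet\models[\![\Gamma]\!](\forall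 v{:}b.\,p_1\Rightarrow p_2)$; $\alpha<:\alpha$; $\forall\alpha.t<:\forall\alpha.t'$ if $\Gamma,\alpha\vdash t<:t'$. - $x{:}t_1\to t_1'<:x{:}t_2\to t_2'$ if $\Gamma\vdash t_2<:t_1$ and $\Gamma,x{:}t_2\vdash t_1'<:t_2'$. - $[x{:}t_1]\to t_1'<:t_2$ if $\Gamma\vdash t_1'[r/x]<:t_2$ and $\lfloor\Gamma\rfloor\vdash r:t_1$ for some term $r$; $t_1<:[x{:}t_2]\to t_2'$ if $\Gamma,x{:}t_2\vdash t_1<:t_2'$. - $[x{:}t_1].t_1'<:t_2$ if $\Gamma,x{:}t_1\vdash t_1'<:t_2$; $t_1<:[x{:}t_2].t_2'$ if $\Gamma\vdash t_1<:t_2'[r/x]$ and $\lfloor\Gamma\rfloor\vdash r:t_2$ for some term $r$. Typing: - $x:t$ and, if $t=\{v{:}b\mid p\}$, also $x:\{v{:}b\mid p\wedge v=x\}$, when $x{:}t\in\Gamma$ is corporeal; $k:ty(k)$. - $\Lambda\alpha.e:\forall\alpha.t$ if $\Gamma,\alpha\vdash e:t$; $e[\tau]:t[t'/\alpha]$ if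 $e:\forall\alpha.t$, $\Gamma\vdash t'$, $|t'|=\tau$. - $\lambda x{:}t_x.e:(x{:}t_x\to t)$, and $\lambda x{:}\tau.e:(x{:}t_x\to t)$ when $|t_x|=\tau$, if $\Gamma,x{:}t_x\vdash e:t$ and $\Gamma\vdash t_x$; $\lambda[x{:}t_x].e:[x{:}t_x]\to t$ if $\Gamma,[x{:}t_x]\vdash e:t$. - $e_1\,e_2:t'$ if $e_1:t$ and $\Gamma\vdash t;e_2\Rightarrow t'$. - $\mathtt{let}\,x{:}t_x=e_1\,\mathtt{in}\,e_2:t$ if $\Gamma,x{:}t_x\vdash e_1:t_x$, $\Gamma,x{:}t_x\vdash e_2:t$, $\Gamma\vdash t_x$, $\Gamma\vdash t$; $\mathtt{let}\,x{:}\tau=e_1\,\mathtt{in}\,e_2:t$ if for some $t_x$ with $|t_x|=\tau$, $\Gamma\vdash e_1:t_x$, $\Gamma,x{:}t_x\vdash e_2:t$, $\Gamma\vdash t_x$, $\Gamma\vdash t$. - $\mathtt{unpack}\,(x,y)=e_1\,\mathtt{in}\,e_2:t$ if $e_1:[x{:}t_1].t_2$, $\Gamma,[x{:}t_1],y{:}t_2\vdash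 e_2:t$, $\Gamma\vdash t$. - $e:t_1$ if $e:t_2$, $\Gamma\vdash t_2<:t_1$, $\Gamma\vdash t_1$. Application: - $x{:}t_x\to t;\,y\Rightarrow t[y/x]$ if $y:t_x$ ($y$ a variable). - $x{:}t_x\to t;\,e\Rightarrow t'$ if, for some $t_e$ and fresh $y$, $e:t_e$, $t_e<:t_x$, $\Gamma,y{:}t_e\vdash t[y/x]<:t'$, $\Gamma\vdash t'$. - $[x{:}t_x]\to t;\,e\Rightarrow t'$ if $t[r/x];\,e\Rightarrow t'$ and $\lfloor\Gamma\rfloor\vdash r:t_x$ for some term $r$. *Algorithmic judgments.* $\mathrm{fresh}_\Gamma(t)$ (also for $t=\tau$) replaces each refined base type in $t$ by $\{v{:}b\mid\kappa(\bar x,v)\}$, with $\kappa$ fresh and $\bar x$ all variables of $\Gamma$ and the enclosing binders. All annotations in programs are well-formed where they stand, with refined base types on implicit abstractions. Subtyping $\Gamma\vdash t_1<:t_2\leadsto c$ (existential variables $z$ fresh): - $\{v{:}b\mid p_1\}<:\{v{:}b\mid p_2\}\leadsto\forall v{:}b.\,p_1\Rightarrow p_2$; $\alpha<:\alpha\leadsto\mathtt{true}$;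 $\forall\alpha.t_1<:\forall\alpha.t_2\leadsto c$ if $\Gamma,\alpha\vdash t_1<:t_2\leadsto c$. - $x{:}t_1\to t_1'<:x{:}t_2\to t_2'\leadsto c\wedge((x{:}t_2)\Rightarrow c')$ if $\Gamma\vdash t_2<:t_1\leadsto c$ and $\Gamma,x{:}t_2\vdash t_1'<:t_2'\leadsto c'$. - $[x{:}t_1]\to t_1'<:t_2\leadsto\exists(z{:}t_1).c$ if $\Gamma,z{:}t_1\vdash t_1'[z/x]<:t_2\leadsto c$; $t_1<:[x{:}t_2]\to t_2'\leadsto(x{:}t_2)\Rightarrow c$ if $\Gamma,x{:}t_2\vdash t_1<:t_2'\leadsto c$. - $[x{:}t_1].t_1'<:t_2\leadsto(x{:}t_1)\Rightarrow c$ if $\Gamma,x{:}t_1\vdash t_1'<:t_2\leadsto c$; $t_1<:[x{:}t_2].t_2'\leadsto\exists(z{:}t_2).c$ if $\Gamma,z{:}t_2\vdash t_1<:t_2'[z/x]\leadsto c$. Checking $\Gamma\vdash e\Leftarrow t\leadsto c$: - $e\Leftarrow t\leadsto c\wedge c'$ if $e\Rightarrow t'\leadsto c$, $t'<:t\leadsto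 c'$; $e_1e_2\Leftarrow t\leadsto c_1\wedge c_2$ if $e_1\Rightarrow t'\leadsto c_1$, $t';e_2\Leftarrow t\leadsto c_2$; $\Lambda\alpha.e\Leftarrow\forall\alpha.t\leadsto c$ if $\Gamma,\alpha\vdash e\Leftarrow t\leadsto c$. - $\mathtt{let}\,x{:}\tau=e_1\,\mathtt{in}\,e_2\Leftarrow t\leadsto c_1\wedge((x{:}\hat t)\Rightarrow c_2)$ if $\hat t=\mathrm{fresh}_\Gamma(\tau)$, $e_1\Leftarrow\hat t\leadsto c_1$, $\Gamma,x{:}\hat t\vdash e_2\Leftarrow t\leadsto c_2$. - $\mathtt{let}\,x{:}t_x=e_1\,\mathtt{in}\,e_2\Leftarrow t\leadsto(x{:}t_x)\Rightarrow(c_1\wedge c_2)$ if $\Gamma,x{:}t_x\vdash e_1\Leftarrow t_x\leadsto c_1$ and $\Gamma,x{:}t_x\vdash e_2\Leftarrow t\leadsto c_2$. - $\mathtt{unpack}\,(x,y)=e_1\,\mathtt{in}\,e_2\Leftarrow t\leadsto c_1\wedge((x{:}t_1)\Rightarrow((y{:}t_2)\Rightarrow c_2))$ if $e_1\Rightarrow[x{:}t_1].t_2\leadsto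 c_1$ and $\Gamma,[x{:}t_1],y{:}t_2\vdash e_2\Leftarrow t\leadsto c_2$. Synthesis $\Gamma\vdash e\Rightarrow t\leadsto c$: - Constants and variables synthesize the types given above (both options for base-type variables) with $c=\mathtt{true}$; $\Lambda\alpha.e\Rightarrow\forall\alpha.t\leadsto c$ if $\Gamma,\alpha\vdash e\Rightarrow t\leadsto c$; $e[\tau]\Rightarrow t[\mathrm{fresh}_\Gamma(\tau)/\alpha]\leadsto c$ if $e\Rightarrow\forall\alpha.t\leadsto c$. - $\lambda x{:}t_x.e\Rightarrow x{:}t_x\to t\leadsto(x{:}t_x)\Rightarrow c$ if $\Gamma,x{:}t_x\vdash e\Rightarrow t\leadsto c$; $\lambda x{:}\tau.e$ likewise with $t_x=\mathrm{fresh}_\Gamma(\tau)$; $\lambda[x{:}t_x].e\Rightarrow[x{:}t_x]\to t\leadsto(x{:}t_x)\Rightarrow c$ if $\Gamma,[x{:}t_x]\vdash e\Rightarrow t\leadsto c$. - $e_1e_2\Rightarrow t_2\leadsto c_1\wedge c_2$ if $e_1\Rightarrow t_1\leadsto c_1$ and $t_1;e_2\Rightarrow t_2\leadsto c_2$. - $\mathtt{let}$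 and $\mathtt{unpack}$: as in checking, but the body $e_2$ synthesizes some $t$ with constraint $c_2$; in the body's context $t<:\hat t'\leadsto c_3$ for $\hat t'=\mathrm{fresh}_\Gamma(t)$; the result type is $\hat t'$, and $c_2$ is replaced by $c_2\wedge c_3$ in the constraint. Application checking $\Gamma\vdash t;e\Leftarrow t'\leadsto c$ and application synthesis $\Gamma\vdash t;e\Rightarrow t'\leadsto c$ ($y,z$ fresh): - $x{:}t_x\to t;\,y\Leftarrow t'\leadsto c_1\wedge c_2$ if $y\Leftarrow t_x\leadsto c_1$ and $t[y/x]<:t'\leadsto c_2$ ($y$ a program variable); $x{:}t_x\to t;\,y\Rightarrow t[y/x]\leadsto c$ if $y\Leftarrow t_x\leadsto c$. - $x{:}t_x\to t;\,e\Leftarrow t'\leadsto c_1\wedge c_2\wedge((y{:}t_e)\Rightarrow c_3)$ if $e\Rightarrow t_e\leadsto c_1$, $t_e<:t_x\leadsto c_2$, $\Gamma,[y{:}t_e]\vdash t[y/x]<:t'\leadsto c_3$; the same with $\Rightarrow t'$ for $t'=\mathrm{fresh}_\Gamma(t)$. - $[x{:}t_x]\to t;\,e\Leftarrow t'\leadsto\exists(z{:}t_x).c$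 if $\Gamma,[z{:}t_x]\vdash t[z/x];e\Leftarrow t'\leadsto c$; $[x{:}t_x]\to t;\,e\Rightarrow\hat t\leadsto\exists(z{:}t_x).(c_1\wedge c_2)$ if $\Gamma,[z{:}t_x]\vdash t[z/x];e\Rightarrow t'\leadsto c_1$, $\hat t=\mathrm{fresh}_\Gamma(t')$, and $\Gamma,[z{:}t_x]\vdash t'<:\hat t\leadsto c_2$. **Theorem.** Let each $\lambda\bar x.r$ in $\Delta$ be a closed boolean predicate well-sorted over the parameters of its $\kappa$. Let $\Delta;\Psi\models[\![\Gamma]\!](c)$, where $\Psi$ is well-sorted for $[\![\Gamma]\!](c)$ (a predicate put for a variable $x$ bound by $\exists x{:}b$ has sort $b$ in the scope of that binder at the time it is substituted), and let $\Delta(\Gamma)$ be well-formed. Write $\kappa(\cdot)$ for the set of predicate variables that occur. 1. If $\Gamma\vdash e\Rightarrow t\leadsto c$ and $\kappa(\Gamma)\cup\kappa(t)\subseteq\mathrm{dom}\,\Delta$, then $\Delta(\Gamma)\vdash e:\Delta(t)$. 2. If $\Gamma\vdash e\Leftarrow t\leadsto c$, $\kappa(\Gamma)\cup\kappa(t)\subseteq\mathrm{dom}\,\Delta$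 and $\Delta(\Gamma)\vdash\Delta(t)$, then $\Delta(\Gamma)\vdash e:\Delta(t)$. 3. If $\Gamma\vdash t;e\Rightarrow t'\leadsto c$, $\kappa(\Gamma)\cup\kappa(t)\cup\kappa(t')\subseteq\mathrm{dom}\,\Delta$ and $\Delta(\Gamma)\vdash\Delta(t)$, then $\Delta(\Gamma)\vdash\Delta(t);e\Rightarrow\Delta(t')$. 4. If $\Gamma\vdash t;e\Leftarrow t'\leadsto c$, $\kappa(\Gamma)\cup\kappa(t)\cup\kappa(t')\subseteq\mathrm{dom}\,\Delta$, $\Delta(\Gamma)\vdash\Delta(t)$ and $\Delta(\Gamma)\vdash\Delta(t')$, then $\Delta(\Gamma)\vdash\Delta(t);e\Rightarrow\Delta(t')$. 5. If $\Gamma\vdash t_1<:t_2\leadsto c$, $\kappa(\Gamma)\subseteq\mathrm{dom}\,\Delta$, $\Delta(\Gamma)\vdash\Delta(t_1)$ and $\Delta(\Gamma)\vdash\Delta(t_2)$, then $\Delta(\Gamma)\vdash\Delta(t_1)<:\Delta(t_2)$. -/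

import Mathlib

namespace IRT

/-! ## Base types, background theory, predicates

Variables are names (natural numbers).  Types and expressions are represented in the locally
nameless style: bound variables are de Bruijn indices, free variables are names, and a rule that
goes under a binder opens it with a fresh name.  Constraints keep their binders as names, because
an existential assignment may mention the names of the quantifiers in whose scope it is used. -/

abbrev Var := ℕ
abbrev TVar := ℕ

/-- Base types `b ::= int | bool | ⋯`. -/
inductive Base (B : Type) where
  | int | bool | ext (b : B)

/-- First-order sorts `b₁ → ⋯ → bₙ → b`. -/
inductive FSort (B : Type) where
  | base (b : Base B)
  | arr (b : Base B) (s : FSort B)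

/-- Values of a base type. -/
def Base.Carrier {B : Type} (C : B → Type) : Base B → Type
  | .int => ℤ
  | .bool => Bool
  | .ext b => C b

/-- Values of a first-order sort. -/
def FSort.Den {B : Type} (C : B → Type) : FSort B → Type
  | .base b => b.Carrier C
  | .arr b s => b.Carrier C → s.Den C

/-- The background theory of the refinement logic: the base types and the interpreted function
symbols that it has besides integers, booleans and their operations. -/
structure Theory where
  ExtBase : Type
  Carrier : ExtBase → Type
  carrier_nonempty : ∀ b, Nonempty (Carrier b)
  Fn : Type
  fnSort : Fn → FSort ExtBase
  fnDen : ∀ f, (fnSort f).Den Carrier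

abbrev Theory.B (T : Theory) := Base T.ExtBase
abbrev Theory.S (T : Theory) := FSort T.ExtBase

/-- Interpreted constants `false, true, 0, 1, …, ∧, ∨, +, -, =, ≤, …`
(equality comes once for each base type). -/
inductive Const (T : Theory) where
  | tt | ff | lit (n : ℤ) | conj | disj | plus | minus | eq (b : T.B) | le | fn (f : T.Fn)

def Const.sort {T : Theory} : Const T → T.S
  | .tt => .base .bool
  | .ff => .base .bool
  | .lit _ => .base .int
  | .conj => .arr .bool (.arr .bool (.base .bool))
  | .disj => .arr .bool (.arr .bool (.base .bool))
  | .plus => .arr .int (.arr .int (.base .int))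
  | .minus => .arr .int (.arr .int (.base .int))
  | .eq b => .arr b (.arr b (.base .bool))
  | .le => .arr .int (.arr .int (.base .bool))
  | .fn f => T.fnSort f

open Classical in
noncomputable def Const.den {T : Theory} : (c : Const T) → c.sort.Den T.Carrier
  | .tt => true
  | .ff => false
  | .lit n => n
  | .conj => fun (a b : Bool) => a && b
  | .disj => fun (a b : Bool) => a || b
  | .plus => fun (a b : ℤ) => a + b
  | .minus => fun (a b : ℤ) => a - b
  | .eq _ => fun a b => decide (a = b)
  | .le => fun (a b : ℤ) => decide (a ≤ b)
  | .fn f => T.fnDen f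

/-- Predicates `r` of the logic: quantifier-free first-order terms. -/
inductive Term (T : Theory) where
  | bvar (i : ℕ)
  | fvar (x : Var)
  | con (c : Const T)
  | app (t u : Term T)

namespace Term
variable {T : Theory}

/-- Replace the bound index `k` by `u`. -/
def opn : Term T → ℕ → Term T → Term T
  | .bvar i, k, u => if i = k then u else .bvar i
  | .fvar x, _, _ => .fvar x
  | .con c, _, _ => .con c
  | .app s t, k, u => .app (s.opn k u) (t.opn k u)

def shift : Term T → Term T
  | .bvar i => .bvar (i + 1)
  | .fvar x => .fvar x
  | .con c => .con c
  | .app s t => .app s.shift t.shift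

/-- Replace each bound index `i` by the `i`-th entry of `args`. -/
def inst (args : List (Term T)) : Term T → Term T
  | .bvar i => (args[i]?).getD (.bvar i)
  | .fvar x => .fvar x
  | .con c => .con c
  | .app s t => .app (s.inst args) (t.inst args)

/-- Replace the free variable `x` by `u`. -/
def subst : Term T → Var → Term T → Term T
  | .bvar i, _, _ => .bvar i
  | .fvar y, x, u => if y = x then u else .fvar y
  | .con c, _, _ => .con c
  | .app s t, x, u => .app (s.subst x u) (t.subst x u)

def fv : Term T → Set Var
  | .bvar _ => ∅
  | .fvar x => {x}
  | .con _ => ∅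
  | .app s t => s.fv ∪ t.fv

def eq (b : T.B) (s t : Term T) : Term T := .app (.app (.con (.eq b)) s) t

open Classical in
/-- The value of a term; `none` if the term is ill-sorted or has an unbound variable. -/
noncomputable def eval (ρ : Var → Option (Σ b : T.B, b.Carrier T.Carrier)) :
    Term T → Option (Σ s : T.S, s.Den T.Carrier)
  | .bvar _ => none
  | .fvar x => (ρ x).map fun v => ⟨.base v.1, v.2⟩
  | .con c => some ⟨c.sort, c.den⟩
  | .app s t =>
    match s.eval ρ, t.eval ρ with
    | some ⟨.arr b r, f⟩, some ⟨.base b', a⟩ =>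
        if h : b' = b then some ⟨r, f (h ▸ a)⟩ else none
    | _, _ => none

end Term

/-- Sorting of predicates; `S` sorts the free variables and `L` the bound indices.  Only variables
of base type are visible to the logic. -/
inductive HasSort {T : Theory} (S : Var → Option T.B) (L : List (Option T.B)) :
    Term T → T.S → Prop where
  | bvar {i b} : L[i]? = some (some b) → HasSort S L (.bvar i) (.base b)
  | fvar {x b} : S x = some b → HasSort S L (.fvar x) (.base b)
  | con {c : Const T} : HasSort S L (.con c) c.sort
  | app {t u b s} : HasSort S L t (.arr b s) → HasSort S L u (.base b) →
      HasSort S L (.app t u) s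

/-- Predicate variables `κ`, each with the sorts of its parameters
(`none` for a parameter that is not of base type). -/
structure KVar (T : Theory) where
  id : ℕ
  sorts : List (Option T.B)

/-- Refinements, and propositions of the constraint logic: predicates, applications of predicate
variables, and conjunctions of these. -/
inductive Refn (T : Theory) where
  | pred (r : Term T)
  | kapp (κ : KVar T) (args : List (Term T))
  | and (p q : Refn T)

namespace Refn
variable {T : Theory}

def tt : Refn T := .pred (.con .tt)

def opn (k : ℕ) (u : Term T) : Refn T → Refn T
  | .pred r => .pred (r.opn k u)
  | .kapp κ as => .kapp κ (as.map fun a => a.opn k u)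
  | .and p q => .and (p.opn k u) (q.opn k u)

def subst (x : Var) (u : Term T) : Refn T → Refn T
  | .pred r => .pred (r.subst x u)
  | .kapp κ as => .kapp κ (as.map fun a => a.subst x u)
  | .and p q => .and (p.subst x u) (q.subst x u)

def fv : Refn T → Set Var
  | .pred r => r.fv
  | .kapp _ as => {x | ∃ a ∈ as, x ∈ a.fv}
  | .and p q => p.fv ∪ q.fv

def kvars : Refn T → Set (KVar T)
  | .pred _ => ∅
  | .kapp κ _ => {κ}
  | .and p q => p.kvars ∪ q.kvars

open Classical in
/-- `p[λx̄.r / κ]`; the parameters `x̄` are the bound indices of `r`.  An application of `κ` to a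
wrong number of arguments is not an application of `λx̄.r` and stays. -/
noncomputable def soSubst (κ : KVar T) (r : Term T) : Refn T → Refn T
  | .pred s => .pred s
  | .kapp κ' as => if κ' = κ ∧ as.length = κ.sorts.length then .pred (r.inst as) else .kapp κ' as
  | .and p q => .and (p.soSubst κ r) (q.soSubst κ r)

/-- `p` is a well-sorted boolean predicate without predicate variables. -/
def WS (S : Var → Option T.B) (L : List (Option T.B)) : Refn T → Prop
  | .pred r => HasSort S L r (.base .bool)
  | .kapp _ _ => False
  | .and p q => p.WS S L ∧ q.WS S L

/-- Truth of `p` under a valuation. -/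
def Holds (ρ : Var → Option (Σ b : T.B, b.Carrier T.Carrier)) : Refn T → Prop
  | .pred r => r.eval ρ = some ⟨.base .bool, true⟩
  | .kapp _ _ => False
  | .and p q => p.Holds ρ ∧ q.Holds ρ

end Refn

/-! ## Existential Horn constraints -/

/-- `c ::= ∃x:b.c | ∀x:b.p ⇒ c | c ∧ c | p`. -/
inductive Con (T : Theory) where
  | ex (x : Var) (b : T.B) (c : Con T)
  | all (x : Var) (b : T.B) (p : Refn T) (c : Con T)
  | and (c d : Con T)
  | prop (p : Refn T)

namespace Con
variable {T : Theory}

def tt : Con T := .prop .tt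

/-- Substitution `c[u/x]` for the free occurrences of `x`. -/
def subst (x : Var) (u : Term T) : Con T → Con T
  | .ex y b c => .ex y b (if y = x then c else c.subst x u)
  | .all y b p c => .all y b (if y = x then p else p.subst x u) (if y = x then c else c.subst x u)
  | .and c d => .and (c.subst x u) (d.subst x u)
  | .prop p => .prop (p.subst x u)

/-- Existential substitution `c{r/x}`: removes the binder `∃x` and puts `r` for `x`. -/
def foSubst (x : Var) (r : Term T) : Con T → Con T
  | .ex y b c => if y = x then c.subst x r else .ex y b (c.foSubst x r)
  | .all y b p c => .all y b p (c.foSubst x r)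
  | .and c d => .and (c.foSubst x r) (d.foSubst x r)
  | .prop p => .prop p

/-- `c[λx̄.r / κ]`. -/
noncomputable def soSubst (κ : KVar T) (r : Term T) : Con T → Con T
  | .ex y b c => .ex y b (c.soSubst κ r)
  | .all y b p c => .all y b (p.soSubst κ r) (c.soSubst κ r)
  | .and c d => .and (c.soSubst κ r) (d.soSubst κ r)
  | .prop p => .prop (p.soSubst κ r)

/-- The existentially bound variables. -/
def evars : Con T → Set Var
  | .ex x _ c => {x} ∪ c.evars
  | .all _ _ _ c => c.evars
  | .and c d => c.evars ∪ d.evars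
  | .prop _ => ∅

def kvars : Con T → Set (KVar T)
  | .ex _ _ c => c.kvars
  | .all _ _ p c => p.kvars ∪ c.kvars
  | .and c d => c.kvars ∪ d.kvars
  | .prop p => p.kvars

/-- `c` is a well-sorted formula over the free variables sorted by `S`. -/
def WS (S : Var → Option T.B) : Con T → Prop
  | .ex x b c => c.WS (Function.update S x (some b))
  | .all x b p c => p.WS (Function.update S x (some b)) [] ∧ c.WS (Function.update S x (some b))
  | .and c d => c.WS S ∧ d.WS S
  | .prop p => p.WS S []

/-- Truth of `c` under a valuation. -/
def Holds (ρ : Var → Option (Σ b : T.B, b.Carrier T.Carrier)) : Con T → Prop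
  | .ex x b c => ∃ a : b.Carrier T.Carrier, c.Holds (Function.update ρ x (some ⟨b, a⟩))
  | .all x b p c => ∀ a : b.Carrier T.Carrier,
      p.Holds (Function.update ρ x (some ⟨b, a⟩)) → c.Holds (Function.update ρ x (some ⟨b, a⟩))
  | .and c d => c.Holds ρ ∧ d.Holds ρ
  | .prop p => p.Holds ρ

/-- `c` is a well-sorted sentence that is true in the background theory. -/
def SmtValid (c : Con T) : Prop :=
  c.WS (fun _ => none) ∧ c.Holds (fun _ => none)

/-- At each binder `∃x:b` of `c`, the predicate `r` has sort `b` in the scope of that binder. -/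
def InstOK (x : Var) (r : Term T) (S : Var → Option T.B) : Con T → Prop
  | .ex y b c => if y = x then HasSort S [] r (.base b)
      else c.InstOK x r (Function.update S y (some b))
  | .all y b _ c => c.InstOK x r (Function.update S y (some b))
  | .and c d => c.InstOK x r S ∧ d.InstOK x r S
  | .prop _ => True

end Con

/-- Second-order assignments `Δ`; the head of the list is the rightmost binding. -/
abbrev SOAssign (T : Theory) := List (KVar T × Term T)

/-- First-order assignments `Ψ`; the head of the list is the rightmost binding. -/
abbrev FOAssign (T : Theory) := List (Var × Term T)

def SOAssign.dom {T : Theory} (Δ : SOAssign T) : Set (KVar T) := {κ | ∃ r, (κ, r) ∈ Δ}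

/-- Each `λx̄.r` in `Δ` is a closed, well-sorted predicate over the parameters of its `κ`. -/
def SOAssign.WS {T : Theory} (Δ : SOAssign T) : Prop :=
  ∀ κ r, (κ, r) ∈ Δ → HasSort (fun _ => none) κ.sorts r (.base .bool)

/-- `Ψ` is well-sorted for the closed constraint `c`: whenever a binding is used, the predicate it
puts for an existential variable has the sort of that variable in the scope of its binder. -/
def FOAssign.WS {T : Theory} : FOAssign T → Con T → Prop
  | [], _ => True
  | (x, r) :: Ψ, c => c.InstOK x r (fun _ => none) ∧ FOAssign.WS Ψ (c.foSubst x r)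

/-- Validity `Δ; Ψ ⊨ c`. -/
inductive Valid {T : Theory} : SOAssign T → FOAssign T → Con T → Prop where
  | fo {Δ Ψ c x r} : Valid Δ Ψ (c.foSubst x r) → Valid Δ ((x, r) :: Ψ) c
  | so {Δ c κ r} : Valid Δ [] (c.soSubst κ r) → Valid ((κ, r) :: Δ) [] c
  | smt {c} : c.evars = ∅ → c.kvars = ∅ → c.SmtValid → Valid [] [] c

/-! ## Types -/

/-- Unrefined types `τ`. -/
inductive STy (T : Theory) where
  | base (b : T.B)
  | bvar (i : ℕ)
  | fvar (a : TVar)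
  | arr (τ σ : STy T)
  | all (τ : STy T)

/-- Types `t`: `{v:b|r}`, `x:t → t`, implicit functions `[x:t] → t`, implicit pairs `[x:t]. t`,
type variables and `∀α.t`.  In `refine b r` the value variable is index `0` of `r`; in `fn`, `ifn`
and `sig` the second type has one more term index, in `all` one more type index. -/
inductive Ty (T : Theory) where
  | refine (b : T.B) (r : Refn T)
  | fn (t u : Ty T)
  | ifn (t u : Ty T)
  | sig (t u : Ty T)
  | bvar (i : ℕ)
  | fvar (a : TVar)
  | all (t : Ty T)

namespace STy
variable {T : Theory}

/-- Replace the bound index `k` by `u`. -/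
def opnT : STy T → ℕ → STy T → STy T
  | .base b, _, _ => .base b
  | .bvar i, k, u => if i = k then u else .bvar i
  | .fvar a, _, _ => .fvar a
  | .arr τ σ, k, u => .arr (τ.opnT k u) (σ.opnT k u)
  | .all τ, k, u => .all (τ.opnT (k + 1) u)

def ftv : STy T → Set TVar
  | .base _ => ∅
  | .bvar _ => ∅
  | .fvar a => {a}
  | .arr τ σ => τ.ftv ∪ σ.ftv
  | .all τ => τ.ftv

/-- An unrefined type as a type with trivial refinements. -/
def toTy : STy T → Ty T
  | .base b => .refine b .tt
  | .bvar i => .bvar i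
  | .fvar a => .fvar a
  | .arr τ σ => .fn τ.toTy σ.toTy
  | .all τ => .all τ.toTy

def base? : STy T → Option T.B
  | .base b => some b
  | _ => none

end STy

namespace Ty
variable {T : Theory}

def opn (k : ℕ) (u : Term T) : Ty T → Ty T
  | .refine b r => .refine b (r.opn (k + 1) u)
  | .fn t s => .fn (t.opn k u) (s.opn (k + 1) u)
  | .ifn t s => .ifn (t.opn k u) (s.opn (k + 1) u)
  | .sig t s => .sig (t.opn k u) (s.opn (k + 1) u)
  | .bvar i => .bvar i
  | .fvar a => .fvar a
  | .all t => .all (t.opn k u)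

/-- Replace the bound type index `k` by `u`. -/
def opnT : Ty T → ℕ → Ty T → Ty T
  | .refine b r, _, _ => .refine b r
  | .fn t s, k, u => .fn (t.opnT k u) (s.opnT k u)
  | .ifn t s, k, u => .ifn (t.opnT k u) (s.opnT k u)
  | .sig t s, k, u => .sig (t.opnT k u) (s.opnT k u)
  | .bvar i, k, u => if i = k then u else .bvar i
  | .fvar a, _, _ => .fvar a
  | .all t, k, u => .all (t.opnT (k + 1) u)

def fv : Ty T → Set Var
  | .refine _ r => r.fv
  | .fn t s => t.fv ∪ s.fv
  | .ifn t s => t.fv ∪ s.fv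
  | .sig t s => t.fv ∪ s.fv
  | .bvar _ => ∅
  | .fvar _ => ∅
  | .all t => t.fv

def ftv : Ty T → Set TVar
  | .refine _ _ => ∅
  | .fn t s => t.ftv ∪ s.ftv
  | .ifn t s => t.ftv ∪ s.ftv
  | .sig t s => t.ftv ∪ s.ftv
  | .bvar _ => ∅
  | .fvar a => {a}
  | .all t => t.ftv

def kvars : Ty T → Set (KVar T)
  | .refine _ r => r.kvars
  | .fn t s => t.kvars ∪ s.kvars
  | .ifn t s => t.kvars ∪ s.kvars
  | .sig t s => t.kvars ∪ s.kvars
  | .bvar _ => ∅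
  | .fvar _ => ∅
  | .all t => t.kvars

noncomputable def soSubst (κ : KVar T) (r : Term T) : Ty T → Ty T
  | .refine b p => .refine b (p.soSubst κ r)
  | .fn t s => .fn (t.soSubst κ r) (s.soSubst κ r)
  | .ifn t s => .ifn (t.soSubst κ r) (s.soSubst κ r)
  | .sig t s => .sig (t.soSubst κ r) (s.soSubst κ r)
  | .bvar i => .bvar i
  | .fvar a => .fvar a
  | .all t => .all (t.soSubst κ r)

/-- Erasure of refinements and implicits. -/
def forget : Ty T → STy T
  | .refine b _ => .base b
  | .fn t s => .arr t.forget s.forget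
  | .ifn _ s => s.forget
  | .sig _ s => s.forget
  | .bvar i => .bvar i
  | .fvar a => .fvar a
  | .all t => .all t.forget

/-- `Δ(t)`. -/
noncomputable def applySO : SOAssign T → Ty T → Ty T
  | [], t => t
  | (κ, r) :: Δ, t => applySO Δ (t.soSubst κ r)

end Ty

/-! ## Expressions and contexts -/

/-- Expressions; `P` is a set of further primitive operations.  `lamB` and `letB` carry an unrefined
annotation, `lamR` and `letR` a refinement type.  In `letR t e₁ e₂` the variable is bound in `e₁` as
well as in `e₂`; in `unpack e₁ e₂`, index `1` of `e₂` is the ghost component and index `0` the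
value. -/
inductive Expr (T : Theory) (P : Type) where
  | con (c : Const T)
  | prim (p : P)
  | bvar (i : ℕ)
  | fvar (x : Var)
  | lamB (τ : STy T) (e : Expr T P)
  | lamR (t : Ty T) (e : Expr T P)
  | app (e₁ e₂ : Expr T P)
  | letB (τ : STy T) (e₁ e₂ : Expr T P)
  | letR (t : Ty T) (e₁ e₂ : Expr T P)
  | tabs (e : Expr T P)
  | tapp (e : Expr T P) (τ : STy T)
  | ilam (t : Ty T) (e : Expr T P)
  | unpack (e₁ e₂ : Expr T P)

/-- A predicate read as an expression. -/
def Term.toExpr {T : Theory} {P : Type} : Term T → Expr T P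
  | .bvar i => .bvar i
  | .fvar x => .fvar x
  | .con c => .con c
  | .app t u => .app t.toExpr u.toExpr

namespace Expr
variable {T : Theory} {P : Type}

/-- Open term index `k` with the name `x`. -/
def opn (k : ℕ) (x : Var) : Expr T P → Expr T P
  | .con c => .con c
  | .prim p => .prim p
  | .bvar i => if i = k then .fvar x else .bvar i
  | .fvar y => .fvar y
  | .lamB τ e => .lamB τ (e.opn (k + 1) x)
  | .lamR t e => .lamR (t.opn k (.fvar x)) (e.opn (k + 1) x)
  | .app e₁ e₂ => .app (e₁.opn k x) (e₂.opn k x)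
  | .letB τ e₁ e₂ => .letB τ (e₁.opn k x) (e₂.opn (k + 1) x)
  | .letR t e₁ e₂ => .letR (t.opn k (.fvar x)) (e₁.opn (k + 1) x) (e₂.opn (k + 1) x)
  | .tabs e => .tabs (e.opn k x)
  | .tapp e τ => .tapp (e.opn k x) τ
  | .ilam t e => .ilam (t.opn k (.fvar x)) (e.opn (k + 1) x)
  | .unpack e₁ e₂ => .unpack (e₁.opn k x) (e₂.opn (k + 2) x)

/-- Open type index `k` with the type variable `a`. -/
def opnT (k : ℕ) (a : TVar) : Expr T P → Expr T P
  | .con c => .con c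
  | .prim p => .prim p
  | .bvar i => .bvar i
  | .fvar y => .fvar y
  | .lamB τ e => .lamB (τ.opnT k (.fvar a)) (e.opnT k a)
  | .lamR t e => .lamR (t.opnT k (.fvar a)) (e.opnT k a)
  | .app e₁ e₂ => .app (e₁.opnT k a) (e₂.opnT k a)
  | .letB τ e₁ e₂ => .letB (τ.opnT k (.fvar a)) (e₁.opnT k a) (e₂.opnT k a)
  | .letR t e₁ e₂ => .letR (t.opnT k (.fvar a)) (e₁.opnT k a) (e₂.opnT k a)
  | .tabs e => .tabs (e.opnT (k + 1) a)
  | .tapp e τ => .tapp (e.opnT k a) (τ.opnT k (.fvar a))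
  | .ilam t e => .ilam (t.opnT k (.fvar a)) (e.opnT k a)
  | .unpack e₁ e₂ => .unpack (e₁.opnT k a) (e₂.opnT k a)

def fv : Expr T P → Set Var
  | .con _ => ∅
  | .prim _ => ∅
  | .bvar _ => ∅
  | .fvar y => {y}
  | .lamB _ e => e.fv
  | .lamR t e => t.fv ∪ e.fv
  | .app e₁ e₂ => e₁.fv ∪ e₂.fv
  | .letB _ e₁ e₂ => e₁.fv ∪ e₂.fv
  | .letR t e₁ e₂ => t.fv ∪ e₁.fv ∪ e₂.fv
  | .tabs e => e.fv
  | .tapp e _ => e.fv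
  | .ilam t e => t.fv ∪ e.fv
  | .unpack e₁ e₂ => e₁.fv ∪ e₂.fv

def ftv : Expr T P → Set TVar
  | .con _ => ∅
  | .prim _ => ∅
  | .bvar _ => ∅
  | .fvar _ => ∅
  | .lamB τ e => τ.ftv ∪ e.ftv
  | .lamR t e => t.ftv ∪ e.ftv
  | .app e₁ e₂ => e₁.ftv ∪ e₂.ftv
  | .letB τ e₁ e₂ => τ.ftv ∪ e₁.ftv ∪ e₂.ftv
  | .letR t e₁ e₂ => t.ftv ∪ e₁.ftv ∪ e₂.ftv
  | .tabs e => e.ftv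
  | .tapp e τ => e.ftv ∪ τ.ftv
  | .ilam t e => t.ftv ∪ e.ftv
  | .unpack e₁ e₂ => e₁.ftv ∪ e₂.ftv

end Expr

/-- Contexts: corporeal binders `x : t`, ghost binders, and type variables. -/
inductive Ctx (T : Theory) where
  | nil
  | corp (Γ : Ctx T) (x : Var) (t : Ty T)
  | ghost (Γ : Ctx T) (x : Var) (t : Ty T)
  | tvar (Γ : Ctx T) (a : TVar)

namespace Ctx
variable {T : Theory}

/-- `x : t ∈ Γ` (corporeal binders only). -/
inductive Mem (x : Var) (t : Ty T) : Ctx T → Prop where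
  | here {Γ} : Mem x t (.corp Γ x t)
  | corp {Γ y u} : Mem x t Γ → Mem x t (.corp Γ y u)
  | ghost {Γ y u} : Mem x t Γ → Mem x t (.ghost Γ y u)
  | tvar {Γ a} : Mem x t Γ → Mem x t (.tvar Γ a)

/-- `α ∈ Γ`. -/
def tdom : Ctx T → Set TVar
  | .nil => ∅
  | .corp Γ _ _ => Γ.tdom
  | .ghost Γ _ _ => Γ.tdom
  | .tvar Γ a => {a} ∪ Γ.tdom

/-- All term variables that are bound in `Γ` or occur in its types. -/
def fv : Ctx T → Set Var
  | .nil => ∅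
  | .corp Γ x t => {x} ∪ t.fv ∪ Γ.fv
  | .ghost Γ x t => {x} ∪ t.fv ∪ Γ.fv
  | .tvar Γ _ => Γ.fv

/-- All type variables that are bound in `Γ` or occur in its types. -/
def ftv : Ctx T → Set TVar
  | .nil => ∅
  | .corp Γ _ t => t.ftv ∪ Γ.ftv
  | .ghost Γ _ t => t.ftv ∪ Γ.ftv
  | .tvar Γ a => {a} ∪ Γ.ftv

def kvars : Ctx T → Set (KVar T)
  | .nil => ∅
  | .corp Γ _ t => Γ.kvars ∪ t.kvars
  | .ghost Γ _ t => Γ.kvars ∪ t.kvars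
  | .tvar Γ _ => Γ.kvars

/-- The term variables of `Γ`, in order. -/
def vars : Ctx T → List Var
  | .nil => []
  | .corp Γ x _ => Γ.vars ++ [x]
  | .ghost Γ x _ => Γ.vars ++ [x]
  | .tvar Γ _ => Γ.vars

/-- The sort that a variable has after erasure of ghostliness and refinements, if it is a base. -/
def sort : Ctx T → Var → Option T.B
  | .nil => fun _ => none
  | .corp Γ x t => Function.update Γ.sort x t.forget.base?
  | .ghost Γ x t => Function.update Γ.sort x t.forget.base?
  | .tvar Γ _ => Γ.sort

/-- Turns the ghost binders into corporeal ones. -/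
def forgetGhost : Ctx T → Ctx T
  | .nil => .nil
  | .corp Γ x t => .corp Γ.forgetGhost x t
  | .ghost Γ x t => .corp Γ.forgetGhost x t
  | .tvar Γ a => .tvar Γ.forgetGhost a

noncomputable def soSubst (κ : KVar T) (r : Term T) : Ctx T → Ctx T
  | .nil => .nil
  | .corp Γ x t => .corp (Γ.soSubst κ r) x (t.soSubst κ r)
  | .ghost Γ x t => .ghost (Γ.soSubst κ r) x (t.soSubst κ r)
  | .tvar Γ a => .tvar (Γ.soSubst κ r) a

/-- `Δ(Γ)`. -/
noncomputable def applySO : SOAssign T → Ctx T → Ctx T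
  | [], Γ => Γ
  | (κ, r) :: Δ, Γ => applySO Δ (Γ.soSubst κ r)

end Ctx

/-- `(x : t) ⇒ c`. -/
def genImp {T : Theory} (x : Var) : Ty T → Con T → Con T
  | .refine b r, c => .all x b (r.opn 0 (.fvar x)) c
  | _, c => c

/-- `∃(x : t). c`. -/
def genEx {T : Theory} (x : Var) : Ty T → Con T → Con T
  | .refine b r, c => .ex x b (.and (.prop (r.opn 0 (.fvar x))) c)
  | _, c => c

/-- The embedding `⟦Γ⟧(c)`: quantifies universally over the variables bound at base types. -/
def Ctx.embed {T : Theory} : Ctx T → Con T → Con T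
  | .nil, c => c
  | .corp Γ x (.refine b r), c => Γ.embed (.all x b (r.opn 0 (.fvar x)) c)
  | .ghost Γ x (.refine b r), c => Γ.embed (.all x b (r.opn 0 (.fvar x)) c)
  | .corp Γ _ _, c => Γ.embed c
  | .ghost Γ _ _, c => Γ.embed c
  | .tvar Γ _, c => Γ.embed c

/-! ## Well-formedness -/

def Ty.IsBase {T : Theory} (t : Ty T) : Prop := ∃ b r, t = .refine b r

/-- `Γ ⊢ t`. -/
inductive Wf {T : Theory} : Ctx T → Ty T → Prop where
  | base {Γ b r} : r.WS Γ.sort [some b] → Wf Γ (.refine b r)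
  | fn {Γ x tx t} : x ∉ Γ.fv → x ∉ t.fv →
      Wf Γ tx → Wf (.corp Γ x tx) (t.opn 0 (.fvar x)) → Wf Γ (.fn tx t)
  | ifn {Γ x tx t} : x ∉ Γ.fv → x ∉ t.fv → tx.IsBase →
      Wf Γ tx → Wf (.corp Γ x tx) (t.opn 0 (.fvar x)) → Wf Γ (.ifn tx t)
  | sig {Γ x tx t} : x ∉ Γ.fv → x ∉ t.fv → tx.IsBase →
      Wf Γ tx → Wf (.corp Γ x tx) (t.opn 0 (.fvar x)) → Wf Γ (.sig tx t)
  | var {Γ a} : a ∈ Γ.tdom → Wf Γ (.fvar a)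
  | all {Γ a t} : a ∉ Γ.ftv → a ∉ t.ftv → Wf (.tvar Γ a) (t.opnT 0 (.fvar a)) → Wf Γ (.all t)

/-- Well-formed contexts: distinct binders, each at a type that is well-formed in what precedes. -/
inductive WfCtx {T : Theory} : Ctx T → Prop where
  | nil : WfCtx .nil
  | corp {Γ x t} : WfCtx Γ → x ∉ Γ.fv → Wf Γ t → WfCtx (.corp Γ x t)
  | ghost {Γ x t} : WfCtx Γ → x ∉ Γ.fv → Wf Γ t → WfCtx (.ghost Γ x t)
  | tvar {Γ a} : WfCtx Γ → a ∉ Γ.ftv → WfCtx (.tvar Γ a)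

/-! ## Types of constants and variables -/

/-- `x₁:b₁ → ⋯ → xₙ:bₙ → {v:b | v = h x₁ ⋯ xₙ}` for a term `h` of sort `b₁ → ⋯ → bₙ → b`. -/
def FSort.exactTy {T : Theory} (h : Term T) : T.S → Ty T
  | .base b => .refine b (.pred (.eq b (.bvar 0) h.shift))
  | .arr b s => .fn (.refine b .tt) (FSort.exactTy (.app h.shift (.bvar 0)) s)

/-- The type of an interpreted constant. -/
def Const.ty {T : Theory} (c : Const T) : Ty T := FSort.exactTy (.con c) c.sort

/-- `{v:b | r ∧ v = x}`. -/
def selfTy {T : Theory} (b : T.B) (r : Refn T) (x : Var) : Ty T :=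
  .refine b (.and r (.pred (.eq b (.bvar 0) (.fvar x))))

/-! ## Declarative typing

`tc` gives the types of the further primitive operations. -/

mutual

/-- `Γ ⊢ e : t`. -/
inductive HasType {T : Theory} {P : Type} (tc : P → Ty T) :
    Ctx T → Expr T P → Ty T → Prop where
  | base {Γ x b r} : Γ.Mem x (.refine b r) → HasType tc Γ (.fvar x) (selfTy b r x)
  | var {Γ x t} : Γ.Mem x t → HasType tc Γ (.fvar x) t
  | con {Γ c} : HasType tc Γ (.con c) c.ty
  | prim {Γ p} : HasType tc Γ (.prim p) (tc p)
  | tabs {Γ a e t} : a ∉ Γ.ftv → a ∉ e.ftv → a ∉ t.ftv →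
      HasType tc (.tvar Γ a) (e.opnT 0 a) (t.opnT 0 (.fvar a)) →
      HasType tc Γ (.tabs e) (.all t)
  | tapp {Γ e t t' τ} : HasType tc Γ e (.all t) → Wf Γ t' → t'.forget = τ →
      HasType tc Γ (.tapp e τ) (t.opnT 0 t')
  | absReft {Γ x tx e t} : x ∉ Γ.fv → x ∉ e.fv → x ∉ t.fv →
      HasType tc (.corp Γ x tx) (e.opn 0 x) (t.opn 0 (.fvar x)) → Wf Γ tx →
      HasType tc Γ (.lamR tx e) (.fn tx t)
  | absBase {Γ x tx e t τ} : x ∉ Γ.fv → x ∉ e.fv → x ∉ t.fv →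
      HasType tc (.corp Γ x tx) (e.opn 0 x) (t.opn 0 (.fvar x)) → Wf Γ tx → tx.forget = τ →
      HasType tc Γ (.lamB τ e) (.fn tx t)
  | absI {Γ x tx e t} : x ∉ Γ.fv → x ∉ e.fv → x ∉ t.fv →
      HasType tc (.ghost Γ x tx) (e.opn 0 x) (t.opn 0 (.fvar x)) →
      HasType tc Γ (.ilam tx e) (.ifn tx t)
  | app {Γ e₁ e₂ t t'} : HasType tc Γ e₁ t → AppType tc Γ t e₂ t' →
      HasType tc Γ (.app e₁ e₂) t'
  | letReft {Γ x tx e₁ e₂ t} : x ∉ Γ.fv → x ∉ e₁.fv → x ∉ e₂.fv → x ∉ t.fv →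
      HasType tc (.corp Γ x tx) (e₁.opn 0 x) tx → HasType tc (.corp Γ x tx) (e₂.opn 0 x) t →
      Wf Γ tx → Wf Γ t →
      HasType tc Γ (.letR tx e₁ e₂) t
  | letBase {Γ x tx τ e₁ e₂ t} : x ∉ Γ.fv → x ∉ e₂.fv → x ∉ t.fv →
      HasType tc Γ e₁ tx → HasType tc (.corp Γ x tx) (e₂.opn 0 x) t →
      Wf Γ t → Wf Γ tx → tx.forget = τ →
      HasType tc Γ (.letB τ e₁ e₂) t
  | unpack {Γ x y e₁ e₂ t₁ t₂ t} : x ∉ Γ.fv → y ∉ Γ.fv → x ≠ y →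
      x ∉ (Ty.sig t₁ t₂).fv → y ∉ (Ty.sig t₁ t₂).fv →
      x ∉ e₂.fv → y ∉ e₂.fv → x ∉ t.fv → y ∉ t.fv →
      HasType tc Γ e₁ (.sig t₁ t₂) →
      HasType tc (.corp (.ghost Γ x t₁) y (t₂.opn 0 (.fvar x))) ((e₂.opn 1 x).opn 0 y) t →
      Wf Γ t →
      HasType tc Γ (.unpack e₁ e₂) t
  | sub {Γ e t₁ t₂} : HasType tc Γ e t₂ → SubType tc Γ t₂ t₁ → Wf Γ t₁ → HasType tc Γ e t₁

/-- `Γ ⊢ t ; e ⇒ t'`: an argument `e` of a function of type `t` gives a result of type `t'`. -/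
inductive AppType {T : Theory} {P : Type} (tc : P → Ty T) :
    Ctx T → Ty T → Expr T P → Ty T → Prop where
  | funVar {Γ y tx t} : HasType tc Γ (.fvar y) tx →
      AppType tc Γ (.fn tx t) (.fvar y) (t.opn 0 (.fvar y))
  | fun {Γ y e te tx t t'} : y ∉ Γ.fv → y ∉ e.fv → y ∉ te.fv → y ∉ (Ty.fn tx t).fv → y ∉ t'.fv →
      HasType tc Γ e te → SubType tc Γ te tx →
      SubType tc (.corp Γ y te) (t.opn 0 (.fvar y)) t' → Wf Γ t' →
      AppType tc Γ (.fn tx t) e t'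
  | ifun {Γ e tx t t'} {e' : Term T} : AppType tc Γ (t.opn 0 e') e t' →
      HasType tc Γ.forgetGhost e'.toExpr tx →
      AppType tc Γ (.ifn tx t) e t'

/-- `Γ ⊢ t₁ <: t₂`. -/
inductive SubType {T : Theory} {P : Type} (tc : P → Ty T) :
    Ctx T → Ty T → Ty T → Prop where
  | base {Γ v b r₁ r₂} : v ∉ Γ.fv → v ∉ r₁.fv → v ∉ r₂.fv →
      Valid [] [] (Γ.embed (.all v b (r₁.opn 0 (.fvar v)) (.prop (r₂.opn 0 (.fvar v))))) →
      SubType tc Γ (.refine b r₁) (.refine b r₂)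
  | fun {Γ x t₁ t₁' t₂ t₂'} : x ∉ Γ.fv → x ∉ t₁'.fv → x ∉ t₂'.fv →
      SubType tc Γ t₂ t₁ →
      SubType tc (.corp Γ x t₂) (t₁'.opn 0 (.fvar x)) (t₂'.opn 0 (.fvar x)) →
      SubType tc Γ (.fn t₁ t₁') (.fn t₂ t₂')
  | all {Γ a t t'} : a ∉ Γ.ftv → a ∉ t.ftv → a ∉ t'.ftv →
      SubType tc (.tvar Γ a) (t.opnT 0 (.fvar a)) (t'.opnT 0 (.fvar a)) →
      SubType tc Γ (.all t) (.all t')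
  | funIL {Γ t₁ t₁' t₂} {e : Term T} : SubType tc Γ (t₁'.opn 0 e) t₂ →
      HasType tc Γ.forgetGhost e.toExpr t₁ →
      SubType tc Γ (.ifn t₁ t₁') t₂
  | funIR {Γ x t₁ t₂ t₂'} : x ∉ Γ.fv → x ∉ t₁.fv → x ∉ t₂'.fv →
      SubType tc (.corp Γ x t₂) t₁ (t₂'.opn 0 (.fvar x)) →
      SubType tc Γ t₁ (.ifn t₂ t₂')
  | sigL {Γ x t₁ t₁' t₂} : x ∉ Γ.fv → x ∉ t₁'.fv → x ∉ t₂.fv →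
      SubType tc (.corp Γ x t₁) (t₁'.opn 0 (.fvar x)) t₂ →
      SubType tc Γ (.sig t₁ t₁') t₂
  | sigR {Γ t₁ t₂ t₂'} {e : Term T} : SubType tc Γ t₁ (t₂'.opn 0 e) →
      HasType tc Γ.forgetGhost e.toExpr t₂ →
      SubType tc Γ t₁ (.sig t₂ t₂')
  | alpha {Γ a} : SubType tc Γ (.fvar a) (.fvar a)

end

/-! ## Algorithmic typing -/

/-- `Fresh Γ t t'`: `t'` is a template for `t`, i.e. it has the shape of `t`, and each refinement is
a predicate variable applied to all variables in scope and the value variable. -/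
inductive Fresh {T : Theory} : Ctx T → Ty T → Ty T → Prop where
  | base {Γ b r} {κ : KVar T} : κ ∉ Γ.kvars → κ ∉ r.kvars →
      κ.sorts = Γ.vars.map Γ.sort ++ [some b] →
      Fresh Γ (.refine b r) (.refine b (.kapp κ (Γ.vars.map Term.fvar ++ [.bvar 0])))
  | all {Γ a t t'} : a ∉ Γ.ftv → a ∉ t.ftv → a ∉ t'.ftv →
      Fresh (.tvar Γ a) (t.opnT 0 (.fvar a)) (t'.opnT 0 (.fvar a)) → Fresh Γ (.all t) (.all t')
  | var {Γ a} : Fresh Γ (.fvar a) (.fvar a)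
  | fn {Γ x t₁ t₂ t₁' t₂'} : x ∉ Γ.fv → x ∉ t₂.fv → x ∉ t₁'.fv → x ∉ t₂'.fv → Fresh Γ t₁ t₁' →
      Fresh (.corp Γ x t₁') (t₂.opn 0 (.fvar x)) (t₂'.opn 0 (.fvar x)) →
      Fresh Γ (.fn t₁ t₂) (.fn t₁' t₂')
  | ifn {Γ x t₁ t₂ t₁' t₂'} : x ∉ Γ.fv → x ∉ t₂.fv → x ∉ t₁'.fv → x ∉ t₂'.fv → Fresh Γ t₁ t₁' →
      Fresh (.corp Γ x t₁') (t₂.opn 0 (.fvar x)) (t₂'.opn 0 (.fvar x)) →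
      Fresh Γ (.ifn t₁ t₂) (.ifn t₁' t₂')
  | sig {Γ x t₁ t₂ t₁' t₂'} : x ∉ Γ.fv → x ∉ t₂.fv → x ∉ t₁'.fv → x ∉ t₂'.fv → Fresh Γ t₁ t₁' →
      Fresh (.corp Γ x t₁') (t₂.opn 0 (.fvar x)) (t₂'.opn 0 (.fvar x)) →
      Fresh Γ (.sig t₁ t₂) (.sig t₁' t₂')

/-- Algorithmic subtyping `Γ ⊢ t₁ <: t₂ ⇝ c`. -/
inductive ASub {T : Theory} : Ctx T → Ty T → Ty T → Con T → Prop where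
  | base {Γ x b r₁ r₂} : x ∉ Γ.fv → x ∉ r₁.fv → x ∉ r₂.fv →
      ASub Γ (.refine b r₁) (.refine b r₂)
        (.all x b (r₁.opn 0 (.fvar x)) (.prop (r₂.opn 0 (.fvar x))))
  | all {Γ a t₁ t₂ c} : a ∉ Γ.ftv → a ∉ t₁.ftv → a ∉ t₂.ftv →
      ASub (.tvar Γ a) (t₁.opnT 0 (.fvar a)) (t₂.opnT 0 (.fvar a)) c →
      ASub Γ (.all t₁) (.all t₂) c
  | alpha {Γ a} : ASub Γ (.fvar a) (.fvar a) .tt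
  | fun {Γ x t₁ t₁' t₂ t₂' c c'} : x ∉ Γ.fv → x ∉ t₁'.fv → x ∉ t₂'.fv →
      ASub Γ t₂ t₁ c →
      ASub (.corp Γ x t₂) (t₁'.opn 0 (.fvar x)) (t₂'.opn 0 (.fvar x)) c' →
      ASub Γ (.fn t₁ t₁') (.fn t₂ t₂') (.and c (genImp x t₂ c'))
  | funIL {Γ z t₁ t₁' t₂ c} : z ∉ Γ.fv → z ∉ (Ty.ifn t₁ t₁').fv → z ∉ t₂.fv →
      ASub (.corp Γ z t₁) (t₁'.opn 0 (.fvar z)) t₂ c →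
      ASub Γ (.ifn t₁ t₁') t₂ (genEx z t₁ c)
  | funIR {Γ x t₁ t₂ t₂' c} : x ∉ Γ.fv → x ∉ t₁.fv → x ∉ t₂'.fv →
      ASub (.corp Γ x t₂) t₁ (t₂'.opn 0 (.fvar x)) c →
      ASub Γ t₁ (.ifn t₂ t₂') (genImp x t₂ c)
  | sigL {Γ x t₁ t₁' t₂ c} : x ∉ Γ.fv → x ∉ t₁'.fv → x ∉ t₂.fv →
      ASub (.corp Γ x t₁) (t₁'.opn 0 (.fvar x)) t₂ c →
      ASub Γ (.sig t₁ t₁') t₂ (genImp x t₁ c)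
  | sigR {Γ z t₁ t₂ t₂' c} : z ∉ Γ.fv → z ∉ t₁.fv → z ∉ (Ty.sig t₂ t₂').fv →
      ASub (.corp Γ z t₂) t₁ (t₂'.opn 0 (.fvar z)) c →
      ASub Γ t₁ (.sig t₂ t₂') (genEx z t₂ c)

/-! Program annotations are well-formed types in the context in which they stand; the annotation of
an implicit abstraction is a refined base type, as in a well-formed implicit function type.  These
requirements are the `Wf` and `IsBase` premises below. -/

mutual

/-- Checking `Γ ⊢ e ⇐ t ⇝ c`. -/
inductive Check {T : Theory} {P : Type} (tc : P → Ty T) :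
    Ctx T → Expr T P → Ty T → Con T → Prop where
  | sub {Γ e t t' c c'} : Synth tc Γ e t' c → ASub Γ t' t c' → Check tc Γ e t (.and c c')
  | letBase {Γ x τ s e₁ e₂ t c₁ c₂} : x ∉ Γ.fv → x ∉ s.fv → x ∉ e₂.fv → x ∉ t.fv →
      Wf Γ τ.toTy → Check tc Γ e₁ s c₁ → Check tc (.corp Γ x s) (e₂.opn 0 x) t c₂ →
      Fresh Γ τ.toTy s →
      Check tc Γ (.letB τ e₁ e₂) t (.and c₁ (genImp x s c₂))
  | letReft {Γ x tx e₁ e₂ t c₁ c₂} : x ∉ Γ.fv → x ∉ tx.fv → x ∉ e₁.fv → x ∉ e₂.fv → x ∉ t.fv →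
      Wf Γ tx → Check tc (.corp Γ x tx) (e₁.opn 0 x) tx c₁ →
      Check tc (.corp Γ x tx) (e₂.opn 0 x) t c₂ →
      Check tc Γ (.letR tx e₁ e₂) t (genImp x tx (.and c₁ c₂))
  | app {Γ e₁ e₂ t t' c₁ c₂} : Synth tc Γ e₁ t' c₁ → SpineCheck tc Γ t' e₂ t c₂ →
      Check tc Γ (.app e₁ e₂) t (.and c₁ c₂)
  | tabs {Γ a e t c} : a ∉ Γ.ftv → a ∉ e.ftv → a ∉ t.ftv →
      Check tc (.tvar Γ a) (e.opnT 0 a) (t.opnT 0 (.fvar a)) c →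
      Check tc Γ (.tabs e) (.all t) c
  | unpack {Γ x y e₁ e₂ t₁ t₂ t c₁ c₂} : x ∉ Γ.fv → y ∉ Γ.fv → x ≠ y →
      x ∉ (Ty.sig t₁ t₂).fv → y ∉ (Ty.sig t₁ t₂).fv →
      x ∉ e₂.fv → y ∉ e₂.fv → x ∉ t.fv → y ∉ t.fv →
      Synth tc Γ e₁ (.sig t₁ t₂) c₁ →
      Check tc (.corp (.ghost Γ x t₁) y (t₂.opn 0 (.fvar x))) ((e₂.opn 1 x).opn 0 y) t c₂ →
      Check tc Γ (.unpack e₁ e₂) t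
        (.and c₁ (genImp x t₁ (genImp y (t₂.opn 0 (.fvar x)) c₂)))

/-- Synthesis `Γ ⊢ e ⇒ t ⇝ c`. -/
inductive Synth {T : Theory} {P : Type} (tc : P → Ty T) :
    Ctx T → Expr T P → Ty T → Con T → Prop where
  | tabs {Γ a e t c} : a ∉ Γ.ftv → a ∉ e.ftv → a ∉ t.ftv →
      Synth tc (.tvar Γ a) (e.opnT 0 a) (t.opnT 0 (.fvar a)) c →
      Synth tc Γ (.tabs e) (.all t) c
  | tapp {Γ e t s τ c} : Wf Γ τ.toTy → Synth tc Γ e (.all t) c → Fresh Γ τ.toTy s →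
      Synth tc Γ (.tapp e τ) (t.opnT 0 s) c
  | con {Γ c} : Synth tc Γ (.con c) c.ty .tt
  | prim {Γ p} : Synth tc Γ (.prim p) (tc p) .tt
  | base {Γ x b r} : Γ.Mem x (.refine b r) → Synth tc Γ (.fvar x) (selfTy b r x) .tt
  | var {Γ x t} : Γ.Mem x t → Synth tc Γ (.fvar x) t .tt
  | absBase {Γ x τ s e t c} : x ∉ Γ.fv → x ∉ s.fv → x ∉ e.fv → x ∉ t.fv →
      Wf Γ τ.toTy → Synth tc (.corp Γ x s) (e.opn 0 x) (t.opn 0 (.fvar x)) c →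
      Fresh Γ τ.toTy s →
      Synth tc Γ (.lamB τ e) (.fn s t) (genImp x s c)
  | absReft {Γ x tx e t c} : x ∉ Γ.fv → x ∉ tx.fv → x ∉ e.fv → x ∉ t.fv →
      Wf Γ tx → Synth tc (.corp Γ x tx) (e.opn 0 x) (t.opn 0 (.fvar x)) c →
      Synth tc Γ (.lamR tx e) (.fn tx t) (genImp x tx c)
  | app {Γ e₁ e₂ t₁ t₂ c₁ c₂} : Synth tc Γ e₁ t₁ c₁ → SpineSynth tc Γ t₁ e₂ t₂ c₂ →
      Synth tc Γ (.app e₁ e₂) t₂ (.and c₁ c₂)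
  | absI {Γ x tx e t c} : x ∉ Γ.fv → x ∉ tx.fv → x ∉ e.fv → x ∉ t.fv →
      Wf Γ tx → tx.IsBase → Synth tc (.ghost Γ x tx) (e.opn 0 x) (t.opn 0 (.fvar x)) c →
      Synth tc Γ (.ilam tx e) (.ifn tx t) (genImp x tx c)
  | unpack {Γ x y e₁ e₂ t₁ t₂ t s c₁ c₂ c₃} : x ∉ Γ.fv → y ∉ Γ.fv → x ≠ y →
      x ∉ (Ty.sig t₁ t₂).fv → y ∉ (Ty.sig t₁ t₂).fv →
      x ∉ e₂.fv → y ∉ e₂.fv → x ∉ s.fv → y ∉ s.fv →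
      Synth tc Γ e₁ (.sig t₁ t₂) c₁ →
      Synth tc (.corp (.ghost Γ x t₁) y (t₂.opn 0 (.fvar x))) ((e₂.opn 1 x).opn 0 y) t c₂ →
      ASub (.corp (.ghost Γ x t₁) y (t₂.opn 0 (.fvar x))) t s c₃ →
      Fresh Γ t s →
      Synth tc Γ (.unpack e₁ e₂) s
        (.and c₁ (genImp x t₁ (genImp y (t₂.opn 0 (.fvar x)) (.and c₂ c₃))))
  | letBase {Γ x τ s s' e₁ e₂ t' c₁ c₂ c₃} : x ∉ Γ.fv → x ∉ s.fv → x ∉ e₂.fv → x ∉ s'.fv →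
      Wf Γ τ.toTy → Check tc Γ e₁ s c₁ → Synth tc (.corp Γ x s) (e₂.opn 0 x) t' c₂ →
      ASub (.corp Γ x s) t' s' c₃ → Fresh Γ τ.toTy s → Fresh Γ t' s' →
      Synth tc Γ (.letB τ e₁ e₂) s' (.and c₁ (genImp x s (.and c₂ c₃)))
  | letReft {Γ x tx e₁ e₂ t s c₁ c₂ c₃} :
      x ∉ Γ.fv → x ∉ tx.fv → x ∉ e₁.fv → x ∉ e₂.fv → x ∉ s.fv →
      Wf Γ tx → Check tc (.corp Γ x tx) (e₁.opn 0 x) tx c₁ →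
      Synth tc (.corp Γ x tx) (e₂.opn 0 x) t c₂ →
      ASub (.corp Γ x tx) t s c₃ → Fresh Γ t s →
      Synth tc Γ (.letR tx e₁ e₂) s (genImp x tx (.and c₁ (.and c₂ c₃)))

/-- Application checking `Γ ⊢ t ; e ⇐ t' ⇝ c`. -/
inductive SpineCheck {T : Theory} {P : Type} (tc : P → Ty T) :
    Ctx T → Ty T → Expr T P → Ty T → Con T → Prop where
  | funVar {Γ y tx t t' c₁ c₂} : Check tc Γ (.fvar y) tx c₁ →
      ASub Γ (t.opn 0 (.fvar y)) t' c₂ →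
      SpineCheck tc Γ (.fn tx t) (.fvar y) t' (.and c₁ c₂)
  | ifun {Γ z tx t e t' c} : z ∉ Γ.fv → z ∉ (Ty.ifn tx t).fv → z ∉ e.fv → z ∉ t'.fv →
      SpineCheck tc (.ghost Γ z tx) (t.opn 0 (.fvar z)) e t' c →
      SpineCheck tc Γ (.ifn tx t) e t' (genEx z tx c)
  | fun {Γ y tx t e te t' c₁ c₂ c₃} :
      y ∉ Γ.fv → y ∉ (Ty.fn tx t).fv → y ∉ e.fv → y ∉ te.fv → y ∉ t'.fv →
      Synth tc Γ e te c₁ → ASub Γ te tx c₂ →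
      ASub (.ghost Γ y te) (t.opn 0 (.fvar y)) t' c₃ →
      SpineCheck tc Γ (.fn tx t) e t' (.and c₁ (.and c₂ (genImp y te c₃)))

/-- Application synthesis `Γ ⊢ t ; e ⇒ t' ⇝ c`. -/
inductive SpineSynth {T : Theory} {P : Type} (tc : P → Ty T) :
    Ctx T → Ty T → Expr T P → Ty T → Con T → Prop where
  | funVar {Γ y tx t c} : Check tc Γ (.fvar y) tx c →
      SpineSynth tc Γ (.fn tx t) (.fvar y) (t.opn 0 (.fvar y)) c
  | fun {Γ y tx t e te s c₁ c₂ c₃} :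
      y ∉ Γ.fv → y ∉ (Ty.fn tx t).fv → y ∉ e.fv → y ∉ te.fv → y ∉ s.fv →
      Synth tc Γ e te c₁ → ASub Γ te tx c₂ →
      ASub (.ghost Γ y te) (t.opn 0 (.fvar y)) s c₃ → Fresh Γ (t.opn 0 (.fvar y)) s →
      SpineSynth tc Γ (.fn tx t) e s (.and c₁ (.and c₂ (genImp y te c₃)))
  | ifun {Γ z tx t e t' s c₁ c₂} :
      z ∉ Γ.fv → z ∉ (Ty.ifn tx t).fv → z ∉ e.fv → z ∉ s.fv →
      SpineSynth tc (.ghost Γ z tx) (t.opn 0 (.fvar z)) e t' c₁ →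
      ASub (.ghost Γ z tx) t' s c₂ → Fresh Γ t' s →
      SpineSynth tc Γ (.ifn tx t) e s (genEx z tx (.and c₁ c₂))

end

end IRT

namespace IRT

variable {T : Theory}

/-- Valuations of the free variables. -/
abbrev Env (T : Theory) := Var → Option (Σ b : T.B, b.Carrier T.Carrier)

theorem exists_fresh {s : Set ℕ} (hs : s.Finite) : ∃ x, x ∉ s := hs.exists_notMem

/-! ## Terms -/

namespace Term

/-- Simultaneous substitution for the free variables. -/
def sub (σ : Var → Term T) : Term T → Term T
  | .bvar i => .bvar i
  | .fvar x => σ x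
  | .con c => .con c
  | .app s t => .app (s.sub σ) (t.sub σ)

/-- No bound index occurs. -/
def LC : Term T → Prop
  | .bvar _ => False
  | .fvar _ => True
  | .con _ => True
  | .app s t => s.LC ∧ t.LC

theorem fv_finite (t : Term T) : t.fv.Finite := by
  induction t with
  | app s t hs ht => exact hs.union ht
  | _ => simp [fv]

theorem opn_lc {t : Term T} (h : t.LC) (k : ℕ) (u : Term T) : t.opn k u = t := by
  induction t with
  | bvar i => exact h.elim
  | app s t hs ht => simp [opn, hs h.1, ht h.2]
  | _ => rfl

theorem shift_lc {t : Term T} (h : t.LC) : t.shift = t := by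
  induction t with
  | bvar i => exact h.elim
  | app s t hs ht => simp [shift, hs h.1, ht h.2]
  | _ => rfl

theorem shift_opn_succ (t : Term T) {u : Term T} (hu : u.LC) (k : ℕ) :
    t.shift.opn (k + 1) u = (t.opn k u).shift := by
  induction t with
  | bvar i =>
    by_cases h : i = k <;> simp [shift, opn, h, shift_lc hu]
  | app s t hs ht => simp [shift, opn, hs, ht]
  | _ => rfl

theorem fv_opn_subset (t : Term T) (k : ℕ) (u : Term T) : (t.opn k u).fv ⊆ t.fv ∪ u.fv := by
  induction t with
  | bvar i => by_cases h : i = k <;> simp [opn, h, fv]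
  | app s t hs ht =>
    intro x hx
    rcases hx with hx | hx
    · rcases hs hx with h | h <;> simp [fv, h]
    · rcases ht hx with h | h <;> simp [fv, h]
  | _ => simp [opn]

theorem fv_shift (t : Term T) : t.shift.fv = t.fv := by
  induction t with
  | app s t hs ht => simp [shift, fv, hs, ht]
  | _ => rfl

theorem sub_opn {σ : Var → Term T} (hσ : ∀ x, (σ x).LC) (t : Term T) (k : ℕ) (u : Term T) :
    (t.opn k u).sub σ = (t.sub σ).opn k (u.sub σ) := by
  induction t with
  | bvar i => by_cases h : i = k <;> simp [opn, sub, h]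
  | fvar x => simp [opn, sub, opn_lc (hσ x)]
  | app s t hs ht => simp [opn, sub, hs, ht]
  | con c => rfl

theorem sub_congr {σ τ : Var → Term T} {t : Term T} (h : ∀ x ∈ t.fv, σ x = τ x) :
    t.sub σ = t.sub τ := by
  induction t with
  | fvar x => exact h x rfl
  | app s t hs ht =>
    simp [sub, hs fun x hx => h x (Or.inl hx), ht fun x hx => h x (Or.inr hx)]
  | _ => rfl

theorem sub_fvar (t : Term T) : t.sub .fvar = t := by
  induction t with
  | app s t hs ht => simp [sub, hs, ht]
  | _ => rfl

theorem mem_fv_sub {σ : Var → Term T} {t : Term T} {x : Var} :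
    x ∈ (t.sub σ).fv ↔ ∃ y ∈ t.fv, x ∈ (σ y).fv := by
  induction t with
  | app s t hs ht => simp [sub, fv, hs, ht, or_and_right, exists_or]
  | _ => simp [sub, fv]

theorem sub_sub (σ τ : Var → Term T) (t : Term T) :
    (t.sub σ).sub τ = t.sub fun x => (σ x).sub τ := by
  induction t with
  | app s t hs ht => simp [sub, hs, ht]
  | _ => rfl

theorem subst_eq_sub (t : Term T) (x : Var) (u : Term T) :
    t.subst x u = t.sub (Function.update .fvar x u) := by
  induction t with
  | fvar y => by_cases h : y = x <;> simp [subst, sub, h]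
  | app s t hs ht => simp [subst, sub, hs, ht]
  | _ => rfl

theorem subst_sub (t : Term T) (x : Var) (u : Term T) (σ : Var → Term T) :
    (t.subst x u).sub σ = t.sub (Function.update σ x (u.sub σ)) := by
  rw [subst_eq_sub, sub_sub]
  congr 1
  funext y
  by_cases h : y = x
  · subst h; simp
  · simp [h, sub]

theorem sub_inst (σ : Var → Term T) {q : Term T} (hq : q.fv = ∅) (as : List (Term T)) :
    (q.inst as).sub σ = q.inst (as.map fun a => a.sub σ) := by
  induction q with
  | bvar i =>
    simp only [inst, List.getElem?_map]
    cases as[i]? <;> simp [sub]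
  | fvar x => simp [fv] at hq
  | con c => rfl
  | app s t hs ht =>
    simp only [fv, Set.union_empty_iff] at hq
    simp [inst, sub, hs hq.1, ht hq.2]

theorem fv_inst {q : Term T} (hq : q.fv = ∅) (as : List (Term T)) {x : Var}
    (hx : x ∈ (q.inst as).fv) : ∃ a ∈ as, x ∈ a.fv := by
  induction q with
  | bvar i =>
    simp only [inst] at hx
    cases h : as[i]? with
    | none => simp [h, fv] at hx
    | some a =>
      simp only [h, Option.getD_some] at hx
      exact ⟨a, List.mem_of_getElem? h, hx⟩
  | fvar x => simp [fv] at hq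
  | con c => simp [inst, fv] at hx
  | app s t hs ht =>
    simp only [fv, Set.union_empty_iff] at hq
    rcases hx with h | h
    · exact hs hq.1 h
    · exact ht hq.2 h

/-- All bound indices are below `n`. -/
def Bounded (n : ℕ) : Term T → Prop
  | .bvar i => i < n
  | .fvar _ => True
  | .con _ => True
  | .app s t => s.Bounded n ∧ t.Bounded n

theorem opn_inst {q : Term T} {as : List (Term T)} (hq : q.fv = ∅) (hb : q.Bounded as.length)
    (k : ℕ) (u : Term T) :
    (q.inst as).opn k u = q.inst (as.map fun a => a.opn k u) := by
  induction q with
  | bvar i =>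
    simp only [Bounded] at hb
    simp [inst, hb]
  | fvar x => simp [fv] at hq
  | con c => rfl
  | app s t hs ht =>
    simp only [fv, Set.union_empty_iff] at hq
    simp [inst, opn, hs hq.1 hb.1, ht hq.2 hb.2]

theorem toExpr_fv {P : Type} (t : Term T) : (t.toExpr : Expr T P).fv = t.fv := by
  induction t with
  | app s t hs ht => simp [toExpr, Expr.fv, fv, hs, ht]
  | _ => rfl

end Term

/-! ## Sorting -/

namespace HasSort

variable {S S' : Var → Option T.B} {L L' : List (Option T.B)} {t u : Term T} {s : T.S}

theorem mono (h : HasSort S L t s) (hS : ∀ x b, S x = some b → S' x = some b)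
    (hL : ∀ (i : ℕ) b, L[i]? = some (some b) → L'[i]? = some (some b)) : HasSort S' L' t s := by
  induction h with
  | bvar h => exact .bvar (hL _ _ h)
  | fvar h => exact .fvar (hS _ _ h)
  | con => exact .con
  | app _ _ h₁ h₂ => exact .app h₁ h₂

theorem mono_sort (h : HasSort S L t s) (hS : ∀ x b, S x = some b → S' x = some b) :
    HasSort S' L t s := h.mono hS fun _ _ h => h

theorem lc (h : HasSort S [] t s) : t.LC := by
  induction h with
  | bvar h => simp at h
  | fvar h => trivial
  | con => trivial
  | app _ _ h₁ h₂ => exact ⟨h₁, h₂⟩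

theorem weaken (h : HasSort S [] t s) : HasSort S L t s :=
  h.mono (fun _ _ h => h) (by simp)

theorem bounded (h : HasSort S L t s) : t.Bounded L.length := by
  induction h with
  | bvar h => exact (List.getElem?_eq_some_iff.1 h).1
  | fvar h => trivial
  | con => trivial
  | app _ _ h₁ h₂ => exact ⟨h₁, h₂⟩

theorem mem_dom (h : HasSort S L t s) {x : Var} (hx : x ∈ t.fv) : ∃ b, S x = some b := by
  induction h with
  | bvar h => simp [Term.fv] at hx
  | fvar h => exact ⟨_, (Set.mem_singleton_iff.1 hx) ▸ h⟩
  | con => simp [Term.fv] at hx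
  | app _ _ h₁ h₂ => exact hx.elim h₁ h₂

theorem fv_empty (h : HasSort (fun _ => none) L t s) : t.fv = ∅ := by
  ext x
  refine ⟨fun hx => ?_, fun hx => hx.elim⟩
  obtain ⟨b, hb⟩ := h.mem_dom hx
  simp at hb

theorem sub {σ : Var → Term T} (h : HasSort S L t s)
    (hσ : ∀ x b, S x = some b → HasSort S' [] (σ x) (.base b)) : HasSort S' L (t.sub σ) s := by
  induction h with
  | bvar h => exact .bvar h
  | fvar h => exact (hσ _ _ h).weaken
  | con => exact .con
  | app _ _ h₁ h₂ => exact .app h₁ h₂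

theorem opn {l : Option T.B} (h : HasSort S (L ++ [l]) t s)
    (hu : ∀ b, l = some b → HasSort S [] u (.base b)) :
    HasSort S L (t.opn L.length u) s := by
  induction h with
  | @bvar i b h =>
    by_cases hi : i = L.length
    · subst hi
      simp at h
      simpa [Term.opn] using (hu _ h).weaken
    · simp only [Term.opn, if_neg hi]
      have := (List.getElem?_eq_some_iff.1 h).1
      simp only [List.length_append, List.length_singleton] at this
      rw [List.getElem?_append_left (by omega)] at h
      exact .bvar h
  | fvar h => exact .fvar h
  | con => exact .con
  | app _ _ h₁ h₂ => exact .app h₁ h₂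

theorem close {x : Var} {l : Option T.B} (hx : x ∉ t.fv)
    (h : HasSort (Function.update S x l) L (t.opn L.length (.fvar x)) s) :
    HasSort S (L ++ [l]) t s := by
  induction t generalizing s with
  | bvar i =>
    by_cases hi : i = L.length
    · simp only [Term.opn, if_pos hi] at h
      cases h with
      | fvar h =>
        simp only [Function.update_self] at h
        subst h
        exact .bvar (by simp [hi])
    · simp only [Term.opn, if_neg hi] at h
      cases h with
      | bvar h =>
        refine .bvar ?_
        rw [List.getElem?_append_left (List.getElem?_eq_some_iff.1 h).1]
        exact h
  | fvar y =>
    cases h with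
    | fvar h =>
      refine .fvar ?_
      rwa [Function.update_of_ne (by rintro rfl; exact hx rfl)] at h
  | con c => cases h; exact .con
  | app t u ht hu =>
    cases h with
    | app h₁ h₂ =>
      exact .app (ht (fun h => hx (Or.inl h)) h₁) (hu (fun h => hx (Or.inr h)) h₂)

theorem inst {as : List (Term T)} (h : HasSort (fun _ => none) L' t s)
    (has : ∀ (i : ℕ) b, L'[i]? = some (some b) → ∃ a, as[i]? = some a ∧ HasSort S L a (.base b)) :
    HasSort S L (t.inst as) s := by
  induction h with
  | bvar h =>
    obtain ⟨a, ha, hs⟩ := has _ _ h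
    simpa [Term.inst, ha] using hs
  | fvar h => simp at h
  | con => exact .con
  | app _ _ h₁ h₂ => exact .app h₁ h₂

theorem con' {c : Const T} {s : T.S} (h : c.sort = s) : HasSort S L (.con c) s := h ▸ .con

theorem eq {b : T.B} (h₁ : HasSort S L t (.base b)) (h₂ : HasSort S L u (.base b)) :
    HasSort S L (.eq b t u) (.base .bool) :=
  .app (.app (con' rfl) h₁) h₂

end HasSort

/-! ## Evaluation -/

/-- `ρ` gives a value of the right sort to each variable that `S` sorts. -/
def Models (S : Var → Option T.B) (ρ : Env T) : Prop :=
  ∀ x b, S x = some b → ∃ a, ρ x = some ⟨b, a⟩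

theorem HasSort.eval {S : Var → Option T.B} {ρ : Env T} {t : Term T} {s : T.S}
    (h : HasSort S [] t s) (hρ : Models S ρ) : ∃ d, t.eval ρ = some ⟨s, d⟩ := by
  induction h with
  | bvar h => simp at h
  | fvar h =>
    obtain ⟨a, ha⟩ := hρ _ _ h
    exact ⟨a, by simp [Term.eval, ha]⟩
  | con => exact ⟨_, rfl⟩
  | app _ _ h₁ h₂ =>
    obtain ⟨f, hf⟩ := h₁
    obtain ⟨a, ha⟩ := h₂
    exact ⟨f a, by simp [Term.eval, hf, ha]⟩

theorem HasSort.eval_base {S : Var → Option T.B} {ρ : Env T} {t : Term T} {b : T.B}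
    (h : HasSort S [] t (.base b)) (hρ : Models S ρ) :
    ∃ a : b.Carrier T.Carrier, t.eval ρ = some ⟨.base b, a⟩ := h.eval hρ

theorem Term.eval_congr {ρ ρ' : Env T} {t : Term T} (h : ∀ x ∈ t.fv, ρ x = ρ' x) :
    t.eval ρ = t.eval ρ' := by
  induction t with
  | fvar x => simp [eval, h x rfl]
  | app s t hs ht =>
    simp only [eval, hs fun x hx => h x (Or.inl hx), ht fun x hx => h x (Or.inr hx)]
  | _ => rfl

theorem Term.eval_eq_bool {ρ : Env T} {b : T.B} {t u : Term T} {x y : b.Carrier T.Carrier}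
    (ht : t.eval ρ = some ⟨.base b, x⟩) (hu : u.eval ρ = some ⟨.base b, y⟩) :
    (Term.eq b t u).eval ρ = some ⟨.base .bool, true⟩ ↔ x = y := by
  classical
  have : (Term.eq b t u).eval ρ = some ⟨.base .bool, (decide (x = y) : Bool)⟩ := by
    simp [Term.eq, Term.eval, ht, hu, Const.sort, Const.den]
  rw [this]
  constructor
  · intro h
    have h' : (decide (x = y) : Bool) = true := by
      have := eq_of_heq (Sigma.mk.inj (Option.some.inj h)).2
      exact this
    exact of_decide_eq_true h'
  · intro h
    have : (decide (x = y) : Bool) = true := decide_eq_true h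
    rw [this]

end IRT

namespace IRT

variable {T : Theory}

/-! ## Total second-order substitutions -/

/-- A closed predicate for each predicate variable. -/
abbrev SOSub (T : Theory) := KVar T → Term T

def SOSub.WS (D : SOSub T) : Prop :=
  ∀ κ, HasSort (fun _ => none) κ.sorts (D κ) (.base .bool)

namespace Refn

def sub (σ : Var → Term T) : Refn T → Refn T
  | .pred r => .pred (r.sub σ)
  | .kapp κ as => .kapp κ (as.map fun a => a.sub σ)
  | .and p q => .and (p.sub σ) (q.sub σ)

/-- Replace all predicate variables as `D` says. -/
def so (D : SOSub T) : Refn T → Refn T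
  | .pred r => .pred r
  | .kapp κ as => if as.length = κ.sorts.length then .pred ((D κ).inst as) else .kapp κ as
  | .and p q => .and (p.so D) (q.so D)

theorem fv_finite (p : Refn T) : p.fv.Finite := by
  induction p with
  | pred r => exact r.fv_finite
  | kapp κ as =>
    have : (Refn.kapp κ as).fv = ⋃ a ∈ {a | a ∈ as}, a.fv := by ext; simp [fv]
    rw [this]
    exact (List.finite_toSet as).biUnion fun a _ => a.fv_finite
  | and p q hp hq => exact hp.union hq

theorem fv_opn_subset (p : Refn T) (k : ℕ) (u : Term T) : (p.opn k u).fv ⊆ p.fv ∪ u.fv := by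
  induction p with
  | pred r => exact r.fv_opn_subset k u
  | kapp κ as =>
    rintro x ⟨a, ha, hx⟩
    obtain ⟨a', ha', rfl⟩ := List.mem_map.1 ha
    exact (a'.fv_opn_subset k u hx).imp (fun h => ⟨a', ha', h⟩) id
  | and p q hp hq =>
    rintro x (hx | hx)
    · exact (hp hx).imp Or.inl id
    · exact (hq hx).imp Or.inr id

theorem sub_opn {σ : Var → Term T} (hσ : ∀ x, (σ x).LC) (p : Refn T) (k : ℕ) (u : Term T) :
    (p.opn k u).sub σ = (p.sub σ).opn k (u.sub σ) := by
  induction p with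
  | pred r => simp [opn, sub, Term.sub_opn hσ]
  | kapp κ as => simp [opn, sub, Term.sub_opn hσ]
  | and p q hp hq => simp [opn, sub, hp, hq]

theorem sub_congr {σ τ : Var → Term T} {p : Refn T} (h : ∀ x ∈ p.fv, σ x = τ x) :
    p.sub σ = p.sub τ := by
  induction p with
  | pred r => simp [sub, Term.sub_congr h]
  | kapp κ as =>
    simp only [sub, kapp.injEq, true_and]
    exact List.map_congr_left fun a ha => Term.sub_congr fun x hx => h x ⟨a, ha, hx⟩
  | and p q hp hq =>
    simp [sub, hp fun x hx => h x (Or.inl hx), hq fun x hx => h x (Or.inr hx)]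

theorem sub_fvar (p : Refn T) : p.sub .fvar = p := by
  induction p with
  | pred r => simp [sub, Term.sub_fvar]
  | kapp κ as => simp [sub, Term.sub_fvar]
  | and p q hp hq => simp [sub, hp, hq]

theorem mem_fv_sub {σ : Var → Term T} {p : Refn T} {x : Var} :
    x ∈ (p.sub σ).fv ↔ ∃ y ∈ p.fv, x ∈ (σ y).fv := by
  induction p with
  | pred r => exact Term.mem_fv_sub
  | kapp κ as =>
    simp only [sub, fv, List.mem_map, Set.mem_ofPred_eq, exists_exists_and_eq_and, Term.mem_fv_sub]
    constructor
    · rintro ⟨a, ha, y, hy, hx⟩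
      exact ⟨y, ⟨a, ha, hy⟩, hx⟩
    · rintro ⟨y, ⟨a, ha, hy⟩, hx⟩
      exact ⟨a, ha, y, hy, hx⟩
  | and p q hp hq => simp [sub, fv, hp, hq, or_and_right, exists_or]

theorem subst_sub (p : Refn T) (x : Var) (u : Term T) (σ : Var → Term T) :
    (p.subst x u).sub σ = p.sub (Function.update σ x (u.sub σ)) := by
  induction p with
  | pred r => simp [subst, sub, Term.subst_sub]
  | kapp κ as => simp [subst, sub, Term.subst_sub]
  | and p q hp hq => simp [subst, sub, hp, hq]

theorem subst_eq_sub (p : Refn T) (x : Var) (u : Term T) :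
    p.subst x u = p.sub (Function.update .fvar x u) := by
  rw [← sub_fvar (p.subst x u), subst_sub, Term.sub_fvar]

theorem so_opn {D : SOSub T} (hD : D.WS) (p : Refn T) (k : ℕ) (u : Term T) :
    (p.opn k u).so D = (p.so D).opn k u := by
  induction p with
  | pred r => rfl
  | kapp κ as =>
    simp only [opn, so, List.length_map]
    by_cases h : as.length = κ.sorts.length
    · simp only [h, if_true, opn, pred.injEq]
      rw [Term.opn_inst (hD κ).fv_empty (h ▸ (hD κ).bounded)]
    · simp [h, opn]
  | and p q hp hq => simp [opn, so, hp, hq]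

theorem so_sub {D : SOSub T} (hD : D.WS) (p : Refn T) (σ : Var → Term T) :
    (p.sub σ).so D = (p.so D).sub σ := by
  induction p with
  | pred r => rfl
  | kapp κ as =>
    simp only [sub, so, List.length_map]
    by_cases h : as.length = κ.sorts.length
    · simp only [h, if_true, sub, pred.injEq]
      rw [Term.sub_inst _ (hD κ).fv_empty]
    · simp [h, sub]
  | and p q hp hq => simp [sub, so, hp, hq]

theorem fv_so_subset {D : SOSub T} (hD : D.WS) (p : Refn T) : (p.so D).fv ⊆ p.fv := by
  induction p with
  | pred r => exact subset_rfl
  | kapp κ as =>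
    simp only [so]
    by_cases h : as.length = κ.sorts.length
    · simp only [h, if_true]
      exact fun x hx => Term.fv_inst (hD κ).fv_empty as hx
    · simp [h]
  | and p q hp hq => exact Set.union_subset_union hp hq

theorem so_of_kvars {D : SOSub T} {p : Refn T} (h : p.kvars = ∅) : p.so D = p := by
  induction p with
  | pred r => rfl
  | kapp κ as => simp [kvars] at h
  | and p q hp hq =>
    simp only [kvars, Set.union_empty_iff] at h
    simp [so, hp h.1, hq h.2]

namespace WS

variable {S S' : Var → Option T.B} {L L' : List (Option T.B)} {p : Refn T}

theorem mono (h : p.WS S L) (hS : ∀ x b, S x = some b → S' x = some b)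
    (hL : ∀ (i : ℕ) b, L[i]? = some (some b) → L'[i]? = some (some b)) : p.WS S' L' := by
  induction p with
  | pred r => exact HasSort.mono h hS hL
  | kapp κ as => exact h
  | and p q hp hq => exact ⟨hp h.1, hq h.2⟩

theorem mono_sort (h : p.WS S L) (hS : ∀ x b, S x = some b → S' x = some b) : p.WS S' L :=
  h.mono hS fun _ _ h => h

theorem sub {σ : Var → Term T} (h : p.WS S L)
    (hσ : ∀ x b, S x = some b → HasSort S' [] (σ x) (.base b)) : (p.sub σ).WS S' L := by
  induction p with
  | pred r => exact HasSort.sub h hσ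
  | kapp κ as => exact h
  | and p q hp hq => exact ⟨hp h.1, hq h.2⟩

theorem opn {l : Option T.B} {u : Term T} (h : p.WS S (L ++ [l]))
    (hu : ∀ b, l = some b → HasSort S [] u (.base b)) : (p.opn L.length u).WS S L := by
  induction p with
  | pred r => exact HasSort.opn h hu
  | kapp κ as => exact h
  | and p q hp hq => exact ⟨hp h.1, hq h.2⟩

theorem opn_zero {l : Option T.B} {u : Term T} (h : p.WS S [l])
    (hu : ∀ b, l = some b → HasSort S [] u (.base b)) : (p.opn 0 u).WS S [] :=
  opn (L := []) h hu

theorem close {x : Var} {l : Option T.B} (hx : x ∉ p.fv)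
    (h : (p.opn L.length (.fvar x)).WS (Function.update S x l) L) : p.WS S (L ++ [l]) := by
  induction p with
  | pred r => exact HasSort.close hx h
  | kapp κ as => exact h
  | and p q hp hq =>
    exact ⟨hp (fun h => hx (Or.inl h)) h.1, hq (fun h => hx (Or.inr h)) h.2⟩

theorem mem_dom (h : p.WS S L) {x : Var} (hx : x ∈ p.fv) : ∃ b, S x = some b := by
  induction p with
  | pred r => exact HasSort.mem_dom h hx
  | kapp κ as => exact h.elim
  | and p q hp hq => exact hx.elim (hp h.1) (hq h.2)

theorem kvars (h : p.WS S L) : p.kvars = ∅ := by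
  induction p with
  | pred r => rfl
  | kapp κ as => exact h.elim
  | and p q hp hq => simp [Refn.kvars, hp h.1, hq h.2]

end WS

theorem Holds_congr {ρ ρ' : Env T} {p : Refn T} (h : ∀ x ∈ p.fv, ρ x = ρ' x) :
    p.Holds ρ ↔ p.Holds ρ' := by
  induction p with
  | pred r => simp [Holds, Term.eval_congr h]
  | kapp κ as => rfl
  | and p q hp hq =>
    simp [Holds, hp fun x hx => h x (Or.inl hx), hq fun x hx => h x (Or.inr hx)]

end Refn

/-! ## Types -/

theorem STy.base?_opnT (τ : STy T) (k : ℕ) (a : TVar) :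
    (τ.opnT k (.fvar a)).base? = τ.base? := by
  cases τ with
  | bvar i => by_cases h : i = k <;> simp [opnT, base?, h]
  | _ => rfl

namespace Ty

def sub (σ : Var → Term T) : Ty T → Ty T
  | .refine b r => .refine b (r.sub σ)
  | .fn t s => .fn (t.sub σ) (s.sub σ)
  | .ifn t s => .ifn (t.sub σ) (s.sub σ)
  | .sig t s => .sig (t.sub σ) (s.sub σ)
  | .bvar i => .bvar i
  | .fvar a => .fvar a
  | .all t => .all (t.sub σ)

def so (D : SOSub T) : Ty T → Ty T
  | .refine b r => .refine b (r.so D)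
  | .fn t s => .fn (t.so D) (s.so D)
  | .ifn t s => .ifn (t.so D) (s.so D)
  | .sig t s => .sig (t.so D) (s.so D)
  | .bvar i => .bvar i
  | .fvar a => .fvar a
  | .all t => .all (t.so D)

def size : Ty T → ℕ
  | .refine _ _ => 0
  | .fn t s => t.size + s.size + 1
  | .ifn t s => t.size + s.size + 1
  | .sig t s => t.size + s.size + 1
  | .bvar _ => 0
  | .fvar _ => 0
  | .all t => t.size + 1

theorem size_opn (t : Ty T) (k : ℕ) (u : Term T) : (t.opn k u).size = t.size := by
  induction t generalizing k <;> simp [opn, size, *]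

theorem size_opnT (t : Ty T) (k : ℕ) (a : TVar) : (t.opnT k (.fvar a)).size = t.size := by
  induction t generalizing k with
  | bvar i => by_cases h : i = k <;> simp [opnT, size, h]
  | _ => simp [opnT, size, *]

theorem fv_finite (t : Ty T) : t.fv.Finite := by
  induction t with
  | refine b r => exact r.fv_finite
  | fn _ _ h₁ h₂ | ifn _ _ h₁ h₂ | sig _ _ h₁ h₂ => exact h₁.union h₂
  | bvar | fvar => exact Set.finite_empty
  | all _ h => exact h

theorem ftv_finite (t : Ty T) : t.ftv.Finite := by
  induction t with
  | fn _ _ h₁ h₂ | ifn _ _ h₁ h₂ | sig _ _ h₁ h₂ => exact h₁.union h₂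
  | refine | bvar => exact Set.finite_empty
  | fvar a => exact Set.finite_singleton a
  | all _ h => exact h

theorem fv_opn_subset (t : Ty T) (k : ℕ) (u : Term T) : (t.opn k u).fv ⊆ t.fv ∪ u.fv := by
  induction t generalizing k with
  | refine b r => exact r.fv_opn_subset _ u
  | fn _ _ h₁ h₂ | ifn _ _ h₁ h₂ | sig _ _ h₁ h₂ =>
    rintro x (hx | hx)
    · exact (h₁ _ hx).imp Or.inl id
    · exact (h₂ _ hx).imp Or.inr id
  | bvar | fvar => simp [opn, fv]
  | all _ h => exact h _

theorem fv_opnT (t : Ty T) (k : ℕ) (a : TVar) : (t.opnT k (.fvar a)).fv = t.fv := by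
  induction t generalizing k with
  | bvar i => by_cases h : i = k <;> simp [opnT, fv, h]
  | _ => simp [opnT, fv, *]

theorem sub_opn {σ : Var → Term T} (hσ : ∀ x, (σ x).LC) (t : Ty T) (k : ℕ) (u : Term T) :
    (t.opn k u).sub σ = (t.sub σ).opn k (u.sub σ) := by
  induction t generalizing k <;> simp [opn, sub, Refn.sub_opn hσ, *]

theorem sub_opnT (σ : Var → Term T) (t : Ty T) (k : ℕ) (u : Ty T) :
    (t.opnT k u).sub σ = (t.sub σ).opnT k (u.sub σ) := by
  induction t generalizing k with
  | bvar i => by_cases h : i = k <;> simp [opnT, sub, h]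
  | _ => simp [opnT, sub, *]

theorem sub_congr {σ τ : Var → Term T} {t : Ty T} (h : ∀ x ∈ t.fv, σ x = τ x) :
    t.sub σ = t.sub τ := by
  induction t with
  | refine b r => simp [sub, Refn.sub_congr h]
  | fn _ _ h₁ h₂ | ifn _ _ h₁ h₂ | sig _ _ h₁ h₂ =>
    simp [sub, h₁ fun x hx => h x (Or.inl hx), h₂ fun x hx => h x (Or.inr hx)]
  | bvar | fvar => rfl
  | all _ ih => simp [sub, ih h]

theorem sub_fvar (t : Ty T) : t.sub .fvar = t := by
  induction t <;> simp [sub, Refn.sub_fvar, *]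

theorem sub_eq_self {σ : Var → Term T} {t : Ty T} (h : ∀ x ∈ t.fv, σ x = .fvar x) :
    t.sub σ = t := (sub_congr h).trans t.sub_fvar

theorem mem_fv_sub {σ : Var → Term T} {t : Ty T} {x : Var} :
    x ∈ (t.sub σ).fv ↔ ∃ y ∈ t.fv, x ∈ (σ y).fv := by
  induction t with
  | refine b r => exact Refn.mem_fv_sub
  | fn _ _ h₁ h₂ | ifn _ _ h₁ h₂ | sig _ _ h₁ h₂ =>
    simp [sub, fv, h₁, h₂, or_and_right, exists_or]
  | bvar | fvar => simp [sub, fv]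
  | all _ h => exact h

theorem ftv_sub (σ : Var → Term T) (t : Ty T) : (t.sub σ).ftv = t.ftv := by
  induction t <;> simp [sub, ftv, *]

theorem so_opn {D : SOSub T} (hD : D.WS) (t : Ty T) (k : ℕ) (u : Term T) :
    (t.opn k u).so D = (t.so D).opn k u := by
  induction t generalizing k <;> simp [opn, so, Refn.so_opn hD, *]

theorem so_opnT (D : SOSub T) (t : Ty T) (k : ℕ) (u : Ty T) :
    (t.opnT k u).so D = (t.so D).opnT k (u.so D) := by
  induction t generalizing k with
  | bvar i => by_cases h : i = k <;> simp [opnT, so, h]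
  | _ => simp [opnT, so, *]

theorem fv_so_subset {D : SOSub T} (hD : D.WS) (t : Ty T) : (t.so D).fv ⊆ t.fv := by
  induction t with
  | refine b r => exact r.fv_so_subset hD
  | fn _ _ h₁ h₂ | ifn _ _ h₁ h₂ | sig _ _ h₁ h₂ => exact Set.union_subset_union h₁ h₂
  | bvar | fvar => exact subset_rfl
  | all _ h => exact h

theorem ftv_so (D : SOSub T) (t : Ty T) : (t.so D).ftv = t.ftv := by
  induction t <;> simp [so, ftv, *]

theorem so_of_kvars {D : SOSub T} {t : Ty T} (h : t.kvars = ∅) : t.so D = t := by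
  induction t with
  | refine b r => simp [so, Refn.so_of_kvars h]
  | fn _ _ h₁ h₂ | ifn _ _ h₁ h₂ | sig _ _ h₁ h₂ =>
    simp only [kvars, Set.union_empty_iff] at h
    simp [so, h₁ h.1, h₂ h.2]
  | bvar | fvar => rfl
  | all _ ih => simp [so, ih h]

theorem forget_opn (t : Ty T) (k : ℕ) (u : Term T) : (t.opn k u).forget = t.forget := by
  induction t generalizing k <;> simp [opn, forget, *]

theorem forget_opnT (t : Ty T) (k : ℕ) (u : Ty T) :
    (t.opnT k u).forget = t.forget.opnT k u.forget := by
  induction t generalizing k with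
  | bvar i => by_cases h : i = k <;> simp [opnT, STy.opnT, forget, h]
  | _ => simp [opnT, STy.opnT, forget, *]

theorem forget_sub (σ : Var → Term T) (t : Ty T) : (t.sub σ).forget = t.forget := by
  induction t <;> simp [sub, forget, *]

theorem forget_so (D : SOSub T) (t : Ty T) : (t.so D).forget = t.forget := by
  induction t <;> simp [so, forget, *]

theorem IsBase.opn {t : Ty T} (h : t.IsBase) (k : ℕ) (u : Term T) : (t.opn k u).IsBase := by
  obtain ⟨b, r, rfl⟩ := h
  exact ⟨_, _, rfl⟩

theorem IsBase.opnT {t : Ty T} (h : t.IsBase) (k : ℕ) (u : Ty T) : (t.opnT k u).IsBase := by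
  obtain ⟨b, r, rfl⟩ := h
  exact ⟨_, _, rfl⟩

theorem IsBase.sub {t : Ty T} (h : t.IsBase) (σ : Var → Term T) : (t.sub σ).IsBase := by
  obtain ⟨b, r, rfl⟩ := h
  exact ⟨_, _, rfl⟩

theorem isBase_of_opn {t : Ty T} {k : ℕ} {u : Term T} (h : (t.opn k u).IsBase) : t.IsBase := by
  obtain ⟨b, r, h⟩ := h
  cases t <;> simp [Ty.opn] at h
  exact ⟨_, _, rfl⟩

theorem isBase_of_opnT {t : Ty T} {k : ℕ} {a : TVar} (h : (t.opnT k (.fvar a)).IsBase) :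
    t.IsBase := by
  obtain ⟨b, r, h⟩ := h
  cases t with
  | bvar i => by_cases hi : i = k <;> simp [Ty.opnT, hi] at h
  | refine b r => exact ⟨_, _, rfl⟩
  | _ => simp [Ty.opnT] at h

theorem isBase_so {D : SOSub T} {t : Ty T} : (t.so D).IsBase ↔ t.IsBase := by
  constructor <;> rintro ⟨b, r, h⟩
  · cases t <;> simp [so] at h
    exact ⟨_, _, rfl⟩
  · subst h
    exact ⟨_, _, rfl⟩

/-! ## Well-formedness without names -/

/-- Well-formedness over sorted variables `S` and type variables `A`, below binders whose sorts are
listed in `L` and below `n` type binders. -/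
def WfB (S : Var → Option T.B) (A : Set TVar) : List (Option T.B) → ℕ → Ty T → Prop
  | L, _, .refine b r => r.WS S (some b :: L)
  | L, n, .fn t u => t.WfB S A L n ∧ u.WfB S A (t.forget.base? :: L) n
  | L, n, .ifn t u => t.IsBase ∧ t.WfB S A L n ∧ u.WfB S A (t.forget.base? :: L) n
  | L, n, .sig t u => t.IsBase ∧ t.WfB S A L n ∧ u.WfB S A (t.forget.base? :: L) n
  | _, n, .bvar i => i < n
  | _, _, .fvar a => a ∈ A
  | L, n, .all t => t.WfB S A L (n + 1)

namespace WfB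

variable {S S' : Var → Option T.B} {A A' : Set TVar} {L L' : List (Option T.B)} {n m : ℕ}
  {t s : Ty T}

theorem cons_mono {l : Option T.B}
    (hL : ∀ (i : ℕ) b, L[i]? = some (some b) → L'[i]? = some (some b)) :
    ∀ (i : ℕ) b, (l :: L)[i]? = some (some b) → (l :: L')[i]? = some (some b)
  | 0, _, h => h
  | i + 1, b, h => hL i b h

theorem mono (h : t.WfB S A L n) (hS : ∀ x b, S x = some b → S' x = some b) (hA : A ⊆ A')
    (hL : ∀ (i : ℕ) b, L[i]? = some (some b) → L'[i]? = some (some b)) (hn : n ≤ m) :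
    t.WfB S' A' L' m := by
  induction t generalizing L L' n m with
  | refine b r => exact Refn.WS.mono h hS (cons_mono hL)
  | fn _ _ h₁ h₂ => exact ⟨h₁ h.1 hL hn, h₂ h.2 (cons_mono hL) hn⟩
  | ifn _ _ h₁ h₂ | sig _ _ h₁ h₂ => exact ⟨h.1, h₁ h.2.1 hL hn, h₂ h.2.2 (cons_mono hL) hn⟩
  | bvar i => exact lt_of_lt_of_le h hn
  | fvar a => exact hA h
  | all _ ih => exact ih h hL (Nat.succ_le_succ hn)

theorem mono_ctx (h : t.WfB S A L n) (hS : ∀ x b, S x = some b → S' x = some b) (hA : A ⊆ A') :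
    t.WfB S' A' L n := h.mono hS hA (fun _ _ h => h) le_rfl

theorem weaken (h : t.WfB S A [] 0) : t.WfB S A L n :=
  h.mono (fun _ _ h => h) subset_rfl (by simp) (Nat.zero_le _)

theorem sub {σ : Var → Term T} (h : t.WfB S A L n)
    (hσ : ∀ x b, S x = some b → HasSort S' [] (σ x) (.base b)) (hA : A ⊆ A') :
    (t.sub σ).WfB S' A' L n := by
  induction t generalizing L n with
  | refine b r => exact Refn.WS.sub h hσ
  | fn _ _ h₁ h₂ =>
    refine ⟨h₁ h.1, ?_⟩
    rw [forget_sub]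
    exact h₂ h.2
  | ifn _ _ h₁ h₂ | sig _ _ h₁ h₂ =>
    refine ⟨h.1.sub σ, h₁ h.2.1, ?_⟩
    rw [forget_sub]
    exact h₂ h.2.2
  | bvar i => exact h
  | fvar a => exact hA h
  | all _ ih => exact ih h

theorem opn {l : Option T.B} {u : Term T} (h : t.WfB S A (L ++ [l]) n)
    (hu : ∀ b, l = some b → HasSort S [] u (.base b)) : (t.opn L.length u).WfB S A L n := by
  induction t generalizing L n with
  | refine b r => exact Refn.WS.opn (L := some b :: L) h hu
  | fn t _ h₁ h₂ =>
    refine ⟨h₁ h.1, ?_⟩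
    rw [forget_opn]
    exact h₂ (L := t.forget.base? :: L) h.2
  | ifn t _ h₁ h₂ | sig t _ h₁ h₂ =>
    refine ⟨h.1.opn _ _, h₁ h.2.1, ?_⟩
    rw [forget_opn]
    exact h₂ (L := t.forget.base? :: L) h.2.2
  | bvar i => exact h
  | fvar a => exact h
  | all _ ih => exact ih h

theorem opn_zero {l : Option T.B} {u : Term T} (h : t.WfB S A [l] n)
    (hu : ∀ b, l = some b → HasSort S [] u (.base b)) : (t.opn 0 u).WfB S A [] n :=
  opn (L := []) h hu

theorem close {x : Var} {l : Option T.B} (hx : x ∉ t.fv)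
    (h : (t.opn L.length (.fvar x)).WfB (Function.update S x l) A L n) :
    t.WfB S A (L ++ [l]) n := by
  induction t generalizing L n with
  | refine b r => exact Refn.WS.close (L := some b :: L) hx h
  | fn t _ h₁ h₂ =>
    refine ⟨h₁ (fun h => hx (Or.inl h)) h.1,
      h₂ (L := t.forget.base? :: L) (fun h => hx (Or.inr h)) ?_⟩
    have := h.2
    rwa [forget_opn] at this
  | ifn t _ h₁ h₂ | sig t _ h₁ h₂ =>
    refine ⟨isBase_of_opn h.1, h₁ (fun h => hx (Or.inl h)) h.2.1,
      h₂ (L := t.forget.base? :: L) (fun h => hx (Or.inr h)) ?_⟩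
    have := h.2.2
    rwa [forget_opn] at this
  | bvar i => exact h
  | fvar a => exact h
  | all _ ih => exact ih hx h

theorem close_zero {x : Var} {l : Option T.B} (hx : x ∉ t.fv)
    (h : (t.opn 0 (.fvar x)).WfB (Function.update S x l) A [] n) : t.WfB S A [l] n :=
  close (L := []) hx h

theorem opnT (h : t.WfB S A L (n + 1)) (hs : s.WfB S A [] 0) : (t.opnT n s).WfB S A L n := by
  have key : ∀ (t : Ty T) (L : List (Option T.B)) (i : ℕ) (b : T.B),
      (t.forget.base? :: L)[i]? = some (some b) →
      ((t.opnT n s).forget.base? :: L)[i]? = some (some b) := by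
    intro t L i b hb
    cases i with
    | succ i => exact hb
    | zero =>
      cases t with
      | refine => exact hb
      | bvar => simp [forget, STy.base?] at hb
      | fvar => simp [forget, STy.base?] at hb
      | fn => simp [forget, STy.base?] at hb
      | all => simp [forget, STy.base?] at hb
      | ifn t u | sig t u =>
        rw [forget_opnT]
        generalize forget _ = τ at hb
        cases τ <;> simp [STy.base?] at hb ⊢
        simpa [STy.opnT] using hb
  induction t generalizing L n with
  | refine b r => exact h
  | fn t u h₁ h₂ =>
    exact ⟨h₁ h.1 key, (h₂ h.2 key).mono (fun _ _ h => h) subset_rfl (key t L) le_rfl⟩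
  | ifn t u h₁ h₂ | sig t u h₁ h₂ =>
    exact ⟨h.1.opnT _ _, h₁ h.2.1 key,
      (h₂ h.2.2 key).mono (fun _ _ h => h) subset_rfl (key t L) le_rfl⟩
  | bvar i =>
    by_cases hi : i = n
    · simpa [Ty.opnT, hi] using hs.weaken
    · simp only [Ty.opnT, if_neg hi]
      simp only [WfB] at h ⊢
      omega
  | fvar a => exact h
  | all t ih =>
    refine ih (n := n + 1) h fun t L i b hb => ?_
    cases i with
    | succ i => exact hb
    | zero =>
      rw [forget_opnT]
      simp only [List.getElem?_cons_zero, Option.some.injEq] at hb ⊢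
      generalize forget t = τ at hb
      cases τ <;> simp [STy.base?] at hb ⊢
      simpa [STy.opnT] using hb

theorem closeT {a : TVar} (ha : a ∉ t.ftv) (h : (t.opnT n (.fvar a)).WfB S ({a} ∪ A) L n) :
    t.WfB S A L (n + 1) := by
  induction t generalizing L n with
  | refine b r => exact h
  | fn t _ h₁ h₂ =>
    refine ⟨h₁ (fun h => ha (Or.inl h)) h.1, h₂ (fun h => ha (Or.inr h)) ?_⟩
    have := h.2
    rwa [forget_opnT, forget, STy.base?_opnT] at this
  | ifn t _ h₁ h₂ | sig t _ h₁ h₂ =>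
    refine ⟨isBase_of_opnT h.1, h₁ (fun h => ha (Or.inl h)) h.2.1,
      h₂ (fun h => ha (Or.inr h)) ?_⟩
    have := h.2.2
    rwa [forget_opnT, forget, STy.base?_opnT] at this
  | bvar i =>
    by_cases hi : i = n
    · simp [WfB, hi]
    · simp only [Ty.opnT, if_neg hi, WfB] at h ⊢
      omega
  | fvar c =>
    rcases h with h | h
    · exact (ha h.symm).elim
    · exact h
  | all _ ih => exact ih ha h

theorem mem_dom (h : t.WfB S A L n) {x : Var} (hx : x ∈ t.fv) : ∃ b, S x = some b := by
  induction t generalizing L n with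
  | refine b r => exact Refn.WS.mem_dom h hx
  | fn _ _ h₁ h₂ => exact hx.elim (h₁ h.1) (h₂ h.2)
  | ifn _ _ h₁ h₂ | sig _ _ h₁ h₂ => exact hx.elim (h₁ h.2.1) (h₂ h.2.2)
  | bvar | fvar => exact hx.elim
  | all _ ih => exact ih h hx

theorem kvars (h : t.WfB S A L n) : t.kvars = ∅ := by
  induction t generalizing L n with
  | refine b r => exact Refn.WS.kvars h
  | fn _ _ h₁ h₂ => simp [Ty.kvars, h₁ h.1, h₂ h.2]
  | ifn _ _ h₁ h₂ | sig _ _ h₁ h₂ => simp [Ty.kvars, h₁ h.2.1, h₂ h.2.2]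
  | bvar | fvar => rfl
  | all _ ih => exact ih h

end WfB

end Ty

theorem Ctx.fv_finite (Γ : Ctx T) : Γ.fv.Finite := by
  induction Γ with
  | nil => exact Set.finite_empty
  | corp Γ x t h | ghost Γ x t h => exact ((Set.finite_singleton x).union t.fv_finite).union h
  | tvar Γ a h => exact h

theorem Ctx.ftv_finite (Γ : Ctx T) : Γ.ftv.Finite := by
  induction Γ with
  | nil => exact Set.finite_empty
  | corp Γ x t h | ghost Γ x t h => exact t.ftv_finite.union h
  | tvar Γ a h => exact (Set.finite_singleton a).union h

theorem Wf.wfB {Γ : Ctx T} {t : Ty T} (h : Wf Γ t) : t.WfB Γ.sort Γ.tdom [] 0 := by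
  induction h with
  | base h => exact h
  | fn _ hx _ _ h₁ h₂ => exact ⟨h₁, Ty.WfB.close_zero hx h₂⟩
  | ifn _ hx hb _ _ h₁ h₂ => exact ⟨hb, h₁, Ty.WfB.close_zero hx h₂⟩
  | sig _ hx hb _ _ h₁ h₂ => exact ⟨hb, h₁, Ty.WfB.close_zero hx h₂⟩
  | var h => exact h
  | all _ ha _ h => exact Ty.WfB.closeT ha h

/-- Opening a type below a binder of a type with erasure `tx`. -/
theorem Ty.WfB.opn_var {S : Var → Option T.B} {A : Set TVar} {t : Ty T} {x : Var}
    {l : Option T.B} {n : ℕ} (h : t.WfB S A [l] n) (hx : S x = none) :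
    (t.opn 0 (.fvar x)).WfB (Function.update S x l) A [] n := by
  refine Ty.WfB.opn_zero (h.mono_ctx (fun y b hy => ?_) subset_rfl) fun b hb => .fvar (by simp [hb])
  rwa [Function.update_of_ne]
  rintro rfl
  simp [hx] at hy

theorem Ty.WfB.opnT_var {S : Var → Option T.B} {A : Set TVar} {t : Ty T} {a : TVar}
    (h : t.WfB S A [] 1) : (t.opnT 0 (.fvar a)).WfB S ({a} ∪ A) [] 0 :=
  Ty.WfB.opnT (h.mono_ctx (fun _ _ h => h) Set.subset_union_right) (Or.inl rfl)

theorem Ctx.sort_eq_none {Γ : Ctx T} {x : Var} (hx : x ∉ Γ.fv) : Γ.sort x = none := by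
  induction Γ with
  | nil => rfl
  | corp Γ y t h | ghost Γ y t h =>
    simp only [Ctx.fv, Set.mem_union, Set.mem_singleton_iff, not_or] at hx
    simp [Ctx.sort, hx.1.1, h hx.2]
  | tvar Γ a h => exact h hx

theorem Ty.WfB.wf {Γ : Ctx T} {t : Ty T} (h : t.WfB Γ.sort Γ.tdom [] 0) : Wf Γ t := by
  induction hn : t.size using Nat.strong_induction_on generalizing t Γ with
  | _ n ih =>
  subst hn
  have body : ∀ (tx u : Ty T) (x : Var), u.size < t.size → x ∉ Γ.fv →
      u.WfB Γ.sort Γ.tdom [tx.forget.base?] 0 → Wf (.corp Γ x tx) (u.opn 0 (.fvar x)) := by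
    intro tx u x hu hx h
    refine ih _ hu ?_ (u.size_opn 0 _)
    exact h.opn_var (Ctx.sort_eq_none hx)
  cases t with
  | refine b r => exact .base h
  | fn t u =>
    obtain ⟨x, hx⟩ := exists_fresh (Γ.fv_finite.union u.fv_finite)
    simp only [Set.mem_union, not_or] at hx
    simp only [Ty.size] at ih body
    exact .fn hx.1 hx.2 (ih _ (by omega) h.1 rfl) (body _ _ _ (by omega) hx.1 h.2)
  | ifn t u =>
    obtain ⟨x, hx⟩ := exists_fresh (Γ.fv_finite.union u.fv_finite)
    simp only [Set.mem_union, not_or] at hx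
    simp only [Ty.size] at ih body
    exact .ifn hx.1 hx.2 h.1 (ih _ (by omega) h.2.1 rfl) (body _ _ _ (by omega) hx.1 h.2.2)
  | sig t u =>
    obtain ⟨x, hx⟩ := exists_fresh (Γ.fv_finite.union u.fv_finite)
    simp only [Set.mem_union, not_or] at hx
    simp only [Ty.size] at ih body
    exact .sig hx.1 hx.2 h.1 (ih _ (by omega) h.2.1 rfl) (body _ _ _ (by omega) hx.1 h.2.2)
  | bvar i => exact absurd h (Nat.not_lt_zero i)
  | fvar a => exact .var h
  | all t =>
    obtain ⟨a, ha⟩ := exists_fresh (Γ.ftv_finite.union t.ftv_finite)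
    simp only [Set.mem_union, not_or] at ha
    exact .all ha.1 ha.2 (ih _ (by simp [Ty.size]) h.opnT_var (t.size_opnT 0 a))

end IRT

namespace IRT

variable {T : Theory}

/-! ## The logical reading of contexts -/

/-- The sorts in scope below a binder `x : t`; only refined base types are visible to the logic. -/
def Ty.extS (t : Ty T) (x : Var) (S : Var → Option T.B) : Var → Option T.B :=
  match t with
  | .refine b _ => Function.update S x (some b)
  | _ => S

def Ty.extSat (t : Ty T) (x : Var) (Φ : Set (Env T)) : Set (Env T) :=
  match t with
  | .refine b r => {ρ' | ∃ ρ ∈ Φ, ∃ a, ρ' = Function.update ρ x (some ⟨b, a⟩) ∧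
      (r.opn 0 (.fvar x)).Holds ρ'}
  | _ => Φ

def Ty.ExtOK (t : Ty T) (x : Var) (S : Var → Option T.B) : Prop :=
  match t with
  | .refine b r => (r.opn 0 (.fvar x)).WS (Function.update S x (some b)) []
  | _ => True

namespace Ctx

/-- The sorts of the variables that the embedding of `Γ` quantifies. -/
def semS : Ctx T → Var → Option T.B
  | .nil => fun _ => none
  | .corp Γ x t => t.extS x Γ.semS
  | .ghost Γ x t => t.extS x Γ.semS
  | .tvar Γ _ => Γ.semS

/-- The valuations that satisfy the refinements of `Γ`. -/
def sat : Ctx T → Set (Env T)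
  | .nil => {fun _ => none}
  | .corp Γ x t => t.extSat x Γ.sat
  | .ghost Γ x t => t.extSat x Γ.sat
  | .tvar Γ _ => Γ.sat

/-- The refinements in `Γ` are well-sorted over the variables visible to the logic. -/
def EWS : Ctx T → Prop
  | .nil => True
  | .corp Γ x t => Γ.EWS ∧ t.ExtOK x Γ.semS
  | .ghost Γ x t => Γ.EWS ∧ t.ExtOK x Γ.semS
  | .tvar Γ _ => Γ.EWS

/-- The binders of the context are distinct. -/
def Nodup : Ctx T → Prop
  | .nil => True
  | .corp Γ x _ => Γ.Nodup ∧ x ∉ Γ.fv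
  | .ghost Γ x _ => Γ.Nodup ∧ x ∉ Γ.fv
  | .tvar Γ _ => Γ.Nodup

/-- `p` is a well-sorted consequence of the refinements in `Γ`. -/
def Ent (Γ : Ctx T) (p : Refn T) : Prop :=
  Γ.EWS ∧ p.WS Γ.semS [] ∧ ∀ ρ ∈ Γ.sat, p.Holds ρ

theorem embed_corp (Γ : Ctx T) (x : Var) (t : Ty T) (c : Con T) :
    (Ctx.corp Γ x t).embed c = Γ.embed (genImp x t c) := by
  cases t <;> rfl

theorem embed_ghost (Γ : Ctx T) (x : Var) (t : Ty T) (c : Con T) :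
    (Ctx.ghost Γ x t).embed c = Γ.embed (genImp x t c) := by
  cases t <;> rfl

end Ctx

theorem genImp_WS {x : Var} {t : Ty T} {c : Con T} {S : Var → Option T.B} :
    (genImp x t c).WS S ↔ t.ExtOK x S ∧ c.WS (t.extS x S) := by
  cases t <;> simp [genImp, Ty.ExtOK, Ty.extS, Con.WS]

theorem genImp_Holds {x : Var} {t : Ty T} {c : Con T} {Φ : Set (Env T)} :
    (∀ ρ ∈ Φ, (genImp x t c).Holds ρ) ↔ ∀ ρ ∈ t.extSat x Φ, c.Holds ρ := by
  cases t with
  | refine b r =>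
    simp only [genImp, Con.Holds, Ty.extSat]
    constructor
    · rintro h _ ⟨ρ, hρ, a, rfl, hr⟩
      exact h ρ hρ a hr
    · intro h ρ hρ a hr
      exact h _ ⟨ρ, hρ, a, rfl, hr⟩
  | _ => simp [genImp, Ty.extSat]

theorem genImp_evars (x : Var) (t : Ty T) (c : Con T) : (genImp x t c).evars = c.evars := by
  cases t <;> rfl

namespace Ctx

theorem embed_WS {Γ : Ctx T} {c : Con T} :
    (Γ.embed c).WS (fun _ => none) ↔ Γ.EWS ∧ c.WS Γ.semS := by
  induction Γ generalizing c with
  | nil => simp [embed, EWS, semS]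
  | corp Γ x t h => simp only [embed_corp, h, genImp_WS, EWS, semS, and_assoc]
  | ghost Γ x t h => simp only [embed_ghost, h, genImp_WS, EWS, semS, and_assoc]
  | tvar Γ a h => exact h

theorem embed_Holds {Γ : Ctx T} {c : Con T} :
    (Γ.embed c).Holds (fun _ => none) ↔ ∀ ρ ∈ Γ.sat, c.Holds ρ := by
  induction Γ generalizing c with
  | nil => simp [embed, sat]
  | corp Γ x t h => rw [embed_corp, h, genImp_Holds, sat]
  | ghost Γ x t h => rw [embed_ghost, h, genImp_Holds, sat]
  | tvar Γ a h => exact h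

theorem embed_evars (Γ : Ctx T) (c : Con T) : (Γ.embed c).evars = c.evars := by
  induction Γ generalizing c with
  | nil => rfl
  | corp Γ x t h => rw [embed_corp, h, genImp_evars]
  | ghost Γ x t h => rw [embed_ghost, h, genImp_evars]
  | tvar Γ a h => exact h c

end Ctx

theorem Con.WS.kvars {S : Var → Option T.B} {c : Con T} (h : c.WS S) : c.kvars = ∅ := by
  induction c generalizing S with
  | ex x b c ih => exact ih h
  | all x b p c ih => simp [Con.kvars, ih h.2, Refn.WS.kvars h.1]
  | and c d hc hd => simp [Con.kvars, hc h.1, hd h.2]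
  | prop p => exact Refn.WS.kvars h

namespace Ctx

theorem Ent.valid {Γ : Ctx T} {p : Refn T} (h : Γ.Ent p) : Valid [] [] (Γ.embed (.prop p)) := by
  have hws : (Γ.embed (.prop p)).WS (fun _ => none) := embed_WS.2 ⟨h.1, h.2.1⟩
  exact .smt ((embed_evars _ _).trans rfl) hws.kvars ⟨hws, embed_Holds.2 h.2.2⟩

theorem semS_eq_none {Γ : Ctx T} {x : Var} (hx : x ∉ Γ.fv) : Γ.semS x = none := by
  induction Γ with
  | nil => rfl
  | corp Γ y t h | ghost Γ y t h =>
    simp only [Ctx.fv, Set.mem_union, Set.mem_singleton_iff, not_or] at hx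
    cases t <;> simp [semS, Ty.extS, hx.1.1, h hx.2]
  | tvar Γ a h => exact h hx

theorem sat_models {Γ : Ctx T} {ρ : Env T} (h : ρ ∈ Γ.sat) : Models Γ.semS ρ := by
  induction Γ generalizing ρ with
  | nil => intro x b hx; simp [semS] at hx
  | corp Γ y t ih | ghost Γ y t ih =>
    cases t with
    | refine b r =>
      obtain ⟨ρ, hρ, a, rfl, -⟩ := h
      intro x b' hx
      by_cases hxy : x = y
      · subst hxy
        simp only [semS, Ty.extS, Function.update_self, Option.some.injEq] at hx
        subst hx
        exact ⟨a, by simp⟩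
      · simp only [semS, Ty.extS, Function.update_of_ne hxy] at hx ⊢
        exact ih hρ x b' hx
    | _ => exact ih h
  | tvar Γ a ih => exact ih h

theorem semS_le_sort {Γ : Ctx T} (h : Γ.Nodup) {x : Var} {b : T.B} (hx : Γ.semS x = some b) :
    Γ.sort x = some b := by
  induction Γ with
  | nil => simp [semS] at hx
  | corp Γ y t ih | ghost Γ y t ih =>
    have hne : Γ.semS x = some b → x ≠ y := by
      rintro h' rfl
      simp [semS_eq_none h.2] at h'
    cases t with
    | refine b' r =>
      by_cases hxy : x = y
      · subst hxy
        simpa [semS, Ty.extS, sort, Ty.forget, STy.base?] using hx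
      · simp only [semS, Ty.extS, Function.update_of_ne hxy] at hx
        simp only [sort, Function.update_of_ne hxy]
        exact ih h.1 hx
    | _ =>
      simp only [semS, Ty.extS] at hx
      simp only [sort, Function.update_of_ne (hne hx)]
      exact ih h.1 hx
  | tvar Γ a ih => exact ih h hx

theorem Mem.mem_fv {Γ : Ctx T} {x : Var} {t : Ty T} (h : Γ.Mem x t) : x ∈ Γ.fv := by
  induction h with
  | here => simp [Ctx.fv]
  | _ => simp [Ctx.fv, *]

theorem Mem.semS {Γ : Ctx T} {x : Var} {b : T.B} {r : Refn T} (h : Γ.Mem x (.refine b r))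
    (hΓ : Γ.Nodup) : Γ.semS x = some b := by
  induction h with
  | here => simp [Ctx.semS, Ty.extS]
  | @corp Γ y u h ih | @ghost Γ y u h ih =>
    have : x ≠ y := by
      rintro rfl
      exact hΓ.2 h.mem_fv
    cases u <;> simp [Ctx.semS, Ty.extS, this, ih hΓ.1]
  | tvar h ih => exact ih hΓ

theorem Mem.semS_none {Γ : Ctx T} {x : Var} {t : Ty T} (h : Γ.Mem x t)
    (hΓ : Γ.Nodup) (ht : ¬ t.IsBase) : Γ.semS x = none := by
  induction h with
  | @here Γ =>
    cases t with
    | refine b r => exact (ht ⟨b, r, rfl⟩).elim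
    | _ => exact semS_eq_none (Γ := Γ) hΓ.2
  | @corp Γ y u h ih | @ghost Γ y u h ih =>
    have : x ≠ y := by
      rintro rfl
      exact hΓ.2 h.mem_fv
    cases u <;> simp [Ctx.semS, Ty.extS, this, ih hΓ.1]
  | tvar h ih => exact ih hΓ

theorem mem_of_semS {Γ : Ctx T} {x : Var} {b : T.B} (h : Γ.semS x = some b) :
    ∃ r, Γ.forgetGhost.Mem x (.refine b r) := by
  induction Γ with
  | nil => simp [Ctx.semS] at h
  | corp Γ y t ih | ghost Γ y t ih =>
    cases t with
    | refine b' r =>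
      by_cases hxy : x = y
      · subst hxy
        simp only [Ctx.semS, Ty.extS, Function.update_self, Option.some.injEq] at h
        subst h
        exact ⟨r, .here⟩
      · simp only [Ctx.semS, Ty.extS, Function.update_of_ne hxy] at h
        obtain ⟨r, hr⟩ := ih h
        exact ⟨r, .corp hr⟩
    | _ =>
      obtain ⟨r, hr⟩ := ih h
      exact ⟨r, .corp hr⟩
  | tvar Γ a ih =>
    obtain ⟨r, hr⟩ := ih h
    exact ⟨r, .tvar hr⟩

section forgetGhost

variable (Γ : Ctx T)

theorem semS_forgetGhost : Γ.forgetGhost.semS = Γ.semS := by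
  induction Γ <;> simp [forgetGhost, semS, *]

theorem sat_forgetGhost : Γ.forgetGhost.sat = Γ.sat := by
  induction Γ <;> simp [forgetGhost, sat, *]

theorem fv_forgetGhost : Γ.forgetGhost.fv = Γ.fv := by
  induction Γ <;> simp [forgetGhost, fv, *]

theorem EWS_forgetGhost : Γ.forgetGhost.EWS ↔ Γ.EWS := by
  induction Γ <;> simp [forgetGhost, EWS, semS_forgetGhost, *]

theorem Nodup_forgetGhost : Γ.forgetGhost.Nodup ↔ Γ.Nodup := by
  induction Γ <;> simp [forgetGhost, Nodup, fv_forgetGhost, *]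

theorem Ent_forgetGhost (p : Refn T) : Γ.forgetGhost.Ent p ↔ Γ.Ent p := by
  simp [Ent, EWS_forgetGhost, semS_forgetGhost, sat_forgetGhost]

end forgetGhost

end Ctx

/-! ## Typing of the predicates -/

variable {P : Type} {tc : P → Ty T}

theorem SubType.of_ent {Γ : Ctx T} {v : Var} {b : T.B} {r₁ r₂ : Refn T} (hv : v ∉ Γ.fv)
    (h₁ : v ∉ r₁.fv) (h₂ : v ∉ r₂.fv)
    (h : (Ctx.corp Γ v (.refine b r₁)).Ent (r₂.opn 0 (.fvar v))) :
    SubType tc Γ (.refine b r₁) (.refine b r₂) :=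
  .base hv h₁ h₂ h.valid

namespace HasSort

variable {S : Var → Option T.B} {L : List (Option T.B)} {t u : Term T}

theorem unique {s s' : T.S} (h : HasSort S L t s) (h' : HasSort S L t s') : s = s' := by
  induction h generalizing s' with
  | bvar h =>
    cases h' with
    | bvar h' => rw [h] at h'; simpa using h'
  | fvar h =>
    cases h' with
    | fvar h' => rw [h] at h'; simpa using h'
  | con => cases h'; rfl
  | app _ _ h₁ h₂ =>
    cases h' with
    | app h₁' h₂' => exact (FSort.arr.inj (h₁ h₁')).2

theorem unopn {s : T.S} {b : T.B} (h : HasSort S [] (t.opn 0 u) s)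
    (hu : HasSort S [] u (.base b)) : HasSort S [some b] t s := by
  induction t generalizing s with
  | bvar i =>
    by_cases hi : i = 0
    · simp only [Term.opn, if_pos hi] at h
      rw [h.unique hu, hi]
      exact .bvar rfl
    · simp only [Term.opn, if_neg hi] at h
      exact h.weaken
  | fvar x => exact HasSort.weaken h
  | con c => exact HasSort.weaken h
  | app t u ht hu =>
    cases h with
    | app h₁ h₂ => exact .app (ht h₁) (hu h₂)

theorem shift {s : T.S} {l : Option T.B} (h : HasSort S L t s) : HasSort S (l :: L) t.shift s := by
  induction h with
  | bvar h => exact .bvar h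
  | fvar h => exact .fvar h
  | con => exact .con
  | app _ _ h₁ h₂ => exact .app h₁ h₂

end HasSort

theorem Refn.WS.unopn {S : Var → Option T.B} {p : Refn T} {u : Term T} {b : T.B}
    (h : (p.opn 0 u).WS S []) (hu : HasSort S [] u (.base b)) : p.WS S [some b] := by
  induction p with
  | pred r => exact HasSort.unopn h hu
  | kapp κ as => exact h
  | and p q hp hq => exact ⟨hp h.1, hq h.2⟩

theorem Term.eval_opn_congr {ρ : Env T} {u u' : Term T} (h : u.eval ρ = u'.eval ρ) (t : Term T)
    (k : ℕ) : (t.opn k u).eval ρ = (t.opn k u').eval ρ := by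
  induction t with
  | bvar i => by_cases hi : i = k <;> simp [opn, hi, h]
  | app s t hs ht => simp only [opn, eval, hs, ht]
  | _ => rfl

theorem Refn.Holds_opn_congr {ρ : Env T} {u u' : Term T} (h : u.eval ρ = u'.eval ρ) (p : Refn T)
    (k : ℕ) : (p.opn k u).Holds ρ ↔ (p.opn k u').Holds ρ := by
  induction p with
  | pred r => simp [opn, Holds, Term.eval_opn_congr h r]
  | kapp κ as => simp [opn, Holds]
  | and p q hp hq => simp [opn, Holds, hp, hq]

theorem eval_fvar {ρ : Env T} {x : Var} {b : T.B} {a : b.Carrier T.Carrier}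
    (h : ρ x = some ⟨b, a⟩) : (Term.fvar x).eval ρ = some ⟨.base b, a⟩ := by
  simp [Term.eval, h]

theorem FSort.exactTy_opn (h : Term T) (s : T.S) (k : ℕ) {u : Term T} (hu : u.LC) :
    (FSort.exactTy h s).opn k u = FSort.exactTy (h.opn k u) s := by
  induction s generalizing h k with
  | base b =>
    simp [exactTy, Ty.opn, Refn.opn, Term.eq, Term.opn, Term.shift_opn_succ _ hu]
  | arr b s ih =>
    simp [exactTy, Ty.opn, Refn.opn, Refn.tt, Term.opn, ih, Term.shift_opn_succ _ hu]

theorem FSort.exactTy_fv (h : Term T) (s : T.S) : (FSort.exactTy h s).fv = h.fv := by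
  induction s generalizing h with
  | base b => simp [exactTy, Ty.fv, Refn.fv, Term.eq, Term.fv, Term.fv_shift]
  | arr b s ih => simp [exactTy, Ty.fv, Refn.fv, Refn.tt, Term.fv, ih, Term.fv_shift]

theorem FSort.exactTy_wfB {S : Var → Option T.B} {A : Set TVar} {L : List (Option T.B)} {n : ℕ}
    {h : Term T} {s : T.S} (hs : HasSort S L h s) : (FSort.exactTy h s).WfB S A L n := by
  induction s generalizing h L with
  | base b => exact HasSort.eq (.bvar rfl) hs.shift
  | arr b s ih => exact ⟨HasSort.con' rfl, ih (.app hs.shift (.bvar rfl))⟩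

/-- The predicate `v = h`. -/
def eqR (b : T.B) (h : Term T) : Refn T := .pred (.eq b (.bvar 0) h)

theorem eqR_opn {b : T.B} {h u : Term T} (hh : h.LC) :
    (eqR b h).opn 0 u = .pred (.eq b u h) := by
  simp [eqR, Refn.opn, Term.eq, Term.opn, Term.opn_lc hh]

theorem eqR_fv (b : T.B) (h : Term T) : (eqR b h).fv = h.fv := by
  simp [eqR, Refn.fv, Term.eq, Term.fv]

theorem FSort.exactTy_base {h : Term T} (hh : h.LC) (b : T.B) :
    FSort.exactTy h (.base b) = .refine b (eqR b h) := by
  simp [exactTy, eqR, Term.shift_lc hh]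

theorem FSort.exactTy_arr_opn {h : Term T} (hh : h.LC) (s : T.S) (x : Var) :
    (FSort.exactTy (.app h.shift (.bvar 0)) s).opn 0 (.fvar x)
      = FSort.exactTy (.app h (.fvar x)) s := by
  rw [FSort.exactTy_opn _ _ _ (u := .fvar x) trivial]
  simp [Term.opn, Term.shift_lc hh, Term.opn_lc hh]

theorem Ctx.le_update {Γ : Ctx T} {x : Var} (hx : x ∉ Γ.fv) (b' : Option T.B) (y : Var) (b : T.B)
    (h : Γ.semS y = some b) : Function.update Γ.semS x b' y = some b := by
  rwa [Function.update_of_ne]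
  rintro rfl
  simp [Ctx.semS_eq_none hx] at h

theorem Ctx.not_mem_fv {Γ : Ctx T} {x : Var} (hx : x ∉ Γ.fv) {L : List (Option T.B)} {t : Term T}
    {s : T.S} (h : HasSort Γ.semS L t s) : x ∉ t.fv := by
  intro hxt
  obtain ⟨b, hb⟩ := h.mem_dom hxt
  simp [Ctx.semS_eq_none hx] at hb

theorem Ctx.le_extS {Γ : Ctx T} {x : Var} (hx : x ∉ Γ.fv) (t : Ty T) (y : Var) (b : T.B)
    (h : Γ.semS y = some b) : t.extS x Γ.semS y = some b := by
  cases t with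
  | refine b' r => exact Ctx.le_update hx _ y b h
  | _ => exact h

theorem Ctx.Mem.refine_WS {Γ : Ctx T} {x : Var} {b : T.B} {r : Refn T}
    (h : Γ.Mem x (.refine b r)) (hΓ : Γ.EWS) (hN : Γ.Nodup) : r.WS Γ.semS [some b] := by
  induction h with
  | here => exact hΓ.2.unopn (.fvar (by simp))
  | corp h ih | ghost h ih => exact (ih hΓ.1 hN.1).mono_sort (Ctx.le_extS hN.2 _)
  | tvar h ih => exact ih hΓ hN

theorem eval_update {ρ : Env T} {x : Var} {t : Term T} (hx : x ∉ t.fv) (v) :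
    t.eval (Function.update ρ x v) = t.eval ρ :=
  Term.eval_congr fun y hy => Function.update_of_ne (by rintro rfl; exact hx hy) _ _

theorem HasType.refine_tt {Γ : Ctx T} (hΓ : Γ.EWS) {b : T.B} {r : Refn T}
    (h : ∀ v, v ∉ Γ.fv → (Ty.refine b r).ExtOK v Γ.semS) :
    SubType tc Γ (.refine b r) (.refine b .tt) := by
  obtain ⟨v, hv⟩ := exists_fresh (Γ.fv_finite.union r.fv_finite)
  simp only [Set.mem_union, not_or] at hv
  exact .of_ent hv.1 hv.2 (by simp [Refn.tt, Refn.fv, Term.fv])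
    ⟨⟨hΓ, h v hv.1⟩, HasSort.con' rfl, fun ρ _ => rfl⟩

theorem SubType.exactTy {Γ : Ctx T} (hΓ : Γ.EWS) {s : T.S} {h₁ h₂ : Term T}
    (hs₁ : HasSort Γ.semS [] h₁ s) (hs₂ : HasSort Γ.semS [] h₂ s)
    (heq : ∀ ρ ∈ Γ.sat, h₁.eval ρ = h₂.eval ρ) :
    SubType tc Γ (FSort.exactTy h₁ s) (FSort.exactTy h₂ s) := by
  induction s generalizing Γ h₁ h₂ with
  | base b =>
    rw [FSort.exactTy_base hs₁.lc, FSort.exactTy_base hs₂.lc]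
    obtain ⟨v, hv⟩ := exists_fresh Γ.fv_finite
    have hv₁ := Ctx.not_mem_fv hv hs₁
    have hv₂ := Ctx.not_mem_fv hv hs₂
    refine .of_ent hv (by rwa [eqR_fv]) (by rwa [eqR_fv]) ⟨⟨hΓ, ?_⟩, ?_, ?_⟩
    · simp only [Ty.ExtOK, eqR_opn hs₁.lc]
      exact HasSort.eq (.fvar (by simp)) (hs₁.mono_sort (Ctx.le_update hv _))
    · simp only [Ctx.semS, Ty.extS, eqR_opn hs₂.lc]
      exact HasSort.eq (.fvar (by simp)) (hs₂.mono_sort (Ctx.le_update hv _))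
    · rintro ρ' ⟨ρ, hρ, a, rfl, h⟩
      rw [eqR_opn hs₁.lc] at h
      rw [eqR_opn hs₂.lc]
      obtain ⟨d, hd⟩ := hs₁.eval_base (Ctx.sat_models hρ)
      have e₁ := (eval_update hv₁ (some ⟨b, a⟩)).trans hd
      have e₂ := (eval_update hv₂ (some ⟨b, a⟩)).trans ((heq ρ hρ).symm.trans hd)
      have e₀ := eval_fvar (ρ := Function.update ρ v (some ⟨b, a⟩)) (Function.update_self v _ ρ)
      exact (Term.eval_eq_bool e₀ e₂).2 ((Term.eval_eq_bool e₀ e₁).1 h)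
  | arr b s ih =>
    obtain ⟨x, hx⟩ := exists_fresh Γ.fv_finite
    have hx₁ := Ctx.not_mem_fv hx hs₁
    have hx₂ := Ctx.not_mem_fv hx hs₂
    refine .fun hx ?_ ?_ (HasType.refine_tt hΓ fun v hv => HasSort.con' rfl) ?_
    · rw [FSort.exactTy_fv]
      simpa [Term.fv, Term.fv_shift] using hx₁
    · rw [FSort.exactTy_fv]
      simpa [Term.fv, Term.fv_shift] using hx₂
    · rw [FSort.exactTy_arr_opn hs₁.lc, FSort.exactTy_arr_opn hs₂.lc]
      refine ih (Γ := .corp Γ x (.refine b .tt)) ⟨hΓ, HasSort.con' rfl⟩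
        (.app (hs₁.mono_sort (Ctx.le_update hx _)) (.fvar (by simp [Ctx.semS, Ty.extS])))
        (.app (hs₂.mono_sort (Ctx.le_update hx _)) (.fvar (by simp [Ctx.semS, Ty.extS]))) ?_
      rintro ρ' ⟨ρ, hρ, a, rfl, -⟩
      simp only [Term.eval, eval_update hx₁, eval_update hx₂, heq ρ hρ]

theorem HasType.exactTy {Γ : Ctx T} (hΓ : Γ.EWS) (hN : Γ.Nodup)
    (hmem : ∀ x b, Γ.semS x = some b → ∃ r, Γ.Mem x (.refine b r))
    {r : Term T} {s : T.S} (h : HasSort Γ.semS [] r s) :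
    HasType tc Γ r.toExpr (FSort.exactTy r s) := by
  induction h with
  | bvar h => simp at h
  | con => exact .con
  | @fvar x b h =>
    obtain ⟨r, hr⟩ := hmem x b h
    refine .sub (.base hr) ?_ (FSort.exactTy_wfB (.fvar (Ctx.semS_le_sort hN h))).wf
    rw [FSort.exactTy_base (h := .fvar x) trivial]
    obtain ⟨v, hv⟩ := exists_fresh (Γ.fv_finite.union r.fv_finite)
    simp only [Set.mem_union, not_or] at hv
    have hvx : v ≠ x := by
      rintro rfl
      exact hv.1 hr.mem_fv
    refine .of_ent hv.1 ?_ ?_ ⟨⟨hΓ, ?_⟩, ?_, ?_⟩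
    · simp [Refn.fv, Term.eq, Term.fv, hv.2, hvx]
    · simp [eqR_fv, Term.fv, hvx]
    · exact ⟨((hr.refine_WS hΓ hN).mono_sort (Ctx.le_update hv.1 _)).opn_zero
          fun b' hb' => .fvar (by simpa using hb'),
        HasSort.eq (.fvar (by simp)) (.fvar (by simpa [hvx.symm] using h))⟩
    · rw [eqR_opn (h := .fvar x) trivial]
      exact HasSort.eq (.fvar (by simp [Ctx.semS, Ty.extS]))
        (.fvar (by simpa [Ctx.semS, Ty.extS, hvx.symm] using h))
    · rintro ρ' ⟨ρ, hρ, a, rfl, -, h⟩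
      exact h
  | @app t u b s ht hu iht ihu =>
    obtain ⟨y, hy⟩ := exists_fresh Γ.fv_finite
    have hyt := Ctx.not_mem_fv hy ht
    have hyu := Ctx.not_mem_fv hy hu
    rw [FSort.exactTy_base hu.lc] at ihu
    have hok : ∀ v, v ∉ Γ.fv → (Ty.refine b (eqR b u)).ExtOK v Γ.semS := by
      intro v hv
      simp only [Ty.ExtOK, eqR_opn hu.lc]
      exact HasSort.eq (.fvar (by simp)) (hu.mono_sort (Ctx.le_update hv _))
    have htu := HasSort.app ht hu
    refine .app iht (.fun hy ?_ ?_ ?_ ?_ ihu (HasType.refine_tt hΓ hok) ?_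
      (FSort.exactTy_wfB (htu.mono_sort fun _ _ => Ctx.semS_le_sort hN)).wf)
    · rwa [Term.toExpr_fv]
    · simpa [Ty.fv, eqR_fv] using hyu
    · simpa [Ty.fv, FSort.exactTy_fv, Term.fv, Term.fv_shift, Refn.tt, Refn.fv] using hyt
    · simpa [FSort.exactTy_fv, Term.fv] using ⟨hyt, hyu⟩
    · rw [FSort.exactTy_arr_opn ht.lc]
      refine .exactTy (Γ := .corp Γ y (.refine b (eqR b u))) ⟨hΓ, hok y hy⟩
        (.app (ht.mono_sort (Ctx.le_update hy _)) (.fvar (by simp [Ctx.semS, Ty.extS])))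
        (htu.mono_sort (Ctx.le_update hy _)) ?_
      rintro ρ' ⟨ρ, hρ, a, rfl, h⟩
      rw [eqR_opn hu.lc] at h
      obtain ⟨d, hd⟩ := hu.eval_base (Ctx.sat_models hρ)
      have e₁ := (eval_update hyu (some ⟨b, a⟩)).trans hd
      have e₀ := eval_fvar (ρ := Function.update ρ y (some ⟨b, a⟩)) (Function.update_self y _ ρ)
      have := (Term.eval_eq_bool e₀ e₁).1 h
      subst this
      simp only [Term.eval] at e₀ ⊢
      rw [e₀, e₁]

theorem HasType.refine_of_ent {Γ : Ctx T} (hN : Γ.Nodup) {r : Term T} {b : T.B} {p : Refn T}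
    (hr : HasSort Γ.semS [] r (.base b)) (hp : Γ.Ent (p.opn 0 r)) :
    HasType tc Γ.forgetGhost r.toExpr (.refine b p) := by
  rw [← Ctx.semS_forgetGhost] at hr
  rw [← Ctx.Ent_forgetGhost] at hp
  rw [← Ctx.Nodup_forgetGhost] at hN
  have hmem : ∀ x b, Γ.forgetGhost.semS x = some b →
      ∃ r, Γ.forgetGhost.Mem x (.refine b r) := by
    intro x b h
    rw [Ctx.semS_forgetGhost] at h
    exact Ctx.mem_of_semS h
  generalize Γ.forgetGhost = Γ at *
  have hws := hp.2.1.unopn hr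
  refine .sub (.exactTy hp.1 hN hmem hr) ?_
    (.base (hws.mono_sort fun _ _ => Ctx.semS_le_sort hN))
  rw [FSort.exactTy_base hr.lc]
  obtain ⟨v, hv⟩ := exists_fresh (Γ.fv_finite.union p.fv_finite)
  simp only [Set.mem_union, not_or] at hv
  have hvr := Ctx.not_mem_fv hv.1 hr
  refine .of_ent hv.1 (by rwa [eqR_fv]) hv.2 ⟨⟨hp.1, ?_⟩, ?_, ?_⟩
  · simp only [Ty.ExtOK, eqR_opn hr.lc]
    exact HasSort.eq (.fvar (by simp)) (hr.mono_sort (Ctx.le_update hv.1 _))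
  · exact (hws.mono_sort (Ctx.le_update hv.1 _)).opn_zero
      fun b' hb' => .fvar (by simpa [Ctx.semS, Ty.extS] using hb')
  · rintro ρ' ⟨ρ, hρ, a, rfl, h⟩
    rw [eqR_opn hr.lc] at h
    obtain ⟨d, hd⟩ := hr.eval_base (Ctx.sat_models hρ)
    have e₁ := (eval_update hvr (some ⟨b, a⟩)).trans hd
    have e₀ := eval_fvar (ρ := Function.update ρ v (some ⟨b, a⟩)) (Function.update_self v _ ρ)
    have := (Term.eval_eq_bool e₀ e₁).1 h
    subst this
    refine (Refn.Holds_opn_congr (e₀.trans e₁.symm) p 0).2 ?_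
    refine (Refn.Holds_congr fun y hy => ?_).2 (hp.2.2 ρ hρ)
    refine Function.update_of_ne ?_ _ _
    rintro rfl
    rcases p.fv_opn_subset _ _ hy with h | h
    · exact hv.2 h
    · exact hvr h

end IRT

namespace IRT

variable {T : Theory}

/-! ## Semantic subtyping

A variant of subtyping in which implicit arguments are terms that satisfy the refinement of their
type.  The index is the size of the derivation. -/

inductive SSub : ℕ → Ctx T → Ty T → Ty T → Prop where
  | base {Γ v b r₁ r₂} : v ∉ Γ.fv → v ∉ r₁.fv → v ∉ r₂.fv →
      (Ctx.corp Γ v (.refine b r₁)).Ent (r₂.opn 0 (.fvar v)) →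
      SSub 0 Γ (.refine b r₁) (.refine b r₂)
  | fn {n m Γ x t₁ t₁' t₂ t₂'} : x ∉ Γ.fv → x ∉ t₂.fv → x ∉ t₁'.fv → x ∉ t₂'.fv →
      (Ctx.corp Γ x t₂).EWS → SSub n Γ t₂ t₁ →
      SSub m (.corp Γ x t₂) (t₁'.opn 0 (.fvar x)) (t₂'.opn 0 (.fvar x)) →
      SSub (n + m + 1) Γ (.fn t₁ t₁') (.fn t₂ t₂')
  | all {n Γ a t t'} : a ∉ Γ.ftv → a ∉ t.ftv → a ∉ t'.ftv →
      SSub n (.tvar Γ a) (t.opnT 0 (.fvar a)) (t'.opnT 0 (.fvar a)) →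
      SSub (n + 1) Γ (.all t) (.all t')
  | funIL {n Γ b p t₁' t₂ r} : HasSort Γ.semS [] r (.base b) → Γ.Ent (p.opn 0 r) →
      SSub n Γ (t₁'.opn 0 r) t₂ → SSub (n + 1) Γ (.ifn (.refine b p) t₁') t₂
  | funIR {n Γ x t₁ t₂ t₂'} : x ∉ Γ.fv → x ∉ t₁.fv → x ∉ t₂.fv → x ∉ t₂'.fv →
      (Ctx.corp Γ x t₂).EWS → SSub n (.corp Γ x t₂) t₁ (t₂'.opn 0 (.fvar x)) →
      SSub (n + 1) Γ t₁ (.ifn t₂ t₂')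
  | sigL {n Γ x t₁ t₁' t₂} : x ∉ Γ.fv → x ∉ t₁.fv → x ∉ t₁'.fv → x ∉ t₂.fv →
      (Ctx.corp Γ x t₁).EWS → SSub n (.corp Γ x t₁) (t₁'.opn 0 (.fvar x)) t₂ →
      SSub (n + 1) Γ (.sig t₁ t₁') t₂
  | sigR {n Γ t₁ b p t₂' r} : HasSort Γ.semS [] r (.base b) → Γ.Ent (p.opn 0 r) →
      SSub n Γ t₁ (t₂'.opn 0 r) → SSub (n + 1) Γ t₁ (.sig (.refine b p) t₂')
  | alpha {Γ a} : SSub 0 Γ (.fvar a) (.fvar a)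

theorem SSub.subType {P : Type} {tc : P → Ty T} {n : ℕ} {Γ : Ctx T} {t u : Ty T}
    (h : SSub n Γ t u) (hN : Γ.Nodup) : SubType tc Γ t u := by
  induction h with
  | base hv h₁ h₂ h => exact .of_ent hv h₁ h₂ h
  | fn hx _ h₁ h₂ _ _ _ ih₁ ih₂ => exact .fun hx h₁ h₂ (ih₁ hN) (ih₂ ⟨hN, hx⟩)
  | all h h₁ h₂ _ ih => exact .all h h₁ h₂ (ih hN)
  | funIL hr hp _ ih => exact .funIL (ih hN) (.refine_of_ent hN hr hp)
  | funIR hx h₁ _ h₂ _ _ ih => exact .funIR hx h₁ h₂ (ih ⟨hN, hx⟩)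
  | sigL hx _ h₁ h₂ _ _ ih => exact .sigL hx h₁ h₂ (ih ⟨hN, hx⟩)
  | sigR hr hp _ ih => exact .sigR (ih hN) (.refine_of_ent hN hr hp)
  | alpha => exact .alpha

/-! ## Relational substitution -/

/-- `t'` results from `t` by replacing each free variable by a term that `E` allows for it. -/
inductive Term.Rel (E : Var → Term T → Prop) : Term T → Term T → Prop where
  | bvar {i} : Rel E (.bvar i) (.bvar i)
  | fvar {x u} : E x u → Rel E (.fvar x) u
  | con {c} : Rel E (.con c) (.con c)
  | app {t u t' u'} : Rel E t t' → Rel E u u' → Rel E (.app t u) (.app t' u')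

inductive Refn.Rel (E : Var → Term T → Prop) : Refn T → Refn T → Prop where
  | pred {t t'} : t.Rel E t' → Rel E (.pred t) (.pred t')
  | kapp {κ as as'} : Rel E (.kapp κ as) (.kapp κ as')
  | and {p q p' q'} : Rel E p p' → Rel E q q' → Rel E (.and p q) (.and p' q')

inductive Ty.Rel (E : Var → Term T → Prop) (f : TVar → TVar) : Ty T → Ty T → Prop where
  | refine {b r r'} : r.Rel E r' → Rel E f (.refine b r) (.refine b r')
  | fn {t u t' u'} : Rel E f t t' → Rel E f u u' → Rel E f (.fn t u) (.fn t' u')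
  | ifn {t u t' u'} : Rel E f t t' → Rel E f u u' → Rel E f (.ifn t u) (.ifn t' u')
  | sig {t u t' u'} : Rel E f t t' → Rel E f u u' → Rel E f (.sig t u) (.sig t' u')
  | bvar {i} : Rel E f (.bvar i) (.bvar i)
  | fvar {a} : Rel E f (.fvar a) (.fvar (f a))
  | all {t t'} : Rel E f t t' → Rel E f (.all t) (.all t')

/-- Extends `E` by `x ↦ v`. -/
def extE (E : Var → Term T → Prop) (x : Var) (v : Term T) : Var → Term T → Prop :=
  fun y u => (y = x ∧ u = v) ∨ (y ≠ x ∧ E y u)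

def idE : Var → Term T → Prop := fun y u => u = .fvar y

section Rel

variable {E E' : Var → Term T → Prop} {f f' : TVar → TVar}

theorem Term.Rel.opn (hE : ∀ x u, E x u → u.LC) {t t' r r' : Term T} (h : t.Rel E t')
    (hr : r.Rel E r') (k : ℕ) : (t.opn k r).Rel E (t'.opn k r') := by
  induction h with
  | @bvar i =>
    by_cases hi : i = k
    · simpa [Term.opn, hi] using hr
    · simpa [Term.opn, hi] using .bvar
  | fvar h => rw [Term.opn_lc (hE _ _ h)]; exact .fvar h
  | con => exact .con
  | app _ _ h₁ h₂ => exact .app h₁ h₂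

theorem Refn.Rel.opn (hE : ∀ x u, E x u → u.LC) {t t' : Refn T} {r r' : Term T} (h : t.Rel E t')
    (hr : r.Rel E r') (k : ℕ) : (t.opn k r).Rel E (t'.opn k r') := by
  induction h with
  | pred h => exact .pred (h.opn hE hr k)
  | kapp => exact .kapp
  | and _ _ h₁ h₂ => exact .and h₁ h₂

theorem Ty.Rel.opn (hE : ∀ x u, E x u → u.LC) {t t' : Ty T} {r r' : Term T} (h : t.Rel E f t')
    (hr : r.Rel E r') (k : ℕ) : (t.opn k r).Rel E f (t'.opn k r') := by
  induction h generalizing k with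
  | refine h => exact .refine (h.opn hE hr _)
  | fn _ _ h₁ h₂ => exact .fn (h₁ _) (h₂ _)
  | ifn _ _ h₁ h₂ => exact .ifn (h₁ _) (h₂ _)
  | sig _ _ h₁ h₂ => exact .sig (h₁ _) (h₂ _)
  | bvar => exact .bvar
  | fvar => exact .fvar
  | all _ ih => exact .all (ih _)

theorem Ty.Rel.opnT {t t' : Ty T} {a a' : TVar} (h : t.Rel E f t') (ha : a ∉ t.ftv) (k : ℕ) :
    (t.opnT k (.fvar a)).Rel E (Function.update f a a') (t'.opnT k (.fvar a')) := by
  induction h generalizing k with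
  | refine h => exact .refine h
  | fn _ _ h₁ h₂ => exact .fn (h₁ (fun h => ha (Or.inl h)) _) (h₂ (fun h => ha (Or.inr h)) _)
  | ifn _ _ h₁ h₂ => exact .ifn (h₁ (fun h => ha (Or.inl h)) _) (h₂ (fun h => ha (Or.inr h)) _)
  | sig _ _ h₁ h₂ => exact .sig (h₁ (fun h => ha (Or.inl h)) _) (h₂ (fun h => ha (Or.inr h)) _)
  | @bvar i =>
    by_cases hi : i = k
    · simp only [Ty.opnT, if_pos hi]
      have : a' = Function.update f a a' a := by simp
      nth_rw 2 [this]
      exact .fvar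
    · simpa [Ty.opnT, hi] using .bvar
  | @fvar c =>
    have : f c = Function.update f a a' c := by
      rw [Function.update_of_ne]
      rintro rfl
      exact ha rfl
    simp only [Ty.opnT]
    rw [this]
    exact .fvar
  | all _ ih => exact .all (ih ha _)

theorem Term.Rel.mono {t t' : Term T} (h : t.Rel E t')
    (hE : ∀ x ∈ t.fv, ∀ u, E x u → E' x u) : t.Rel E' t' := by
  induction h with
  | bvar => exact .bvar
  | fvar h => exact .fvar (hE _ rfl _ h)
  | con => exact .con
  | app _ _ h₁ h₂ =>
    exact .app (h₁ fun x hx => hE x (Or.inl hx)) (h₂ fun x hx => hE x (Or.inr hx))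

theorem Refn.Rel.mono {t t' : Refn T} (h : t.Rel E t')
    (hE : ∀ x ∈ t.fv, ∀ u, E x u → E' x u) : t.Rel E' t' := by
  induction h with
  | pred h => exact .pred (h.mono hE)
  | kapp => exact .kapp
  | and _ _ h₁ h₂ =>
    exact .and (h₁ fun x hx => hE x (Or.inl hx)) (h₂ fun x hx => hE x (Or.inr hx))

theorem Ty.Rel.mono {t t' : Ty T} (h : t.Rel E f t')
    (hE : ∀ x ∈ t.fv, ∀ u, E x u → E' x u) : t.Rel E' f t' := by
  induction h with
  | refine h => exact .refine (h.mono hE)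
  | fn _ _ h₁ h₂ =>
    exact .fn (h₁ fun x hx => hE x (Or.inl hx)) (h₂ fun x hx => hE x (Or.inr hx))
  | ifn _ _ h₁ h₂ =>
    exact .ifn (h₁ fun x hx => hE x (Or.inl hx)) (h₂ fun x hx => hE x (Or.inr hx))
  | sig _ _ h₁ h₂ =>
    exact .sig (h₁ fun x hx => hE x (Or.inl hx)) (h₂ fun x hx => hE x (Or.inr hx))
  | bvar => exact .bvar
  | fvar => exact .fvar
  | all _ ih => exact .all (ih hE)

theorem extE_of_ne {x : Var} {v : Term T} {s : Set Var} (hx : x ∉ s) :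
    ∀ y ∈ s, ∀ u, E y u → extE E x v y u := fun y hy _ h =>
  Or.inr ⟨by rintro rfl; exact hx hy, h⟩

theorem extE_self (E : Var → Term T → Prop) (x : Var) (v : Term T) : extE E x v x v :=
  Or.inl ⟨rfl, rfl⟩

theorem extE_lc (hE : ∀ x u, E x u → u.LC) (x : Var) {v : Term T} (hv : v.LC) :
    ∀ y u, extE E x v y u → u.LC := by
  rintro y u (⟨-, rfl⟩ | ⟨-, h⟩)
  · exact hv
  · exact hE y u h

theorem Ty.Rel.opn_ext (hE : ∀ x u, E x u → u.LC) {t t' : Ty T} (h : t.Rel E f t') {x : Var}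
    {v : Term T} (hv : v.LC) (hx : x ∉ t.fv) :
    (t.opn 0 (.fvar x)).Rel (extE E x v) f (t'.opn 0 v) :=
  (h.mono (extE_of_ne hx)).opn (extE_lc hE x hv) (.fvar (extE_self E x v)) 0

theorem Refn.Rel.opn_ext (hE : ∀ x u, E x u → u.LC) {t t' : Refn T} (h : t.Rel E t') {x : Var}
    {v : Term T} (hv : v.LC) (hx : x ∉ t.fv) :
    (t.opn 0 (.fvar x)).Rel (extE E x v) (t'.opn 0 v) :=
  (h.mono (extE_of_ne hx)).opn (extE_lc hE x hv) (.fvar (extE_self E x v)) 0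

theorem Term.Rel.refl (hE : ∀ x, E x (.fvar x)) (t : Term T) : t.Rel E t := by
  induction t with
  | bvar => exact .bvar
  | fvar x => exact .fvar (hE x)
  | con => exact .con
  | app _ _ h₁ h₂ => exact .app h₁ h₂

theorem Refn.Rel.refl (hE : ∀ x, E x (.fvar x)) (t : Refn T) : t.Rel E t := by
  induction t with
  | pred r => exact .pred (.refl hE r)
  | kapp => exact .kapp
  | and _ _ h₁ h₂ => exact .and h₁ h₂

theorem Ty.Rel.refl (hE : ∀ x, E x (.fvar x)) (t : Ty T) : t.Rel E id t := by
  induction t with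
  | refine b r => exact .refine (.refl hE r)
  | fn _ _ h₁ h₂ => exact .fn h₁ h₂
  | ifn _ _ h₁ h₂ => exact .ifn h₁ h₂
  | sig _ _ h₁ h₂ => exact .sig h₁ h₂
  | bvar => exact .bvar
  | fvar a => exact .fvar (f := id)
  | all _ ih => exact .all ih

theorem idE_refl (x : Var) : idE x (.fvar x : Term T) := rfl

theorem idE_lc (x : Var) (u : Term T) (h : idE x u) : u.LC := by
  rw [show u = .fvar x from h]
  trivial

theorem Ty.Rel.refl_of_not_mem {t : Ty T} {x : Var} (hx : x ∉ t.fv) (v : Term T) :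
    t.Rel (extE idE x v) id t := (Ty.Rel.refl idE_refl t).mono (extE_of_ne hx)

theorem Ty.Rel.opn_id {t : Ty T} {x : Var} (hx : x ∉ t.fv) {v : Term T} (hv : v.LC) :
    (t.opn 0 (.fvar x)).Rel (extE idE x v) id (t.opn 0 v) :=
  (Ty.Rel.refl idE_refl t).opn_ext idE_lc hv hx

theorem Term.Rel.exists {t : Term T} (h : ∀ x ∈ t.fv, ∃ u, E x u) : ∃ t', t.Rel E t' := by
  induction t with
  | bvar i => exact ⟨_, .bvar⟩
  | fvar x =>
    obtain ⟨u, hu⟩ := h x rfl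
    exact ⟨u, .fvar hu⟩
  | con c => exact ⟨_, .con⟩
  | app s t hs ht =>
    obtain ⟨s', hs'⟩ := hs fun x hx => h x (Or.inl hx)
    obtain ⟨t', ht'⟩ := ht fun x hx => h x (Or.inr hx)
    exact ⟨_, .app hs' ht'⟩

variable {S S' : Var → Option T.B}

theorem Term.Rel.hasSort {L : List (Option T.B)} {s : T.S} {t t' : Term T} (h : t.Rel E t')
    (ht : HasSort S L t s)
    (hE : ∀ x b u, S x = some b → E x u → HasSort S' [] u (.base b)) : HasSort S' L t' s := by
  induction h generalizing s with
  | bvar => cases ht with | bvar h => exact .bvar h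
  | fvar h => cases ht with | fvar h' => exact (hE _ _ _ h' h).weaken
  | con => cases ht; exact .con
  | app _ _ h₁ h₂ => cases ht with | app ht₁ ht₂ => exact .app (h₁ ht₁) (h₂ ht₂)

theorem Refn.Rel.ws {L : List (Option T.B)} {t t' : Refn T} (h : t.Rel E t') (ht : t.WS S L)
    (hE : ∀ x b u, S x = some b → E x u → HasSort S' [] u (.base b)) : t'.WS S' L := by
  induction h with
  | pred h => exact h.hasSort ht hE
  | kapp => exact ht.elim
  | and _ _ h₁ h₂ => exact ⟨h₁ ht.1, h₂ ht.2⟩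

theorem Term.Rel.eval {s : T.S} {t t' : Term T} {ρ ρ' : Env T} (h : t.Rel E t')
    (ht : HasSort S [] t s)
    (hE : ∀ x b u, S x = some b → E x u → u.eval ρ' = (Term.fvar x).eval ρ) :
    t'.eval ρ' = t.eval ρ := by
  induction h generalizing s with
  | bvar => rfl
  | fvar h => cases ht with | fvar h' => exact hE _ _ _ h' h
  | con => rfl
  | app _ _ h₁ h₂ => cases ht with | app ht₁ ht₂ => simp only [Term.eval, h₁ ht₁, h₂ ht₂]

theorem Refn.Rel.holds {t t' : Refn T} {ρ ρ' : Env T} (h : t.Rel E t') (ht : t.WS S [])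
    (hE : ∀ x b u, S x = some b → E x u → u.eval ρ' = (Term.fvar x).eval ρ) :
    t'.Holds ρ' ↔ t.Holds ρ := by
  induction h with
  | pred h => simp only [Refn.Holds, h.eval ht hE]
  | kapp => exact ht.elim
  | and _ _ h₁ h₂ => simp only [Refn.Holds, h₁ ht.1, h₂ ht.2]

end Rel

/-- `E` interprets the logical content of `Γ` in `Γ'`. -/
structure Mor (E : Var → Term T → Prop) (Γ Γ' : Ctx T) : Prop where
  lc : ∀ x u, E x u → u.LC
  tot : ∀ x b, Γ.semS x = some b → ∃ u, E x u
  sort : ∀ x b u, Γ.semS x = some b → E x u → HasSort Γ'.semS [] u (.base b)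
  sat : ∀ ρ' ∈ Γ'.sat, ∃ ρ ∈ Γ.sat, ∀ x b u, Γ.semS x = some b → E x u →
    u.eval ρ' = (Term.fvar x).eval ρ
  ews : Γ'.EWS

theorem fvar_eval_update {ρ : Env T} {x y : Var} (h : y ≠ x) (v) :
    (Term.fvar y : Term T).eval (Function.update ρ x v) = (Term.fvar y).eval ρ := by
  simp [Term.eval, Function.update_of_ne h]

namespace Mor

variable {E : Var → Term T → Prop} {f : TVar → TVar} {Γ Γ' : Ctx T}

theorem ent (h : Mor E Γ Γ') {p p' : Refn T} (hp : Γ.Ent p) (hr : p.Rel E p') : Γ'.Ent p' := by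
  refine ⟨h.ews, hr.ws hp.2.1 h.sort, fun ρ' hρ' => ?_⟩
  obtain ⟨ρ, hρ, he⟩ := h.sat ρ' hρ'
  exact (hr.holds hp.2.1 he).2 (hp.2.2 ρ hρ)

theorem id (h : Γ.EWS) : Mor idE Γ Γ where
  lc := idE_lc
  tot x _ _ := ⟨_, idE_refl x⟩
  sort x b u hx hu := by
    rw [show u = .fvar x from hu]
    exact .fvar hx
  sat ρ hρ := ⟨ρ, hρ, fun x b u _ hu => by rw [show u = .fvar x from hu]⟩
  ews := h

theorem ext (h : Mor E Γ Γ') {x x' : Var} {t t' : Ty T} (hx : x ∉ Γ.fv) (hx' : x' ∉ Γ'.fv)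
    (hxt : x ∉ t.fv) (ht : t.Rel E f t') (hews : (Ctx.corp Γ x t).EWS) :
    Mor (extE E x (.fvar x')) (.corp Γ x t) (.corp Γ' x' t') := by
  have hlc := extE_lc h.lc x (v := .fvar x') trivial
  have hold : ∀ y b u, Γ.semS y = some b → extE E x (.fvar x') y u → E y u := by
    rintro y b u hy (⟨rfl, -⟩ | ⟨-, h⟩)
    · simp [Ctx.semS_eq_none hx] at hy
    · exact h
  have htot : ∀ y b, Γ.semS y = some b → ∃ u, extE E x (.fvar x') y u := by
    intro y b hy
    obtain ⟨u, hu⟩ := h.tot y b hy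
    refine ⟨u, Or.inr ⟨?_, hu⟩⟩
    rintro rfl
    simp [Ctx.semS_eq_none hx] at hy
  have trivialCase : (Ctx.corp Γ x t).semS = Γ.semS → (Ctx.corp Γ x t).sat = Γ.sat →
      (Ctx.corp Γ' x' t').semS = Γ'.semS → (Ctx.corp Γ' x' t').sat = Γ'.sat →
      (Ctx.corp Γ' x' t').EWS →
      Mor (extE E x (.fvar x')) (.corp Γ x t) (.corp Γ' x' t') := by
    intro e₁ e₂ e₃ e₄ e₅
    refine ⟨hlc, ?_, ?_, ?_, e₅⟩
    · rwa [e₁]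
    · rw [e₁, e₃]
      exact fun y b u hy hu => h.sort y b u hy (hold y b u hy hu)
    · rw [e₁, e₂, e₄]
      intro ρ' hρ'
      obtain ⟨ρ, hρ, he⟩ := h.sat ρ' hρ'
      exact ⟨ρ, hρ, fun y b u hy hu => he y b u hy (hold y b u hy hu)⟩
  cases ht with
  | @refine b r r' hr =>
    have hr' := hr.opn_ext h.lc (x := x) (v := .fvar x') trivial hxt
    have hsort : ∀ y b₀ u, (Ctx.corp Γ x (.refine b r)).semS y = some b₀ →
        extE E x (.fvar x') y u →
        HasSort (Function.update Γ'.semS x' (some b)) [] u (.base b₀) := by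
      rintro y b₀ u hy (⟨rfl, rfl⟩ | ⟨hne, hu⟩)
      · simp only [Ctx.semS, Ty.extS, Function.update_self, Option.some.injEq] at hy
        subst hy
        exact .fvar (by simp)
      · simp only [Ctx.semS, Ty.extS, Function.update_of_ne hne] at hy
        exact (h.sort y b₀ u hy hu).mono_sort (Ctx.le_update hx' _)
    refine ⟨hlc, ?_, hsort, ?_, ⟨h.ews, hr'.ws hews.2 hsort⟩⟩
    · intro y b₀ hy
      by_cases hne : y = x
      · exact ⟨_, Or.inl ⟨hne, rfl⟩⟩
      · simp only [Ctx.semS, Ty.extS, Function.update_of_ne hne] at hy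
        exact htot y b₀ hy
    · rintro ρ' ⟨ρ₀', hρ₀', a, rfl, hh⟩
      obtain ⟨ρ₀, hρ₀, he⟩ := h.sat ρ₀' hρ₀'
      have he' : ∀ y b₀ u, (Ctx.corp Γ x (.refine b r)).semS y = some b₀ →
          extE E x (.fvar x') y u → u.eval (Function.update ρ₀' x' (some ⟨b, a⟩))
            = (Term.fvar y).eval (Function.update ρ₀ x (some ⟨b, a⟩)) := by
        rintro y b₀ u hy (⟨rfl, rfl⟩ | ⟨hne, hu⟩)
        · simp [Term.eval]
        · simp only [Ctx.semS, Ty.extS, Function.update_of_ne hne] at hy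
          rw [fvar_eval_update hne, eval_update (Ctx.not_mem_fv hx' (h.sort y b₀ u hy hu))]
          exact he y b₀ u hy hu
      exact ⟨_, ⟨ρ₀, hρ₀, a, rfl, (hr'.holds hews.2 he').1 hh⟩, he'⟩
  | _ => exact trivialCase rfl rfl rfl rfl ⟨h.ews, trivial⟩

theorem tvar (h : Mor E Γ Γ') (a a' : TVar) : Mor E (.tvar Γ a) (.tvar Γ' a') :=
  ⟨h.lc, h.tot, h.sort, h.sat, h.ews⟩

end Mor

theorem SSub.mor {n : ℕ} {Γ : Ctx T} {t u : Ty T} (h : SSub n Γ t u) {Γ' : Ctx T}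
    {E : Var → Term T → Prop} {f : TVar → TVar} {t' u' : Ty T} (hm : Mor E Γ Γ')
    (ht : t.Rel E f t') (hu : u.Rel E f u') : SSub n Γ' t' u' := by
  induction h generalizing Γ' E f t' u' with
  | @base Γ v b r₁ r₂ hv h₁ h₂ h =>
    cases ht with | @refine _ _ r₁' hr₁ =>
    cases hu with | @refine _ _ r₂' hr₂ =>
    obtain ⟨v', hv'⟩ := exists_fresh ((Γ'.fv_finite.union r₁'.fv_finite).union r₂'.fv_finite)
    simp only [Set.mem_union, not_or] at hv'
    refine .base hv'.1.1 hv'.1.2 hv'.2 ?_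
    exact (hm.ext (f := f) (t := .refine b r₁) hv hv'.1.1 h₁ (.refine hr₁) h.1).ent h
      (hr₂.opn_ext hm.lc trivial h₂)
  | @fn n m Γ x t₁ t₁' t₂ t₂' hx hx₂ h₁ h₂ hews _ _ ih₁ ih₂ =>
    cases ht with | @fn _ _ s₁ s₁' ht₁ ht₁' =>
    cases hu with | @fn _ _ s₂ s₂' ht₂ ht₂' =>
    obtain ⟨x', hx'⟩ := exists_fresh
      (((Γ'.fv_finite.union s₂.fv_finite).union s₁'.fv_finite).union s₂'.fv_finite)
    simp only [Set.mem_union, not_or] at hx'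
    obtain ⟨⟨⟨a₁, a₂⟩, a₃⟩, a₄⟩ := hx'
    have hm' := hm.ext hx a₁ hx₂ ht₂ hews
    exact .fn a₁ a₂ a₃ a₄ hm'.ews (ih₁ hm ht₂ ht₁)
      (ih₂ hm' (ht₁'.opn_ext hm.lc trivial h₁) (ht₂'.opn_ext hm.lc trivial h₂))
  | @all n Γ a t₁ t₂ ha h₁ h₂ _ ih =>
    cases ht with | @all _ s₁ ht₁ =>
    cases hu with | @all _ s₂ ht₂ =>
    obtain ⟨a', ha'⟩ := exists_fresh ((Γ'.ftv_finite.union s₁.ftv_finite).union s₂.ftv_finite)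
    simp only [Set.mem_union, not_or] at ha'
    exact .all ha'.1.1 ha'.1.2 ha'.2 (ih (hm.tvar a a') (ht₁.opnT h₁ 0) (ht₂.opnT h₂ 0))
  | @funIL n Γ b p t₁' t₂ r hr hp _ ih =>
    cases ht with | ifn ht₁ ht₁' =>
    cases ht₁ with | refine hpp =>
    obtain ⟨r', hr'⟩ := Term.Rel.exists (E := E) (t := r) fun x hx => by
      obtain ⟨b, hb⟩ := hr.mem_dom hx
      exact hm.tot x b hb
    exact .funIL (hr'.hasSort hr hm.sort) (hm.ent hp (hpp.opn hm.lc hr' 0))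
      (ih hm (ht₁'.opn hm.lc hr' 0) hu)
  | @funIR n Γ x t₁ t₂ t₂' hx h₁ hx₂ h₂ hews _ ih =>
    cases hu with | @ifn _ _ s₂ s₂' ht₂ ht₂' =>
    obtain ⟨x', hx'⟩ := exists_fresh
      (((Γ'.fv_finite.union t'.fv_finite).union s₂.fv_finite).union s₂'.fv_finite)
    simp only [Set.mem_union, not_or] at hx'
    obtain ⟨⟨⟨a₁, a₂⟩, a₃⟩, a₄⟩ := hx'
    have hm' := hm.ext hx a₁ hx₂ ht₂ hews
    exact .funIR a₁ a₂ a₃ a₄ hm'.ews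
      (ih hm' (ht.mono (extE_of_ne h₁)) (ht₂'.opn_ext hm.lc trivial h₂))
  | @sigL n Γ x t₁ t₁' t₂ hx hx₁ h₁ h₂ hews _ ih =>
    cases ht with | @sig _ _ s₁ s₁' ht₁ ht₁' =>
    obtain ⟨x', hx'⟩ := exists_fresh
      (((Γ'.fv_finite.union s₁.fv_finite).union s₁'.fv_finite).union u'.fv_finite)
    simp only [Set.mem_union, not_or] at hx'
    obtain ⟨⟨⟨a₁, a₂⟩, a₃⟩, a₄⟩ := hx'
    have hm' := hm.ext hx a₁ hx₁ ht₁ hews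
    exact .sigL a₁ a₂ a₃ a₄ hm'.ews
      (ih hm' (ht₁'.opn_ext hm.lc trivial h₁) (hu.mono (extE_of_ne h₂)))
  | @sigR n Γ t₁ b p t₂' r hr hp _ ih =>
    cases hu with | sig ht₂ ht₂' =>
    cases ht₂ with | refine hpp =>
    obtain ⟨r', hr'⟩ := Term.Rel.exists (E := E) (t := r) fun x hx => by
      obtain ⟨b, hb⟩ := hr.mem_dom hx
      exact hm.tot x b hb
    exact .sigR (hr'.hasSort hr hm.sort) (hm.ent hp (hpp.opn hm.lc hr' 0))
      (ih hm ht (ht₂'.opn hm.lc hr' 0))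
  | alpha =>
    cases ht with | fvar =>
    cases hu with | fvar => exact .alpha

/-! ## Particular interpretations of contexts -/

theorem Refn.holds_rename {ρ : Env T} {p : Refn T} {x y : Var} (hx : x ∉ p.fv) (hy : y ∉ p.fv)
    {v : Option (Σ b : T.B, b.Carrier T.Carrier)}
    (h : (p.opn 0 (.fvar x)).Holds (Function.update ρ x v)) :
    (p.opn 0 (.fvar y)).Holds (Function.update ρ y v) := by
  have key : ∀ t : Term T, x ∉ t.fv → y ∉ t.fv →
      (t.opn 0 (.fvar x)).eval (Function.update ρ x v)
        = (t.opn 0 (.fvar y)).eval (Function.update ρ y v) := by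
    intro t hx hy
    induction t with
    | bvar i => by_cases hi : i = 0 <;> simp [Term.opn, Term.eval, hi]
    | fvar z =>
      have h₁ : z ≠ x := by rintro rfl; exact hx rfl
      have h₂ : z ≠ y := by rintro rfl; exact hy rfl
      simp [Term.opn, Term.eval, h₁, h₂]
    | con => rfl
    | app s t hs ht =>
      simp only [Term.fv, Set.mem_union, not_or] at hx hy
      simp only [Term.opn, Term.eval, hs hx.1 hy.1, ht hx.2 hy.2]
  induction p with
  | pred r => simpa only [Refn.opn, Refn.Holds, key r hx hy] using h
  | kapp => exact h.elim
  | and p q hp hq =>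
    exact ⟨hp (fun h => hx (Or.inl h)) (fun h => hy (Or.inl h)) h.1,
      hq (fun h => hx (Or.inr h)) (fun h => hy (Or.inr h)) h.2⟩

namespace Mor

variable {Γ : Ctx T}

theorem weaken {x : Var} {t : Ty T} (hx : x ∉ Γ.fv) (h : (Ctx.corp Γ x t).EWS) :
    Mor idE Γ (.corp Γ x t) where
  lc := idE_lc
  tot y _ _ := ⟨_, idE_refl y⟩
  sort y b u hy hu := by
    rw [show u = .fvar y from hu]
    exact .fvar (Ctx.le_extS hx t y b hy)
  sat ρ' hρ' := by
    cases t with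
    | refine b r =>
      obtain ⟨ρ, hρ, a, rfl, -⟩ := hρ'
      refine ⟨ρ, hρ, fun y b' u hy hu => ?_⟩
      rw [show u = .fvar y from hu, fvar_eval_update]
      rintro rfl
      simp [Ctx.semS_eq_none hx] at hy
    | _ => exact ⟨ρ', hρ', fun y b u _ hu => by rw [show u = .fvar y from hu]⟩
  ews := h

theorem rename {x y : Var} {t : Ty T} (hx : x ∉ Γ.fv) (hxt : x ∉ t.fv) (hy : y ∉ Γ.fv)
    (h : (Ctx.corp Γ x t).EWS) : Mor (extE idE x (.fvar y)) (.corp Γ x t) (.corp Γ y t) :=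
  (Mor.id h.1).ext hx hy hxt (.refl idE_refl t) h

/-- A term that satisfies the type of a variable can be put for it. -/
theorem inst {x : Var} {b : T.B} {p : Refn T} {r : Term T} (hx : x ∉ Γ.fv) (hxp : x ∉ p.fv)
    (hr : HasSort Γ.semS [] r (.base b)) (hp : Γ.Ent (p.opn 0 r)) :
    Mor (extE idE x r) (.corp Γ x (.refine b p)) Γ where
  lc := extE_lc idE_lc x hr.lc
  tot y _ _ := by
    by_cases h : y = x
    · exact ⟨r, Or.inl ⟨h, rfl⟩⟩
    · exact ⟨.fvar y, Or.inr ⟨h, rfl⟩⟩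
  sort := by
    rintro y b' u hy (⟨rfl, rfl⟩ | ⟨hne, hu⟩)
    · simp only [Ctx.semS, Ty.extS, Function.update_self, Option.some.injEq] at hy
      rwa [← hy]
    · simp only [Ctx.semS, Ty.extS, Function.update_of_ne hne] at hy
      rw [show u = .fvar y from hu]
      exact .fvar hy
  sat ρ hρ := by
    obtain ⟨a, ha⟩ := hr.eval_base (Ctx.sat_models hρ)
    have hxr := Ctx.not_mem_fv hx hr
    refine ⟨_, ⟨ρ, hρ, a, rfl, ?_⟩, ?_⟩
    · have e₁ := (eval_update hxr (some ⟨b, a⟩)).trans ha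
      have e₀ := eval_fvar (ρ := Function.update ρ x (some ⟨b, a⟩)) (Function.update_self x _ ρ)
      refine (Refn.Holds_opn_congr (e₀.trans e₁.symm) p 0).2 ?_
      refine (Refn.Holds_congr fun y hy => ?_).2 (hp.2.2 ρ hρ)
      refine Function.update_of_ne ?_ _ _
      rintro rfl
      exact (p.fv_opn_subset _ _ hy).elim hxp hxr
    · rintro y b' u hy (⟨rfl, rfl⟩ | ⟨hne, hu⟩)
      · rw [ha]
        simp [Term.eval]
      · rw [show u = .fvar y from hu, fvar_eval_update hne]
  ews := hp.1

/-- Narrowing of the type of the last variable. -/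
theorem narrow {m : ℕ} {x y : Var} {a a' : Ty T} (h : SSub m Γ a' a)
    (hb : a.IsBase ↔ a'.IsBase) (hx : x ∉ Γ.fv) (hy : y ∉ Γ.fv) (hxa : x ∉ a.fv)
    (hya : y ∉ a.fv) (hya' : y ∉ a'.fv) (hews : (Ctx.corp Γ y a').EWS) :
    Mor (extE idE x (.fvar y)) (.corp Γ x a) (.corp Γ y a') := by
  by_cases hbase : a.IsBase
  · obtain ⟨b', r', rfl⟩ := hb.1 hbase
    obtain ⟨b, r, rfl⟩ := hbase
    cases h with | @base _ v _ _ _ hv h₁ h₂ he =>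
    refine ⟨extE_lc idE_lc x trivial, ?_, ?_, ?_, hews⟩
    · intro z _ _
      by_cases h : z = x
      · exact ⟨_, Or.inl ⟨h, rfl⟩⟩
      · exact ⟨.fvar z, Or.inr ⟨h, rfl⟩⟩
    · rintro z b' u hz (⟨rfl, rfl⟩ | ⟨hne, hu⟩)
      · simp only [Ctx.semS, Ty.extS, Function.update_self, Option.some.injEq] at hz
        subst hz
        exact .fvar (by simp [Ctx.semS, Ty.extS])
      · simp only [Ctx.semS, Ty.extS, Function.update_of_ne hne] at hz
        rw [show u = .fvar z from hu]
        exact .fvar (Ctx.le_update hy _ _ _ hz)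
    · rintro ρ' ⟨ρ, hρ, d, rfl, hh⟩
      refine ⟨_, ⟨ρ, hρ, d, rfl, ?_⟩, ?_⟩
      · exact Refn.holds_rename h₂ hxa
          (he.2.2 _ ⟨ρ, hρ, d, rfl, Refn.holds_rename hya' h₁ hh⟩)
      · rintro z b' u hz (⟨rfl, rfl⟩ | ⟨hne, hu⟩)
        · simp [Term.eval]
        · simp only [Ctx.semS, Ty.extS, Function.update_of_ne hne] at hz
          rw [show u = .fvar z from hu, fvar_eval_update hne, fvar_eval_update]
          rintro rfl
          simp [Ctx.semS_eq_none hy] at hz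
  · have hbase' := fun h => hbase (hb.2 h)
    have e₁ : ∀ z (t : Ty T), ¬ t.IsBase → (Ctx.corp Γ z t).semS = Γ.semS ∧
        (Ctx.corp Γ z t).sat = Γ.sat := by
      intro z t ht
      cases t with
      | refine b r => exact (ht ⟨b, r, rfl⟩).elim
      | _ => exact ⟨rfl, rfl⟩
    have hold : ∀ z b (u : Term T), Γ.semS z = some b →
        extE idE x (.fvar y) z u → u = .fvar z := by
      rintro z b u hz (⟨rfl, -⟩ | ⟨-, h⟩)
      · simp [Ctx.semS_eq_none hx] at hz
      · exact h
    refine ⟨extE_lc idE_lc x trivial, ?_, ?_, ?_, hews⟩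
    · intro z _ _
      by_cases h : z = x
      · exact ⟨_, Or.inl ⟨h, rfl⟩⟩
      · exact ⟨.fvar z, Or.inr ⟨h, rfl⟩⟩
    · rw [(e₁ x a hbase).1, (e₁ y a' hbase').1]
      intro z b u hz hu
      rw [hold z b u hz hu]
      exact .fvar hz
    · rw [(e₁ x a hbase).1, (e₁ x a hbase).2, (e₁ y a' hbase').2]
      intro ρ hρ
      exact ⟨ρ, hρ, fun z b u hz hu => by rw [hold z b u hz hu]⟩

/-- A new variable with the value of `y` can be put for some of the occurrences of `y`. -/
theorem copy {y y' : Var} {t : Ty T} (hy' : y' ∉ Γ.fv) (hews : (Ctx.corp Γ y' t).EWS)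
    (ht : ∀ b, Γ.semS y = some b → ∃ r, t = selfTy b r y) :
    Mor (fun z u => u = .fvar z ∨ (z = y ∧ u = .fvar y')) Γ (.corp Γ y' t) where
  lc := by
    rintro z u (rfl | ⟨-, rfl⟩) <;> trivial
  tot z _ _ := ⟨_, Or.inl rfl⟩
  sort := by
    rintro z b u hz (rfl | ⟨rfl, rfl⟩)
    · exact .fvar (Ctx.le_extS hy' t z b hz)
    · obtain ⟨r, rfl⟩ := ht b hz
      exact .fvar (by simp [selfTy, Ctx.semS, Ty.extS])
  sat ρ' hρ' := by
    have hne : ∀ z b, Γ.semS z = some b → z ≠ y' := by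
      rintro z b hz rfl
      simp [Ctx.semS_eq_none hy'] at hz
    by_cases hb : ∃ b, Γ.semS y = some b
    · obtain ⟨b, hb⟩ := hb
      obtain ⟨r, rfl⟩ := ht b hb
      obtain ⟨ρ, hρ, a, rfl, -, h⟩ := hρ'
      refine ⟨ρ, hρ, ?_⟩
      rintro z b' u hz (rfl | ⟨rfl, rfl⟩)
      · exact fvar_eval_update (hne z b' hz) _
      · obtain ⟨d, hd⟩ := Ctx.sat_models hρ z b hb
        have e₁ := eval_fvar hd
        have e₂ := (fvar_eval_update (hne z b' hz) (some ⟨b, a⟩)).trans e₁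
        have e₀ := eval_fvar (ρ := Function.update ρ y' (some ⟨b, a⟩))
          (Function.update_self y' _ ρ)
        have := (Term.eval_eq_bool e₀ e₂).1 h
        rw [e₀, e₁, this]
    · obtain ⟨ρ, hρ, he⟩ := (Mor.weaken hy' hews).sat ρ' hρ'
      refine ⟨ρ, hρ, ?_⟩
      rintro z b' u hz (rfl | ⟨rfl, rfl⟩)
      · exact he z b' _ hz rfl
      · exact (hb ⟨b', hz⟩).elim
  ews := hews

end Mor

/-! ## Transitivity -/

open Classical in
/-- The erasure of a type, together with the information which domains are refined base types. -/
noncomputable def Ty.sk : Ty T → Ty T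
  | .refine b _ => .refine b .tt
  | .fn t s => .fn (if t.IsBase then t.sk else .sig (.refine .int .tt) t.sk) s.sk
  | .ifn _ s => s.sk
  | .sig _ s => s.sk
  | .bvar i => .bvar i
  | .fvar a => .fvar a
  | .all t => .all t.sk

namespace Ty

theorem isBase_opn {t : Ty T} {k : ℕ} {u : Term T} : (t.opn k u).IsBase ↔ t.IsBase :=
  ⟨isBase_of_opn, fun h => h.opn k u⟩

theorem isBase_opnT {t : Ty T} {k : ℕ} {a : TVar} : (t.opnT k (.fvar a)).IsBase ↔ t.IsBase :=
  ⟨isBase_of_opnT, fun h => h.opnT k _⟩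

theorem isBase_sub {t : Ty T} {σ : Var → Term T} : (t.sub σ).IsBase ↔ t.IsBase := by
  refine ⟨?_, fun h => h.sub σ⟩
  rintro ⟨b, r, h⟩
  cases t <;> simp [sub] at h
  exact ⟨_, _, rfl⟩

theorem sk_opn (t : Ty T) (k : ℕ) (u : Term T) : (t.opn k u).sk = t.sk := by
  induction t generalizing k with
  | fn t s h₁ h₂ => by_cases h : t.IsBase <;> simp [opn, sk, isBase_opn, h, h₁, h₂]
  | _ => simp [opn, sk, *]

theorem sk_opnT (t : Ty T) (k : ℕ) (a : TVar) :
    (t.opnT k (.fvar a)).sk = t.sk.opnT k (.fvar a) := by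
  induction t generalizing k with
  | bvar i => by_cases h : i = k <;> simp [opnT, sk, h]
  | fn t s h₁ h₂ =>
    by_cases h : t.IsBase <;> simp [opnT, sk, isBase_opnT, h, h₁, h₂]
  | _ => simp [opnT, sk, *]

theorem sk_sub (σ : Var → Term T) (t : Ty T) : (t.sub σ).sk = t.sk := by
  induction t with
  | fn t s h₁ h₂ => by_cases h : t.IsBase <;> simp [sub, sk, isBase_sub, h, h₁, h₂]
  | _ => simp [sub, sk, *]

theorem sk_so (D : SOSub T) (t : Ty T) : (t.so D).sk = t.sk := by
  induction t with
  | fn t s h₁ h₂ => by_cases h : t.IsBase <;> simp [so, sk, isBase_so, h, h₁, h₂]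
  | _ => simp [so, sk, *]

theorem sk_fn_inj {t s t' s' : Ty T} (h : (Ty.fn t s).sk = (Ty.fn t' s').sk) :
    (t.IsBase ↔ t'.IsBase) ∧ t.sk = t'.sk ∧ s.sk = s'.sk := by
  simp only [sk, fn.injEq] at h
  obtain ⟨h₁, h₂⟩ := h
  have key : ∀ t : Ty T, t.IsBase → ∃ b r, t.sk = .refine b r := by
    rintro t ⟨b, r, rfl⟩
    exact ⟨b, _, rfl⟩
  by_cases ht : t.IsBase <;> by_cases ht' : t'.IsBase
  · simp only [if_pos ht, if_pos ht'] at h₁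
    exact ⟨by simp [ht, ht'], h₁, h₂⟩
  · obtain ⟨b, r, hb⟩ := key t ht
    simp [ht, ht', hb] at h₁
  · obtain ⟨b, r, hb⟩ := key t' ht'
    simp [ht, ht', hb] at h₁
  · simp only [if_neg ht, if_neg ht', sig.injEq, true_and] at h₁
    exact ⟨by simp [ht, ht'], h₁, h₂⟩

end Ty

theorem SSub.trans_aux (k : ℕ) : ∀ (h : ℕ) {n₁ n₂ : ℕ} {Γ : Ctx T} {t₁ t₂ t₃ : Ty T},
    t₂.size = k → n₁ + n₂ = h → Γ.EWS → SSub n₁ Γ t₁ t₂ → SSub n₂ Γ t₂ t₃ →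
    t₁.sk = t₂.sk → t₂.sk = t₃.sk → ∃ n, SSub n Γ t₁ t₃ := by
  induction k using Nat.strong_induction_on with | _ k ihk => ?_
  intro h
  induction h using Nat.strong_induction_on with | _ h ihh => ?_
  intro n₁ n₂ Γ t₁ t₂ t₃ hk hh hΓ d₁ d₂ s₁ s₂
  have hIR : ∀ {m x a c}, n₂ = m + 1 → x ∉ Γ.fv → x ∉ t₂.fv → x ∉ a.fv → x ∉ c.fv →
      (Ctx.corp Γ x a).EWS → SSub m (.corp Γ x a) t₂ (c.opn 0 (.fvar x)) → t₂.sk = c.sk →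
      ∃ n, SSub n Γ t₁ (.ifn a c) := by
    intro m x a c hm hx h₂ ha hc he d s
    obtain ⟨y, hy⟩ := exists_fresh
      (((Γ.fv_finite.union t₁.fv_finite).union a.fv_finite).union c.fv_finite)
    simp only [Set.mem_union, not_or] at hy
    obtain ⟨⟨⟨y₁, y₂⟩, y₃⟩, y₄⟩ := hy
    have hm' := Mor.rename hx ha y₁ he
    obtain ⟨n, hn⟩ := ihh (n₁ + m) (by omega) hk rfl hm'.ews
      (d₁.mor (Mor.weaken y₁ hm'.ews) (.refl idE_refl _) (.refl idE_refl _))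
      (d.mor hm' (.refl_of_not_mem h₂ _) (.opn_id hc trivial)) s₁
      (s.trans (Ty.sk_opn c 0 _).symm)
    exact ⟨_, .funIR y₁ y₂ y₃ y₄ hm'.ews hn⟩
  have hSR : ∀ {m b p c r}, n₂ = m + 1 → HasSort Γ.semS [] r (.base b) → Γ.Ent (p.opn 0 r) →
      SSub m Γ t₂ (c.opn 0 r) → t₂.sk = c.sk → ∃ n, SSub n Γ t₁ (.sig (.refine b p) c) := by
    intro m b p c r hm hr hp d s
    obtain ⟨n, hn⟩ := ihh (n₁ + m) (by omega) hk rfl hΓ d₁ d s₁ (s.trans (Ty.sk_opn c 0 _).symm)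
    exact ⟨_, .sigR hr hp hn⟩
  cases d₁ with
  | funIL hr hp d₁ =>
    obtain ⟨n, hn⟩ := ihh _ (by omega) hk rfl hΓ d₁ d₂ ((Ty.sk_opn _ 0 _).trans s₁) s₂
    exact ⟨_, .funIL hr hp hn⟩
  | @sigL n₁ _ x a c _ hx ha hc h₂ he d₁ =>
    obtain ⟨y, hy⟩ := exists_fresh
      (((Γ.fv_finite.union a.fv_finite).union c.fv_finite).union t₃.fv_finite)
    simp only [Set.mem_union, not_or] at hy
    obtain ⟨⟨⟨y₁, y₂⟩, y₃⟩, y₄⟩ := hy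
    have hm' := Mor.rename hx ha y₁ he
    obtain ⟨n, hn⟩ := ihh (n₁ + n₂) (by omega) hk rfl hm'.ews
      (d₁.mor hm' (.opn_id hc trivial) (.refl_of_not_mem h₂ _))
      (d₂.mor (Mor.weaken y₁ hm'.ews) (.refl idE_refl _) (.refl idE_refl _))
      ((Ty.sk_opn _ 0 _).trans s₁) s₂
    exact ⟨_, .sigL y₁ y₂ y₃ y₄ hm'.ews hn⟩
  | @base _ v b r₁ r₂ hv h₁ h₂ e₁ =>
    cases d₂ with
    | funIR hx a₁ a₂ a₃ he d => exact hIR rfl hx a₁ a₂ a₃ he d s₂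
    | sigR hr hp d => exact hSR rfl hr hp d s₂
    | @base _ w _ _ r₃ hw h₂' h₃ e₂ =>
      obtain ⟨y, hy⟩ := exists_fresh
        (((Γ.fv_finite.union r₁.fv_finite).union r₂.fv_finite).union r₃.fv_finite)
      simp only [Set.mem_union, not_or] at hy
      obtain ⟨⟨⟨y₁, y₂⟩, y₃⟩, y₄⟩ := hy
      have hm := Mor.rename hv (t := .refine b r₁) h₁ y₁ e₁.1
      have hm' := Mor.narrow (.base hv h₁ h₂ e₁) ⟨fun _ => ⟨_, _, rfl⟩, fun _ => ⟨_, _, rfl⟩⟩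
        hw y₁ h₂' y₃ y₂ hm.ews
      exact ⟨0, .base y₁ y₂ y₄
        (hm'.ent e₂ ((Refn.Rel.refl idE_refl r₃).opn_ext idE_lc trivial h₃))⟩
  | @fn n m _ x a₁ c₁ a₂ c₂ hx ha₂ hc₁ hc₂ he d d' =>
    cases d₂ with
    | funIR hx a₁ a₂ a₃ he d => exact hIR rfl hx a₁ a₂ a₃ he d s₂
    | sigR hr hp d => exact hSR rfl hr hp d s₂
    | @fn n' m' _ x' _ _ a₃ c₃ hx' ha₃ hc₂' hc₃ he' e e' =>
      obtain ⟨-, sa₁, sc₁⟩ := Ty.sk_fn_inj s₁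
      obtain ⟨hb, sa₂, sc₂⟩ := Ty.sk_fn_inj s₂
      simp only [Ty.size] at hk
      obtain ⟨y, hy⟩ := exists_fresh ((((Γ.fv_finite.union a₃.fv_finite).union
        a₂.fv_finite).union c₁.fv_finite).union c₃.fv_finite)
      simp only [Set.mem_union, not_or] at hy
      obtain ⟨⟨⟨⟨y₁, y₂⟩, y₃⟩, y₄⟩, y₅⟩ := hy
      obtain ⟨p, hp⟩ := ihk a₂.size (by omega) _ rfl rfl hΓ e d sa₂.symm sa₁.symm
      have hm := Mor.rename hx' ha₃ y₁ he'
      have hm' := Mor.narrow e hb hx y₁ ha₂ y₃ y₂ hm.ews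
      obtain ⟨q, hq⟩ := ihk c₂.size (by omega) _ (Ty.size_opn c₂ 0 (.fvar y)) rfl hm.ews
        (d'.mor hm' (.opn_id hc₁ trivial) (.opn_id hc₂ trivial))
        (e'.mor hm (.opn_id hc₂' trivial) (.opn_id hc₃ trivial))
        (by simp only [Ty.sk_opn, sc₁]) (by simp only [Ty.sk_opn, sc₂])
      exact ⟨_, .fn y₁ y₂ y₄ y₅ hm.ews hp hq⟩
  | @all n _ a u₁ u₂ ha h₁ h₂ d =>
    cases d₂ with
    | funIR hx a₁ a₂ a₃ he d => exact hIR rfl hx a₁ a₂ a₃ he d s₂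
    | sigR hr hp d => exact hSR rfl hr hp d s₂
    | @all n' _ a' _ u₃ ha' h₂' h₃ e =>
      simp only [Ty.size] at hk
      obtain ⟨y, hy⟩ := exists_fresh ((Γ.ftv_finite.union u₁.ftv_finite).union u₃.ftv_finite)
      simp only [Set.mem_union, not_or] at hy
      have hm : ∀ a, Mor idE (.tvar Γ a) (.tvar Γ y) := fun a => (Mor.id hΓ).tvar a y
      have hr := fun u => Ty.Rel.refl (T := T) idE_refl u
      obtain ⟨q, hq⟩ := ihk u₂.size (by omega) _ (Ty.size_opnT u₂ 0 y) rfl (hm y).ews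
        (d.mor (hm a) ((hr u₁).opnT h₁ 0) ((hr u₂).opnT h₂ 0))
        (e.mor (hm a') ((hr u₂).opnT h₂' 0) ((hr u₃).opnT h₃ 0))
        (by simp only [Ty.sk, Ty.all.injEq] at s₁; simp only [Ty.sk_opnT, s₁])
        (by simp only [Ty.sk, Ty.all.injEq] at s₂; simp only [Ty.sk_opnT, s₂])
      exact ⟨_, .all hy.1.1 hy.1.2 hy.2 hq⟩
  | @funIR n _ x _ a c hx h₁ ha hc he d =>
    cases d₂ with
    | funIR hx a₁ a₂ a₃ he d => exact hIR rfl hx a₁ a₂ a₃ he d s₂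
    | sigR hr hp d => exact hSR rfl hr hp d s₂
    | @funIL n' _ b p _ _ r hr hp e =>
      simp only [Ty.size] at hk
      exact ihk c.size (by omega) _ (Ty.size_opn c 0 r) rfl hΓ
        (d.mor (Mor.inst hx ha hr hp) (.refl_of_not_mem h₁ _) (.opn_id hc hr.lc)) e
        (s₁.trans (Ty.sk_opn c 0 r).symm) ((Ty.sk_opn c 0 r).trans s₂)
  | @sigR n _ _ b p c r hr hp d =>
    cases d₂ with
    | funIR hx a₁ a₂ a₃ he d => exact hIR rfl hx a₁ a₂ a₃ he d s₂
    | sigR hr hp d => exact hSR rfl hr hp d s₂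
    | @sigL n' _ x _ _ _ hx ha hc h₃ he e =>
      simp only [Ty.size] at hk
      exact ihk c.size (by omega) _ (Ty.size_opn c 0 r) rfl hΓ d
        (e.mor (Mor.inst hx ha hr hp) (.opn_id hc hr.lc) (.refl_of_not_mem h₃ _))
        (s₁.trans (Ty.sk_opn c 0 r).symm) ((Ty.sk_opn c 0 r).trans s₂)
  | alpha => exact ⟨_, d₂⟩

theorem SSub.trans {n₁ n₂ : ℕ} {Γ : Ctx T} {t₁ t₂ t₃ : Ty T} (hΓ : Γ.EWS)
    (h₁ : SSub n₁ Γ t₁ t₂) (h₂ : SSub n₂ Γ t₂ t₃) (s₁ : t₁.sk = t₂.sk) (s₂ : t₂.sk = t₃.sk) :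
    ∃ n, SSub n Γ t₁ t₃ := SSub.trans_aux _ _ rfl rfl hΓ h₁ h₂ s₁ s₂

end IRT

namespace IRT

variable {T : Theory}

/-! ## Constraints -/

namespace Con

def so (D : SOSub T) : Con T → Con T
  | .ex x b c => .ex x b (c.so D)
  | .all x b p c => .all x b (p.so D) (c.so D)
  | .and c d => .and (c.so D) (d.so D)
  | .prop p => .prop (p.so D)

/-- No binder is in `V` or shadows another binder. -/
def Distinct (V : Set Var) : Con T → Prop
  | .ex x _ c => x ∉ V ∧ c.Distinct ({x} ∪ V)
  | .all x _ _ c => x ∉ V ∧ c.Distinct ({x} ∪ V)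
  | .and c d => c.Distinct V ∧ d.Distinct V
  | .prop _ => True

/-- `c` holds in all valuations in `Φ`, with existential variables that are solved by terms over
the variables sorted by `S`; `σ` lists the solutions of the free existential variables. -/
def Sol (S : Var → Option T.B) (Φ : Set (Env T)) (σ : Var → Term T) : Con T → Prop
  | .ex x b c => ∃ r, HasSort S [] r (.base b) ∧ c.Sol S Φ (Function.update σ x r)
  | .all x b p c =>
      (p.sub (Function.update σ x (.fvar x))).WS (Function.update S x (some b)) [] ∧
      c.Sol (Function.update S x (some b))
        {ρ' | ∃ ρ ∈ Φ, ∃ a, ρ' = Function.update ρ x (some ⟨b, a⟩) ∧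
          (p.sub (Function.update σ x (.fvar x))).Holds ρ'}
        (Function.update σ x (.fvar x))
  | .and c d => c.Sol S Φ σ ∧ d.Sol S Φ σ
  | .prop p => (p.sub σ).WS S [] ∧ ∀ ρ ∈ Φ, (p.sub σ).Holds ρ

theorem Distinct.anti {V W : Set Var} {c : Con T} (h : c.Distinct W) (hV : V ⊆ W) :
    c.Distinct V := by
  induction c generalizing V W with
  | ex x b c ih => exact ⟨fun hx => h.1 (hV hx), ih h.2 (Set.union_subset_union_right _ hV)⟩
  | all x b p c ih => exact ⟨fun hx => h.1 (hV hx), ih h.2 (Set.union_subset_union_right _ hV)⟩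
  | and c d hc hd => exact ⟨hc h.1 hV, hd h.2 hV⟩
  | prop p => trivial

theorem Distinct.subst {V : Set Var} {c : Con T} (h : c.Distinct V) (x : Var) (u : Term T) :
    (c.subst x u).Distinct V := by
  induction c generalizing V with
  | ex y b c ih =>
    by_cases hy : y = x
    · simpa [Con.subst, hy] using (hy ▸ h)
    · simpa [Con.subst, hy] using ⟨h.1, ih h.2⟩
  | all y b p c ih =>
    by_cases hy : y = x
    · simpa [Con.subst, hy] using (hy ▸ h)
    · simpa [Con.subst, hy] using ⟨h.1, ih h.2⟩
  | and c d hc hd => exact ⟨hc h.1, hd h.2⟩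
  | prop p => trivial

theorem Distinct.foSubst {V : Set Var} {c : Con T} (h : c.Distinct V) (x : Var) (u : Term T) :
    (c.foSubst x u).Distinct V := by
  induction c generalizing V with
  | ex y b c ih =>
    by_cases hy : y = x
    · simp only [Con.foSubst, if_pos hy]
      exact (h.2.anti Set.subset_union_right).subst x u
    · simpa [Con.foSubst, hy] using ⟨h.1, ih h.2⟩
  | all y b p c ih => exact ⟨h.1, ih h.2⟩
  | and c d hc hd => exact ⟨hc h.1, hd h.2⟩
  | prop p => trivial

theorem Distinct.soSubst {V : Set Var} {c : Con T} (h : c.Distinct V) (κ : KVar T) (r : Term T) :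
    (c.soSubst κ r).Distinct V := by
  induction c generalizing V with
  | ex y b c ih => exact ⟨h.1, ih h.2⟩
  | all y b p c ih => exact ⟨h.1, ih h.2⟩
  | and c d hc hd => exact ⟨hc h.1, hd h.2⟩
  | prop p => trivial

theorem Distinct.so {V : Set Var} {c : Con T} (h : c.Distinct V) (D : SOSub T) :
    (c.so D).Distinct V := by
  induction c generalizing V with
  | ex y b c ih => exact ⟨h.1, ih h.2⟩
  | all y b p c ih => exact ⟨h.1, ih h.2⟩
  | and c d hc hd => exact ⟨hc h.1, hd h.2⟩
  | prop p => trivial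

theorem InstOK.so {x : Var} {r : Term T} {S : Var → Option T.B} {c : Con T}
    (h : c.InstOK x r S) (D : SOSub T) : (c.so D).InstOK x r S := by
  induction c generalizing S with
  | ex y b c ih =>
    by_cases hy : y = x
    · simpa [Con.so, InstOK, hy] using h
    · simp only [InstOK, if_neg hy] at h
      simpa [Con.so, InstOK, hy] using ih h
  | all y b p c ih => exact ih h
  | and c d hc hd => exact ⟨hc h.1, hd h.2⟩
  | prop p => trivial

theorem so_subst {D : SOSub T} (hD : D.WS) (c : Con T) (x : Var) (u : Term T) :
    (c.subst x u).so D = (c.so D).subst x u := by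
  have hp : ∀ p : Refn T, (p.subst x u).so D = (p.so D).subst x u := fun p => by
    rw [Refn.subst_eq_sub, Refn.subst_eq_sub, Refn.so_sub hD]
  induction c with
  | ex y b c ih => by_cases hy : y = x <;> simp [subst, so, hy, ih]
  | all y b p c ih => by_cases hy : y = x <;> simp [subst, so, hy, ih, hp]
  | and c d hc hd => simp [subst, so, hc, hd]
  | prop p => simp [subst, so, hp]

theorem so_foSubst {D : SOSub T} (hD : D.WS) (c : Con T) (x : Var) (u : Term T) :
    (c.foSubst x u).so D = (c.so D).foSubst x u := by
  induction c with
  | ex y b c ih => by_cases hy : y = x <;> simp [foSubst, so, hy, ih, so_subst hD]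
  | all y b p c ih => simp [foSubst, so, ih]
  | and c d hc hd => simp [foSubst, so, hc, hd]
  | prop p => rfl

theorem so_of_kvars {D : SOSub T} {c : Con T} (h : c.kvars = ∅) : c.so D = c := by
  induction c with
  | ex y b c ih => simp [so, ih h]
  | all y b p c ih =>
    simp only [kvars, Set.union_empty_iff] at h
    simp [so, ih h.2, Refn.so_of_kvars h.1]
  | and c d hc hd =>
    simp only [kvars, Set.union_empty_iff] at h
    simp [so, hc h.1, hd h.2]
  | prop p => simp [so, Refn.so_of_kvars h]

/-! ## Solutions from validity -/

theorem Sol.of_subst {V : Set Var} {c : Con T} {x : Var} {r : Term T} {S : Var → Option T.B}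
    {Φ : Set (Env T)} {σ : Var → Term T} (hc : c.Distinct V) (hx : x ∈ V) (hr : r.fv ⊆ V)
    (h : (c.subst x r).Sol S Φ σ) : c.Sol S Φ (Function.update σ x (r.sub σ)) := by
  have key : ∀ {y : Var} (u : Term T) (σ : Var → Term T), y ∉ r.fv → y ≠ x →
      Function.update (Function.update σ x (r.sub σ)) y u
        = Function.update (Function.update σ y u) x (r.sub (Function.update σ y u)) := by
    intro y u σ hy hyx
    rw [Function.update_comm hyx.symm]
    congr 1
    exact Term.sub_congr fun z hz => by
      rw [Function.update_of_ne]
      rintro rfl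
      exact hy hz
  induction c generalizing V S Φ σ with
  | ex y b c ih =>
    have hyx : y ≠ x := by rintro rfl; exact hc.1 hx
    have hyr : y ∉ r.fv := fun h => hc.1 (hr h)
    simp only [Con.subst, if_neg hyx] at h
    obtain ⟨u, hu, hs⟩ := h
    refine ⟨u, hu, ?_⟩
    rw [key u σ hyr hyx]
    exact ih hc.2 (Or.inr hx) (hr.trans Set.subset_union_right) hs
  | all y b p c ih =>
    have hyx : y ≠ x := by rintro rfl; exact hc.1 hx
    have hyr : y ∉ r.fv := fun h => hc.1 (hr h)
    simp only [Con.subst, if_neg hyx] at h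
    simp only [Sol, key _ σ hyr hyx]
    obtain ⟨h₁, h₂⟩ := h
    simp only [Refn.subst_sub] at h₁ h₂
    exact ⟨h₁, ih hc.2 (Or.inr hx) (hr.trans Set.subset_union_right) h₂⟩
  | and c d hc' hd' => exact ⟨hc' hc.1 hx hr h.1, hd' hc.2 hx hr h.2⟩
  | prop p =>
    simp only [Con.subst, Sol, Refn.subst_sub] at h ⊢
    exact h

theorem Sol.of_foSubst {V : Set Var} {c : Con T} {x : Var} {r : Term T}
    {S S' : Var → Option T.B} {Φ : Set (Env T)} {σ : Var → Term T} (hc : c.Distinct V)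
    (hV : ∀ y b, S y = some b → y ∈ V) (hV' : ∀ y b, S' y = some b → y ∈ V)
    (hσ : ∀ y b, S' y = some b → HasSort S [] (σ y) (.base b))
    (hr : c.InstOK x r S') (h : (c.foSubst x r).Sol S Φ σ) : c.Sol S Φ σ := by
  induction c generalizing V S S' Φ σ with
  | ex y b c ih =>
    by_cases hy : y = x
    · subst hy
      simp only [foSubst, InstOK, if_true] at h hr
      refine ⟨r.sub σ, hr.sub hσ, Sol.of_subst hc.2 (Or.inl rfl) (fun z hz => ?_) h⟩
      obtain ⟨b, hb⟩ := hr.mem_dom hz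
      exact Or.inr (hV' z b hb)
    · simp only [foSubst, InstOK, if_neg hy] at h hr
      obtain ⟨u, hu, hs⟩ := h
      refine ⟨u, hu, ih hc.2 (fun z b hz => Or.inr (hV z b hz)) ?_ ?_ hr hs⟩
      · intro z b' hz
        by_cases hzy : z = y
        · exact Or.inl hzy
        · rw [Function.update_of_ne hzy] at hz
          exact Or.inr (hV' z b' hz)
      · intro z b' hz
        by_cases hzy : z = y
        · subst hzy
          simp only [Function.update_self, Option.some.injEq] at hz ⊢
          exact hz ▸ hu
        · rw [Function.update_of_ne hzy] at hz ⊢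
          exact hσ z b' hz
  | all y b p c ih =>
    refine ⟨h.1, ih (V := {y} ∪ V) hc.2 ?_ ?_ ?_ hr h.2⟩
    · intro z b' hz
      by_cases hzy : z = y
      · exact Or.inl hzy
      · rw [Function.update_of_ne hzy] at hz
        exact Or.inr (hV z b' hz)
    · intro z b' hz
      by_cases hzy : z = y
      · exact Or.inl hzy
      · rw [Function.update_of_ne hzy] at hz
        exact Or.inr (hV' z b' hz)
    · intro z b' hz
      by_cases hzy : z = y
      · subst hzy
        simp only [Function.update_self] at hz ⊢
        exact .fvar (by simpa using hz)
      · rw [Function.update_of_ne hzy] at hz ⊢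
        refine (hσ z b' hz).mono_sort fun w b'' hw => ?_
        rwa [Function.update_of_ne]
        rintro rfl
        exact hc.1 (hV _ _ hw)
  | and c d hc' hd' =>
    exact ⟨hc' hc.1 hV hV' hσ hr.1 h.1, hd' hc.2 hV hV' hσ hr.2 h.2⟩
  | prop p => exact h

theorem Sol.of_holds {c : Con T} {S : Var → Option T.B} {Φ : Set (Env T)} (hc : c.evars = ∅)
    (hS : c.WS S) (h : ∀ ρ ∈ Φ, c.Holds ρ) : c.Sol S Φ .fvar := by
  induction c generalizing S Φ with
  | ex y b c ih =>
    have : y ∈ (Con.ex y b c).evars := Or.inl rfl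
    rw [hc] at this
    exact this.elim
  | all y b p c ih =>
    simp only [Sol, Function.update_eq_self, Refn.sub_fvar]
    refine ⟨hS.1, ih hc hS.2 ?_⟩
    rintro ρ' ⟨ρ, hρ, a, rfl, hp⟩
    exact h ρ hρ a hp
  | and c d hc' hd' =>
    simp only [evars, Set.union_empty_iff] at hc
    exact ⟨hc' hc.1 hS.1 fun ρ hρ => (h ρ hρ).1, hd' hc.2 hS.2 fun ρ hρ => (h ρ hρ).2⟩
  | prop p =>
    simp only [Sol, Refn.sub_fvar]
    exact ⟨hS, h⟩

end Con

open Classical in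
/-- The total substitution that agrees with `Δ` on its domain. -/
noncomputable def SOAssign.total : SOAssign T → SOSub T
  | [] => fun _ => .con .tt
  | (κ, r) :: Δ => fun κ' => if κ' = κ then r else SOAssign.total Δ κ'

theorem SOAssign.total_WS {Δ : SOAssign T} (h : Δ.WS) : Δ.total.WS := by
  induction Δ with
  | nil => exact fun κ => HasSort.con' rfl
  | cons kr Δ ih =>
    obtain ⟨κ, r⟩ := kr
    intro κ'
    by_cases hk : κ' = κ
    · subst hk
      simpa [SOAssign.total] using h κ' r (by simp)
    · simpa [SOAssign.total, hk] using ih (fun κ r hr => h κ r (by simp [hr])) κ'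

theorem Refn.soSubst_so (κ : KVar T) (r : Term T) (Δ : SOAssign T) (p : Refn T) :
    (p.soSubst κ r).so Δ.total = p.so (SOAssign.total ((κ, r) :: Δ)) := by
  induction p with
  | pred => rfl
  | kapp κ' as =>
    by_cases hk : κ' = κ
    · subst hk
      by_cases hl : as.length = κ'.sorts.length <;> simp [soSubst, so, SOAssign.total, hl]
    · simp [soSubst, so, SOAssign.total, hk]
  | and p q hp hq => simp [soSubst, so, hp, hq]

theorem Con.soSubst_so (κ : KVar T) (r : Term T) (Δ : SOAssign T) (c : Con T) :
    (c.soSubst κ r).so Δ.total = c.so (SOAssign.total ((κ, r) :: Δ)) := by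
  induction c <;> simp [soSubst, so, Refn.soSubst_so, *]

theorem Ty.soSubst_so (κ : KVar T) (r : Term T) (Δ : SOAssign T) (t : Ty T) :
    (t.soSubst κ r).so Δ.total = t.so (SOAssign.total ((κ, r) :: Δ)) := by
  induction t <;> simp [soSubst, so, Refn.soSubst_so, *]

theorem Valid.sol {Δ : SOAssign T} {Ψ : FOAssign T} {c : Con T} (h : Valid Δ Ψ c) (hΔ : Δ.WS)
    (hΨ : Ψ.WS c) (hc : c.Distinct ∅) :
    (c.so Δ.total).Sol (fun _ => none) {fun _ => none} .fvar := by
  induction h with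
  | fo _ ih =>
    have hs := ih hΔ hΨ.2 (hc.foSubst _ _)
    rw [Con.so_foSubst (SOAssign.total_WS hΔ)] at hs
    exact hs.of_foSubst (hc.so _) (by simp) (by simp) (by simp) (hΨ.1.so _)
  | @so Δ c κ r _ ih =>
    rw [← Con.soSubst_so]
    exact ih (fun κ r hr => hΔ κ r (by simp [hr])) trivial (hc.soSubst _ _)
  | smt he hk hv =>
    rw [Con.so_of_kvars hk]
    refine .of_holds he hv.1 ?_
    rintro ρ rfl
    exact hv.2

/-! ## Contexts -/

namespace Ctx

def so (D : SOSub T) : Ctx T → Ctx T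
  | .nil => .nil
  | .corp Γ x t => .corp (Γ.so D) x (t.so D)
  | .ghost Γ x t => .ghost (Γ.so D) x (t.so D)
  | .tvar Γ a => .tvar (Γ.so D) a

/-- The binders of `Γ`. -/
def names : Ctx T → Set Var
  | .nil => ∅
  | .corp Γ x _ => {x} ∪ Γ.names
  | .ghost Γ x _ => {x} ∪ Γ.names
  | .tvar Γ _ => Γ.names

theorem names_subset_fv (Γ : Ctx T) : Γ.names ⊆ Γ.fv := by
  induction Γ with
  | nil => exact subset_rfl
  | corp Γ x t ih | ghost Γ x t ih =>
    exact Set.union_subset (fun y hy => Or.inl (Or.inl hy)) (fun y hy => Or.inr (ih hy))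
  | tvar Γ a ih => exact ih

theorem names_so (D : SOSub T) (Γ : Ctx T) : (Γ.so D).names = Γ.names := by
  induction Γ <;> simp [so, names, *]

end Ctx

theorem genImp_so {D : SOSub T} (hD : D.WS) (x : Var) (t : Ty T) (c : Con T) :
    (genImp x t c).so D = genImp x (t.so D) (c.so D) := by
  cases t <;> simp [genImp, Con.so, Ty.so, Refn.so_opn hD]

theorem genEx_so {D : SOSub T} (hD : D.WS) (x : Var) (t : Ty T) (c : Con T) :
    (genEx x t c).so D = genEx x (t.so D) (c.so D) := by
  cases t <;> simp [genEx, Con.so, Ty.so, Refn.so_opn hD]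

theorem Ctx.embed_so {D : SOSub T} (hD : D.WS) (Γ : Ctx T) (c : Con T) :
    (Γ.embed c).so D = (Γ.so D).embed (c.so D) := by
  induction Γ generalizing c with
  | nil => rfl
  | corp Γ x t ih => rw [so, embed_corp, embed_corp, ih, genImp_so hD]
  | ghost Γ x t ih => rw [so, embed_ghost, embed_ghost, ih, genImp_so hD]
  | tvar Γ a ih => exact ih c

theorem Con.Sol.genImp {x : Var} {t : Ty T} {c : Con T} {S : Var → Option T.B}
    {Φ : Set (Env T)} {σ : Var → Term T} (hlc : ∀ y, (σ y).LC) (hx : σ x = .fvar x)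
    (h : (IRT.genImp x t c).Sol S Φ σ) : (t.sub σ).ExtOK x S ∧
      c.Sol ((t.sub σ).extS x S) ((t.sub σ).extSat x Φ) σ := by
  cases t with
  | refine b r =>
    have hσ : Function.update σ x (.fvar x) = σ := by rw [← hx, Function.update_eq_self]
    simp only [IRT.genImp, Con.Sol, hσ, Refn.sub_opn hlc, Term.sub, hx] at h
    exact h
  | _ => exact ⟨trivial, h⟩

theorem Con.Sol.embed {Γ : Ctx T} {c : Con T}
    (h : (Γ.embed c).Sol (fun _ => none) {fun _ => none} .fvar) :
    Γ.EWS ∧ c.Sol Γ.semS Γ.sat .fvar := by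
  induction Γ generalizing c with
  | nil => exact ⟨trivial, h⟩
  | corp Γ x t ih =>
    rw [Ctx.embed_corp] at h
    obtain ⟨h₁, h₂⟩ := ih h
    have := h₂.genImp (σ := .fvar) (fun _ => trivial) rfl
    rw [Ty.sub_fvar] at this
    exact ⟨⟨h₁, this.1⟩, this.2⟩
  | ghost Γ x t ih =>
    rw [Ctx.embed_ghost] at h
    obtain ⟨h₁, h₂⟩ := ih h
    have := h₂.genImp (σ := .fvar) (fun _ => trivial) rfl
    rw [Ty.sub_fvar] at this
    exact ⟨⟨h₁, this.1⟩, this.2⟩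
  | tvar Γ a ih => exact ih h

/-! ## Binders of the generated constraints -/

theorem genImp_distinct {V W : Set Var} {x : Var} {t : Ty T} {c : Con T} (hx : x ∉ V)
    (hW : {x} ∪ V ⊆ W) (h : c.Distinct W) : (genImp x t c).Distinct V := by
  cases t with
  | refine b r => exact ⟨hx, h.anti hW⟩
  | _ => exact h.anti (Set.subset_union_right.trans hW)

theorem genEx_distinct {V W : Set Var} {x : Var} {t : Ty T} {c : Con T} (hx : x ∉ V)
    (hW : {x} ∪ V ⊆ W) (h : c.Distinct W) : (genEx x t c).Distinct V := by
  cases t with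
  | refine b r => exact ⟨hx, trivial, h.anti hW⟩
  | _ => exact h.anti (Set.subset_union_right.trans hW)

theorem Ctx.cons_subset (Γ : Ctx T) (x : Var) (t : Ty T) :
    {x} ∪ Γ.fv ⊆ {x} ∪ t.fv ∪ Γ.fv :=
  Set.union_subset_union_left _ Set.subset_union_left

theorem ASub.distinct {Γ : Ctx T} {t u : Ty T} {c : Con T} (h : ASub Γ t u c) :
    c.Distinct Γ.fv := by
  induction h with
  | base hx => exact ⟨hx, trivial⟩
  | all _ _ _ _ ih => exact ih
  | alpha => trivial
  | funIL hx _ _ _ ih => exact genEx_distinct hx (Ctx.cons_subset _ _ _) ih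
  | funIR hx _ _ _ ih => exact genImp_distinct hx (Ctx.cons_subset _ _ _) ih
  | sigL hx _ _ _ ih => exact genImp_distinct hx (Ctx.cons_subset _ _ _) ih
  | sigR hx _ _ _ ih => exact genEx_distinct hx (Ctx.cons_subset _ _ _) ih
  | _ hx _ _ _ _ ih₁ ih₂ => exact ⟨ih₁, genImp_distinct hx (Ctx.cons_subset _ _ _) ih₂⟩

variable {P : Type} {tc : P → Ty T}

theorem Ctx.distinct_unpack {Γ : Ctx T} {x y : Var} {t₁ t₂ : Ty T} {c : Con T} (hx : x ∉ Γ.fv)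
    (hy : y ∉ Γ.fv) (hxy : x ≠ y)
    (h : c.Distinct (Ctx.corp (.ghost Γ x t₁) y t₂).fv) :
    (genImp x t₁ (genImp y t₂ c)).Distinct Γ.fv := by
  refine genImp_distinct (W := {x} ∪ Γ.fv) hx subset_rfl (genImp_distinct (W := _) ?_ ?_ h)
  · rintro (h | h)
    · exact hxy h.symm
    · exact hy h
  · refine Set.Subset.trans ?_ (Ctx.cons_subset _ y t₂)
    exact Set.union_subset_union_right _ (Ctx.cons_subset _ x t₁)

mutual

theorem Check.distinct {Γ : Ctx T} {e : Expr T P} {t : Ty T} {c : Con T} :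
    Check tc Γ e t c → c.Distinct Γ.fv
  | .sub h₁ h₂ => ⟨h₁.distinct, h₂.distinct⟩
  | .letBase hx _ _ _ _ h₁ h₂ _ =>
    ⟨h₁.distinct, genImp_distinct hx (Ctx.cons_subset _ _ _) h₂.distinct⟩
  | .letReft hx _ _ _ _ _ h₁ h₂ =>
    genImp_distinct hx (Ctx.cons_subset _ _ _) ⟨h₁.distinct, h₂.distinct⟩
  | .app h₁ h₂ => ⟨h₁.distinct, h₂.distinct⟩
  | .tabs _ _ _ h => h.distinct
  | .unpack hx hy hxy _ _ _ _ _ _ h₁ h₂ =>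
    ⟨h₁.distinct, Ctx.distinct_unpack hx hy hxy h₂.distinct⟩

theorem Synth.distinct {Γ : Ctx T} {e : Expr T P} {t : Ty T} {c : Con T} :
    Synth tc Γ e t c → c.Distinct Γ.fv
  | .tabs _ _ _ h => h.distinct
  | .tapp _ h _ => h.distinct
  | .con => trivial
  | .prim => trivial
  | .base _ => trivial
  | .var _ => trivial
  | .absBase hx _ _ _ _ h _ => genImp_distinct hx (Ctx.cons_subset _ _ _) h.distinct
  | .absReft hx _ _ _ _ h => genImp_distinct hx (Ctx.cons_subset _ _ _) h.distinct
  | .app h₁ h₂ => ⟨h₁.distinct, h₂.distinct⟩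
  | .absI hx _ _ _ _ _ h => genImp_distinct hx (Ctx.cons_subset _ _ _) h.distinct
  | .unpack hx hy hxy _ _ _ _ _ _ h₁ h₂ h₃ _ =>
    ⟨h₁.distinct, Ctx.distinct_unpack hx hy hxy ⟨h₂.distinct, h₃.distinct⟩⟩
  | .letBase hx _ _ _ _ h₁ h₂ h₃ _ _ =>
    ⟨h₁.distinct, genImp_distinct hx (Ctx.cons_subset _ _ _) ⟨h₂.distinct, h₃.distinct⟩⟩
  | .letReft hx _ _ _ _ _ h₁ h₂ h₃ _ =>
    genImp_distinct hx (Ctx.cons_subset _ _ _) ⟨h₁.distinct, h₂.distinct, h₃.distinct⟩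

theorem SpineCheck.distinct {Γ : Ctx T} {t : Ty T} {e : Expr T P} {t' : Ty T} {c : Con T} :
    SpineCheck tc Γ t e t' c → c.Distinct Γ.fv
  | .funVar h₁ h₂ => ⟨h₁.distinct, h₂.distinct⟩
  | .ifun hx _ _ _ h => genEx_distinct hx (Ctx.cons_subset _ _ _) h.distinct
  | .fun hx _ _ _ _ h₁ h₂ h₃ =>
    ⟨h₁.distinct, h₂.distinct, genImp_distinct hx (Ctx.cons_subset _ _ _) h₃.distinct⟩

theorem SpineSynth.distinct {Γ : Ctx T} {t : Ty T} {e : Expr T P} {t' : Ty T} {c : Con T} :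
    SpineSynth tc Γ t e t' c → c.Distinct Γ.fv
  | .funVar h => h.distinct
  | .fun hx _ _ _ _ h₁ h₂ h₃ _ =>
    ⟨h₁.distinct, h₂.distinct, genImp_distinct hx (Ctx.cons_subset _ _ _) h₃.distinct⟩
  | .ifun hx _ _ _ h₁ h₂ _ =>
    genEx_distinct hx (Ctx.cons_subset _ _ _) ⟨h₁.distinct, h₂.distinct⟩

end

end IRT

namespace IRT

variable {T : Theory}

/-! ## Templates -/

namespace Ty

/-- The type with trivial refinements. -/
def shp : Ty T → Ty T
  | .refine b _ => .refine b .tt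
  | .fn t s => .fn t.shp s.shp
  | .ifn t s => .ifn t.shp s.shp
  | .sig t s => .sig t.shp s.shp
  | .bvar i => .bvar i
  | .fvar a => .fvar a
  | .all t => .all t.shp

theorem shp_opn (t : Ty T) (k : ℕ) (u : Term T) : (t.opn k u).shp = t.shp := by
  induction t generalizing k <;> simp [opn, shp, *]

theorem shp_opnT (t : Ty T) (k : ℕ) (a : TVar) :
    (t.opnT k (.fvar a)).shp = t.shp.opnT k (.fvar a) := by
  induction t generalizing k with
  | bvar i => by_cases h : i = k <;> simp [opnT, shp, h]
  | _ => simp [opnT, shp, *]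

theorem ftv_shp (t : Ty T) : t.shp.ftv = t.ftv := by
  induction t <;> simp [shp, ftv, *]

theorem isBase_shp {t : Ty T} : t.shp.IsBase ↔ t.IsBase := by
  constructor <;> rintro ⟨b, r, h⟩
  · cases t <;> simp [shp] at h
    exact ⟨_, _, rfl⟩
  · subst h
    exact ⟨_, _, rfl⟩

theorem forget_shp (t : Ty T) : t.shp.forget = t.forget := by
  induction t <;> simp [shp, forget, *]

theorem sk_shp (t : Ty T) : t.shp.sk = t.sk := by
  induction t with
  | fn t s h₁ h₂ => by_cases h : t.IsBase <;> simp [shp, sk, isBase_shp, h, h₁, h₂]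
  | _ => simp [shp, sk, *]

theorem opnT_inj {t t' : Ty T} {k : ℕ} {a : TVar} (ha : a ∉ t.ftv) (ha' : a ∉ t'.ftv)
    (h : t.opnT k (.fvar a) = t'.opnT k (.fvar a)) : t = t' := by
  induction t generalizing t' k with
  | refine b r =>
    cases t' with
    | bvar i => by_cases hi : i = k <;> simp [opnT, hi] at h
    | _ => simp [opnT] at h <;> simp [h]
  | fn t s h₁ h₂ | ifn t s h₁ h₂ | sig t s h₁ h₂ =>
    simp only [ftv, Set.mem_union, not_or] at ha
    cases t' with
    | bvar i => by_cases hi : i = k <;> simp [opnT, hi] at h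
    | fn t' s' | ifn t' s' | sig t' s' =>
      simp only [ftv, Set.mem_union, not_or] at ha'
      simp [opnT] at h <;> simp [h₁ ha.1 ha'.1 h.1, h₂ ha.2 ha'.2 h.2]
    | _ => simp [opnT] at h
  | bvar i =>
    cases t' with
    | bvar j => by_cases hi : i = k <;> by_cases hj : j = k <;> simp_all [opnT]
    | fvar c =>
      by_cases hi : i = k <;> simp [opnT, hi] at h
      exact (ha' h).elim
    | _ => by_cases hi : i = k <;> simp [opnT, hi] at h
  | fvar c =>
    cases t' with
    | bvar j =>
      by_cases hj : j = k <;> simp [opnT, hj] at h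
      exact (ha h.symm).elim
    | _ => simp [opnT] at h <;> simp [h]
  | all t ih =>
    cases t' with
    | bvar i => by_cases hi : i = k <;> simp [opnT, hi] at h
    | all t' => simp only [opnT, all.injEq] at h ⊢; exact ih ha ha' h
    | _ => simp [opnT] at h

theorem WfB.shp {S S' : Var → Option T.B} {A : Set TVar} {L L' : List (Option T.B)} {n : ℕ}
    {t : Ty T} (h : t.WfB S A L n) : t.shp.WfB S' A L' n := by
  induction t generalizing L L' n with
  | refine b r => exact HasSort.con' rfl
  | fn _ _ h₁ h₂ => exact ⟨h₁ h.1, h₂ h.2⟩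
  | ifn _ _ h₁ h₂ | sig _ _ h₁ h₂ => exact ⟨isBase_shp.2 h.1, h₁ h.2.1, h₂ h.2.2⟩
  | bvar | fvar => exact h
  | all _ ih => exact ih h

theorem shp_shp (t : Ty T) : t.shp.shp = t.shp := by
  induction t <;> simp [shp, *]

theorem shp_so (D : SOSub T) (t : Ty T) : (t.so D).shp = t.shp := by
  induction t <;> simp [so, shp, *]

end Ty

theorem STy.forget_toTy (τ : STy T) : τ.toTy.forget = τ := by
  induction τ <;> simp [toTy, Ty.forget, *]

theorem Fresh.shp {Γ : Ctx T} {t t' : Ty T} (h : Fresh Γ t t') : t.shp = t'.shp := by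
  induction h with
  | base => rfl
  | all _ h₁ h₂ _ ih =>
    simp only [Ty.shp_opnT] at ih
    simp only [Ty.shp, Ty.all.injEq]
    exact Ty.opnT_inj (by rwa [Ty.ftv_shp]) (by rwa [Ty.ftv_shp]) ih
  | var => rfl
  | fn _ _ _ _ _ _ h₁ h₂ | ifn _ _ _ _ _ _ h₁ h₂ | sig _ _ _ _ _ _ h₁ h₂ =>
    simp only [Ty.shp_opn] at h₂
    simp [Ty.shp, h₁, h₂]

theorem Fresh.sk {Γ : Ctx T} {t t' : Ty T} (h : Fresh Γ t t') : t.sk = t'.sk := by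
  rw [← t.sk_shp, h.shp, t'.sk_shp]

theorem Fresh.forget {Γ : Ctx T} {t t' : Ty T} (h : Fresh Γ t t') : t.forget = t'.forget := by
  rw [← t.forget_shp, h.shp, t'.forget_shp]

theorem Fresh.wfB {D : SOSub T} (hD : D.WS) {Γ : Ctx T} {t t' : Ty T} (h : Fresh Γ t t')
    {S : Var → Option T.B} {A : Set TVar} {L : List (Option T.B)}
    (ht : t.shp.WfB S A L 0) : (t'.so D).WfB Γ.sort A [] 0 := by
  induction h generalizing A L with
  | @base Γ b r κ _ _ hs =>
    have hl : (Γ.vars.map Term.fvar ++ [Term.bvar 0] : List (Term T)).length = κ.sorts.length := by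
      simp [hs]
    simp only [Ty.so, Refn.so, if_pos hl]
    refine HasSort.inst (hD κ) fun i b' hi => ?_
    rw [hs] at hi
    by_cases hi' : i < Γ.vars.length
    · rw [List.getElem?_append_left (by simpa using hi')] at hi ⊢
      simp only [List.getElem?_map, List.getElem?_eq_getElem hi', Option.map_some,
        Option.some.injEq] at hi ⊢
      exact ⟨_, rfl, .fvar hi⟩
    · rw [List.getElem?_append_right (by simpa using hi')] at hi ⊢
      obtain ⟨j, hj⟩ : ∃ j, i = Γ.vars.length + j := ⟨i - Γ.vars.length, by omega⟩
      subst hj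
      simp only [List.length_map, Nat.add_sub_cancel_left] at hi ⊢
      cases j with
      | zero => exact ⟨_, rfl, .bvar hi⟩
      | succ j => simp at hi
  | @all Γ a t t' _ h₁ h₂ _ ih =>
    have h : (t.opnT 0 (.fvar a)).shp.WfB S ({a} ∪ A) [] 0 := by
      rw [Ty.shp_opnT]
      have ht' : t.shp.WfB S A [] 1 := by
        rw [← t.shp_shp]
        exact Ty.WfB.shp (t := t.shp) (n := 1) ht
      exact ht'.opnT_var
    have := ih h
    rw [Ty.so_opnT] at this
    exact Ty.WfB.closeT (by rwa [Ty.ftv_so]) this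
  | var => exact ht
  | @fn Γ x t₁ t₂ t₁' t₂' _ _ _ hx _ _ h₁ h₂ =>
    refine ⟨h₁ ht.1, Ty.WfB.close_zero (x := x) (fun h => hx (t₂'.fv_so_subset hD h)) ?_⟩
    rw [← Ty.so_opn hD, Ty.forget_so]
    exact h₂ (by rw [Ty.shp_opn]; exact ht.2)
  | @ifn Γ x t₁ t₂ t₁' t₂' _ _ _ hx hf _ h₁ h₂ | @sig Γ x t₁ t₂ t₁' t₂' _ _ _ hx hf _ h₁ h₂ =>
    refine ⟨?_, h₁ ht.2.1, Ty.WfB.close_zero (x := x) (fun h => hx (t₂'.fv_so_subset hD h)) ?_⟩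
    · rw [Ty.isBase_so, ← Ty.isBase_shp, ← hf.shp]
      exact ht.1
    · rw [← Ty.so_opn hD, Ty.forget_so]
      exact h₂ (by rw [Ty.shp_opn]; exact ht.2.2)

/-! ## Well-formedness of synthesized types -/

namespace Ctx

/-- `t` is well-formed in `Γ` once `D` is applied. -/
def TyOK (D : SOSub T) (Γ : Ctx T) (t : Ty T) : Prop := (t.so D).WfB Γ.sort Γ.tdom [] 0

/-- `Γ` is well-formed once `D` is applied. -/
def OK (D : SOSub T) : Ctx T → Prop
  | .nil => True
  | .corp Γ x t => Γ.OK D ∧ x ∉ Γ.names ∧ Γ.TyOK D t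
  | .ghost Γ x t => Γ.OK D ∧ x ∉ Γ.names ∧ Γ.TyOK D t
  | .tvar Γ _ => Γ.OK D

theorem sort_eq_none' {Γ : Ctx T} {x : Var} (hx : x ∉ Γ.names) : Γ.sort x = none := by
  induction Γ with
  | nil => rfl
  | corp Γ y t h | ghost Γ y t h =>
    simp only [Ctx.names, Set.mem_union, Set.mem_singleton_iff, not_or] at hx
    simp [Ctx.sort, hx.1, h hx.2]
  | tvar Γ a h => exact h hx

theorem sort_le {Γ : Ctx T} {x : Var} (hx : x ∉ Γ.names) (l : Option T.B) (y : Var) (b : T.B)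
    (h : Γ.sort y = some b) : Function.update Γ.sort x l y = some b := by
  rwa [Function.update_of_ne]
  rintro rfl
  simp [sort_eq_none' hx] at h

namespace TyOK

variable {D : SOSub T} {Γ : Ctx T} {t u tx : Ty T} {x : Var}

theorem weaken (h : Γ.TyOK D t) (hx : x ∉ Γ.names) (u : Ty T) : (Ctx.corp Γ x u).TyOK D t :=
  h.mono_ctx (sort_le hx _) subset_rfl

theorem body (hD : D.WS) (h : (t.so D).WfB Γ.sort Γ.tdom [tx.forget.base?] 0) (hx : x ∉ Γ.names)
    (hu : u.forget.base? = tx.forget.base?) :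
    (Ctx.corp Γ x u).TyOK D (t.opn 0 (.fvar x)) := by
  simp only [TyOK, Ctx.sort, Ctx.tdom, Ty.so_opn hD, hu]
  exact h.opn_var (sort_eq_none' hx)

theorem fn_body (hD : D.WS) (h : Γ.TyOK D (.fn tx t)) (hx : x ∉ Γ.names)
    (hu : u.forget.base? = tx.forget.base?) : (Ctx.corp Γ x u).TyOK D (t.opn 0 (.fvar x)) :=
  body hD (tx := tx) (by simpa only [Ty.forget_so] using h.2) hx hu

theorem ifn_body (hD : D.WS) (h : Γ.TyOK D (.ifn tx t)) (hx : x ∉ Γ.names) :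
    (Ctx.corp Γ x tx).TyOK D (t.opn 0 (.fvar x)) :=
  body hD (tx := tx) (by simpa only [Ty.forget_so] using h.2.2) hx rfl

theorem sig_body (hD : D.WS) (h : Γ.TyOK D (.sig tx t)) (hx : x ∉ Γ.names) :
    (Ctx.corp Γ x tx).TyOK D (t.opn 0 (.fvar x)) :=
  body hD (tx := tx) (by simpa only [Ty.forget_so] using h.2.2) hx rfl

theorem of_body (hD : D.WS) (hx : x ∉ t.fv) (h : (Ctx.corp Γ x tx).TyOK D (t.opn 0 (.fvar x))) :
    (t.so D).WfB Γ.sort Γ.tdom [(tx.so D).forget.base?] 0 := by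
  simp only [TyOK, Ty.so_opn hD, Ctx.sort, Ctx.tdom] at h
  rw [Ty.forget_so]
  exact Ty.WfB.close_zero (fun h => hx (t.fv_so_subset hD h)) h

theorem all_body {a : TVar} (h : Γ.TyOK D (.all t)) :
    (Ctx.tvar Γ a).TyOK D (t.opnT 0 (.fvar a)) := by
  simp only [TyOK, Ty.so_opnT]
  exact Ty.WfB.opnT_var (t := t.so D) h

theorem of_all_body {a : TVar} (ha : a ∉ t.ftv)
    (h : (Ctx.tvar Γ a).TyOK D (t.opnT 0 (.fvar a))) : Γ.TyOK D (.all t) := by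
  simp only [TyOK, Ty.so_opnT] at h
  exact Ty.WfB.closeT (by rwa [Ty.ftv_so]) h

theorem of_wfB (h : t.WfB Γ.sort Γ.tdom [] 0) : Γ.TyOK D t := by
  unfold TyOK
  rwa [Ty.so_of_kvars h.kvars]

theorem fresh (hD : D.WS) (h : Γ.TyOK D t) {Γ' : Ctx T} (hf : Fresh Γ' t u)
    (hA : Γ.tdom = Γ'.tdom) : Γ'.TyOK D u := by
  have h' : t.shp.WfB Γ.sort Γ'.tdom [] 0 := by
    rw [← Ty.shp_so D, ← hA]
    exact Ty.WfB.shp h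
  exact hf.wfB hD h'

end TyOK

theorem Mem.mem_names {Γ : Ctx T} {x : Var} {t : Ty T} (h : Γ.Mem x t) : x ∈ Γ.names := by
  induction h with
  | here => exact Or.inl rfl
  | corp _ ih | ghost _ ih => exact Or.inr ih
  | tvar _ ih => exact ih

theorem Mem.ok {D : SOSub T} {Γ : Ctx T} {x : Var} {t : Ty T} (h : Γ.Mem x t) (hΓ : Γ.OK D) :
    Γ.TyOK D t ∧ Γ.sort x = t.forget.base? := by
  induction h with
  | here => exact ⟨hΓ.2.2.weaken hΓ.2.1 _, by simp [Ctx.sort]⟩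
  | @corp Γ y u h ih | @ghost Γ y u h ih =>
    have : x ≠ y := by
      rintro rfl
      exact hΓ.2.1 h.mem_names
    obtain ⟨h₁, h₂⟩ := ih hΓ.1
    exact ⟨h₁.weaken hΓ.2.1 _, by simpa [Ctx.sort, this] using h₂⟩
  | @tvar Γ a h ih =>
    obtain ⟨h₁, h₂⟩ := ih hΓ
    exact ⟨h₁.mono_ctx (fun _ _ h => h) Set.subset_union_right, h₂⟩

theorem not_mem_names {Γ : Ctx T} {x : Var} (h : x ∉ Γ.fv) : x ∉ Γ.names :=
  fun hx => h (Γ.names_subset_fv hx)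

end Ctx

theorem ASub.base? {Γ : Ctx T} {t u : Ty T} {c : Con T} (h : ASub Γ t u c) :
    t.forget.base? = u.forget.base? := by
  induction h with
  | funIL _ _ _ _ ih => rwa [Ty.forget_opn] at ih
  | funIR _ _ _ _ ih => rwa [Ty.forget_opn] at ih
  | sigL _ _ _ _ ih => rwa [Ty.forget_opn] at ih
  | sigR _ _ _ _ ih => rwa [Ty.forget_opn] at ih
  | _ => rfl

variable {P : Type} {tc : P → Ty T}

theorem Check.fvar_inv {Γ : Ctx T} {y : Var} {t : Ty T} {c : Con T}
    (h : Check tc Γ (.fvar y) t c) :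
    ∃ ty u c', Γ.Mem y ty ∧ (u = ty ∨ ∃ b r, ty = .refine b r ∧ u = selfTy b r y) ∧
      ASub Γ u t c' ∧ c = .and .tt c' := by
  cases h with
  | sub hs ha =>
    cases hs with
    | base hm => exact ⟨_, _, _, hm, Or.inr ⟨_, _, rfl, rfl⟩, ha, rfl⟩
    | var hm => exact ⟨_, _, _, hm, Or.inl rfl, ha, rfl⟩

theorem Check.fvar_sort {D : SOSub T} {Γ : Ctx T} (hΓ : Γ.OK D) {y : Var} {t : Ty T} {c : Con T}
    (h : Check tc Γ (.fvar y) t c) : Γ.sort y = t.forget.base? := by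
  obtain ⟨ty, u, c', hm, hu, ha, -⟩ := h.fvar_inv
  rw [(hm.ok hΓ).2, ← ha.base?]
  obtain rfl | ⟨b, r, rfl, rfl⟩ := hu <;> rfl

theorem Const.ty_ok (D : SOSub T) (Γ : Ctx T) (c : Const T) : Γ.TyOK D c.ty :=
  .of_wfB (FSort.exactTy_wfB .con)

theorem Ctx.TyOK.opn_fvar {D : SOSub T} (hD : D.WS) {Γ : Ctx T} {tx t : Ty T} {y : Var}
    (h : Γ.TyOK D (.fn tx t)) (hy : Γ.sort y = tx.forget.base?) :
    Γ.TyOK D (t.opn 0 (.fvar y)) := by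
  simp only [Ctx.TyOK, Ty.so_opn hD]
  refine Ty.WfB.opn_zero h.2 fun b hb => .fvar ?_
  rw [hy, ← hb, Ty.forget_so]

theorem Ctx.TyOK.shp_opn {D : SOSub T} {Γ : Ctx T} {tx t : Ty T} (h : Γ.TyOK D (.fn tx t))
    (y : Var) (S : Var → Option T.B) : (t.opn 0 (.fvar y)).shp.WfB S Γ.tdom [] 0 := by
  rw [Ty.shp_opn, ← Ty.shp_so D]
  exact Ty.WfB.shp h.2

mutual

theorem Synth.ok {D : SOSub T} (hD : D.WS) (htc : ∀ p, Wf .nil (tc p)) {Γ : Ctx T}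
    {e : Expr T P} {t : Ty T} {c : Con T} (hΓ : Γ.OK D) : Synth tc Γ e t c → Γ.TyOK D t
  | .tabs _ _ ha h => .of_all_body ha (Synth.ok hD htc (Γ := .tvar _ _) hΓ h)
  | .tapp hτ h hf => by
    have hs := (Ctx.TyOK.of_wfB hτ.wfB).fresh hD hf rfl
    simp only [Ctx.TyOK, Ty.so_opnT]
    exact Ty.WfB.opnT (Synth.ok hD htc hΓ h) hs
  | .con => Const.ty_ok D Γ _
  | .prim => .of_wfB ((htc _).wfB.mono_ctx (by simp [Ctx.sort]) (by simp [Ctx.tdom]))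
  | .base hm => by
    obtain ⟨h₁, h₂⟩ := hm.ok hΓ
    exact ⟨h₁, HasSort.eq (.bvar rfl) (.fvar h₂)⟩
  | .var hm => (hm.ok hΓ).1
  | .absBase hx _ _ ht hτ h hf => by
    have hs := (Ctx.TyOK.of_wfB hτ.wfB).fresh hD hf rfl
    exact ⟨hs, Ctx.TyOK.of_body hD ht
      (Synth.ok hD htc (Γ := .corp _ _ _) ⟨hΓ, Ctx.not_mem_names hx, hs⟩ h)⟩
  | .absReft hx _ _ ht hw h => by
    have hs := Ctx.TyOK.of_wfB (D := D) hw.wfB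
    exact ⟨hs, Ctx.TyOK.of_body hD ht
      (Synth.ok hD htc (Γ := .corp _ _ _) ⟨hΓ, Ctx.not_mem_names hx, hs⟩ h)⟩
  | .app h₁ h₂ => SpineSynth.ok hD htc hΓ (Synth.ok hD htc hΓ h₁) h₂
  | .absI hx _ _ ht hw hb h => by
    have hs := Ctx.TyOK.of_wfB (D := D) hw.wfB
    exact ⟨Ty.isBase_so.2 hb, hs, Ctx.TyOK.of_body hD ht
      (Synth.ok hD htc (Γ := .ghost _ _ _) ⟨hΓ, Ctx.not_mem_names hx, hs⟩ h)⟩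
  | @Synth.unpack _ _ _ Γ x y _ _ t₁ t₂ _ _ _ _ _ hx hy hxy _ _ _ _ _ _ h₁ h₂ _ hf => by
    have h := Synth.ok hD htc hΓ h₁
    have hb := h.sig_body hD (Ctx.not_mem_names hx)
    refine (Synth.ok hD htc (Γ := .corp (.ghost Γ x t₁) y _)
      ⟨⟨hΓ, Ctx.not_mem_names hx, h.2.1⟩, ?_, hb⟩ h₂).fresh hD hf rfl
    rintro (h | h)
    · exact hxy h.symm
    · exact Ctx.not_mem_names hy h
  | .letBase hx _ _ _ hτ _ h₂ _ hf hf' => by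
    have hs := (Ctx.TyOK.of_wfB hτ.wfB).fresh hD hf rfl
    exact (Synth.ok hD htc (Γ := .corp _ _ _) ⟨hΓ, Ctx.not_mem_names hx, hs⟩ h₂).fresh hD hf' rfl
  | .letReft hx _ _ _ _ hw _ h₂ _ hf => by
    have hs := Ctx.TyOK.of_wfB (D := D) hw.wfB
    exact (Synth.ok hD htc (Γ := .corp _ _ _) ⟨hΓ, Ctx.not_mem_names hx, hs⟩ h₂).fresh hD hf rfl

theorem SpineSynth.ok {D : SOSub T} (hD : D.WS) (htc : ∀ p, Wf .nil (tc p)) {Γ : Ctx T}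
    {t : Ty T} {e : Expr T P} {t' : Ty T} {c : Con T} (hΓ : Γ.OK D) (ht : Γ.TyOK D t) :
    SpineSynth tc Γ t e t' c → Γ.TyOK D t'
  | .funVar h => ht.opn_fvar hD (h.fvar_sort hΓ)
  | .fun _ _ _ _ _ _ _ _ hf => hf.wfB hD (ht.shp_opn _ Γ.sort)
  | .ifun hx _ _ _ h _ hf =>
    (SpineSynth.ok hD htc (Γ := .ghost _ _ _) ⟨hΓ, Ctx.not_mem_names hx, ht.2.1⟩
      (ht.ifn_body hD (Ctx.not_mem_names hx)) h).fresh hD hf rfl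

end

end IRT

namespace IRT

variable {T : Theory}

/-! ## Instances of contexts -/

/-- `Γ'` is an instance of `Γ`: the existential variables of `Γ` are replaced by the solutions `σ`,
the predicate variables by `D`. -/
structure Ctx.Inst (Γ : Ctx T) (σ : Var → Term T) (Γ' : Ctx T) : Prop where
  lc : ∀ x, (σ x).LC
  fresh : ∀ x ∉ Γ.fv, σ x = .fvar x
  range : ∀ x, σ x = .fvar x ∨ (σ x).fv ⊆ Γ.fv
  fv : Γ'.fv ⊆ Γ.fv
  ftv : Γ'.ftv ⊆ Γ.ftv
  tdom : Γ.tdom ⊆ Γ'.tdom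
  sort : ∀ x b, Γ.sort x = some b → HasSort Γ'.sort [] (σ x) (.base b)
  nodup : Γ'.Nodup
  ews : Γ'.EWS

theorem Con.Sol.genEx {x : Var} {b : T.B} {p : Refn T} {c : Con T} {S : Var → Option T.B}
    {Φ : Set (Env T)} {σ : Var → Term T} (hlc : ∀ y, (σ y).LC) (hx : x ∉ p.fv)
    (h : (IRT.genEx x (.refine b p) c).Sol S Φ σ) :
    ∃ r, HasSort S [] r (.base b) ∧ ((p.sub σ).opn 0 r).WS S [] ∧
      (∀ ρ ∈ Φ, ((p.sub σ).opn 0 r).Holds ρ) ∧ c.Sol S Φ (Function.update σ x r) := by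
  obtain ⟨r, hr, h₁, h₂⟩ := h
  have hlc' : ∀ y, (Function.update σ x r y).LC := fun y => by
    by_cases hy : y = x
    · subst hy
      simpa using hr.lc
    · simpa [hy] using hlc y
  have key : (p.opn 0 (.fvar x)).sub (Function.update σ x r) = (p.sub σ).opn 0 r := by
    rw [Refn.sub_opn hlc']
    congr 1
    · simp [Term.sub]
    · exact Refn.sub_congr fun y hy =>
        Function.update_of_ne (by rintro rfl; exact hx hy) _ _
  simp only [Con.Sol, key] at h₁
  exact ⟨r, hr, h₁.1, h₁.2, h₂⟩

namespace Ctx.Inst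

variable {D : SOSub T} {Γ Γ' : Ctx T} {σ : Var → Term T} {x : Var} {t u : Ty T} {c : Con T}

theorem not_mem (h : Γ.Inst σ Γ') (hx : x ∉ Γ.fv) (ht : x ∉ t.fv) : x ∉ (t.sub σ).fv := by
  rw [Ty.mem_fv_sub]
  rintro ⟨y, hy, hxy⟩
  obtain he | he := h.range y
  · rw [he] at hxy
    exact ht (Set.mem_singleton_iff.1 hxy ▸ hy)
  · exact hx (he hxy)

theorem not_mem_so (h : Γ.Inst σ Γ') (hD : D.WS) (hx : x ∉ Γ.fv) (ht : x ∉ t.fv) :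
    x ∉ ((t.so D).sub σ).fv :=
  h.not_mem hx fun hx' => ht (t.fv_so_subset hD hx')

theorem sub_fv (h : Γ.Inst σ Γ') : (t.sub σ).fv ⊆ t.fv ∪ Γ.fv := by
  intro y hy
  by_contra hn
  simp only [Set.mem_union, not_or] at hn
  exact h.not_mem hn.2 hn.1 hy

theorem corp (h : Γ.Inst σ Γ') (hD : D.WS) (hx : x ∉ Γ.fv)
    (hok : ((t.so D).sub σ).ExtOK x Γ'.semS) :
    (Ctx.corp Γ x t).Inst σ (.corp Γ' x ((t.so D).sub σ)) where
  lc := h.lc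
  fresh y hy := h.fresh y fun hy' => hy (Or.inr hy')
  range y := (h.range y).imp_right fun hy => hy.trans Set.subset_union_right
  fv := by
    rintro y ((hy | hy) | hy)
    · exact Or.inl (Or.inl hy)
    · rcases h.sub_fv hy with hy | hy
      · exact Or.inl (Or.inr (t.fv_so_subset hD hy))
      · exact Or.inr hy
    · exact Or.inr (h.fv hy)
  ftv := by
    simp only [Ctx.ftv, Ty.ftv_sub, Ty.ftv_so]
    exact Set.union_subset_union_right _ h.ftv
  tdom := h.tdom
  sort y b hy := by
    by_cases hyx : y = x
    · subst hyx
      rw [h.fresh y hx]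
      refine .fvar ?_
      simpa [Ctx.sort, Ty.forget_sub, Ty.forget_so] using hy
    · simp only [Ctx.sort, Function.update_of_ne hyx] at hy
      exact (h.sort y b hy).mono_sort
        (sort_le (fun hx' => hx (h.fv (Γ'.names_subset_fv hx'))) _)
  nodup := ⟨h.nodup, fun hx' => hx (h.fv hx')⟩
  ews := ⟨h.ews, hok⟩

theorem ghost_corp (h : (Ctx.corp Γ x t).Inst σ (.corp Γ' x u)) :
    (Ctx.ghost Γ x t).Inst σ (.corp Γ' x u) :=
  ⟨h.lc, h.fresh, h.range, h.fv, h.ftv, h.tdom, h.sort, h.nodup, h.ews⟩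

theorem ghost_ghost (h : (Ctx.corp Γ x t).Inst σ (.corp Γ' x u)) :
    (Ctx.ghost Γ x t).Inst σ (.ghost Γ' x u) :=
  ⟨h.lc, h.fresh, h.range, h.fv, h.ftv, h.tdom, h.sort, h.nodup, h.ews⟩

theorem ghost (h : (Ctx.corp Γ x t).Inst σ Γ') : (Ctx.ghost Γ x t).Inst σ Γ' :=
  ⟨h.lc, h.fresh, h.range, h.fv, h.ftv, h.tdom, h.sort, h.nodup, h.ews⟩

theorem tvar (h : Γ.Inst σ Γ') (a : TVar) : (Ctx.tvar Γ a).Inst σ (.tvar Γ' a) where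
  lc := h.lc
  fresh := h.fresh
  range := h.range
  fv := h.fv
  ftv := Set.union_subset_union_right _ h.ftv
  tdom := Set.union_subset_union_right _ h.tdom
  sort := h.sort
  nodup := h.nodup
  ews := h.ews

theorem fv_subset (h : Γ.Inst σ Γ') {r : Term T} {s : T.S} (hr : HasSort Γ'.semS [] r s) :
    r.fv ⊆ Γ.fv := by
  intro y hy
  by_contra hn
  exact Ctx.not_mem_fv (fun hy' => hn (h.fv hy')) hr hy

/-- An existential variable is solved. -/
theorem solve (h : Γ.Inst σ Γ') {b : T.B} {p : Refn T} {r : Term T}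
    (hr : HasSort Γ'.semS [] r (.base b)) :
    (Ctx.corp Γ x (.refine b p)).Inst (Function.update σ x r) Γ' where
  lc y := by
    by_cases hy : y = x
    · subst hy
      simpa using hr.lc
    · simpa [hy] using h.lc y
  fresh y hy := by
    rw [Function.update_of_ne]
    · exact h.fresh y fun hy' => hy (Or.inr hy')
    · rintro rfl
      exact hy (Or.inl (Or.inl rfl))
  range y := by
    by_cases hy : y = x
    · subst hy
      rw [Function.update_self]
      exact Or.inr ((h.fv_subset hr).trans Set.subset_union_right)
    · rw [Function.update_of_ne hy]
      exact (h.range y).imp_right fun hy => hy.trans Set.subset_union_right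
  fv := h.fv.trans Set.subset_union_right
  ftv := h.ftv.trans Set.subset_union_right
  tdom := h.tdom
  sort y b' hy := by
    by_cases hyx : y = x
    · subst hyx
      simp only [Ctx.sort, Function.update_self, Ty.forget, STy.base?, Option.some.injEq] at hy ⊢
      subst hy
      exact hr.mono_sort fun z b hz => semS_le_sort h.nodup hz
    · simp only [Ctx.sort, Function.update_of_ne hyx] at hy ⊢
      exact h.sort y b' hy
  nodup := h.nodup
  ews := h.ews

theorem wf (h : Γ.Inst σ Γ') (ht : Γ.TyOK D t) : Wf Γ' ((t.so D).sub σ) :=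
  (Ty.WfB.sub ht h.sort h.tdom).wf

theorem opn (h : Γ.Inst σ Γ') (hD : D.WS) (hx : x ∉ Γ.fv) (t : Ty T) :
    ((t.opn 0 (.fvar x)).so D).sub σ = ((t.so D).sub σ).opn 0 (.fvar x) := by
  rw [Ty.so_opn hD, Ty.sub_opn h.lc]
  simp [Term.sub, h.fresh x hx]

theorem opn_solve (h : Γ.Inst σ Γ') (hD : D.WS) {r : Term T} (hr : r.LC) (hx : x ∉ t.fv) :
    ((t.opn 0 (.fvar x)).so D).sub (Function.update σ x r) = ((t.so D).sub σ).opn 0 r := by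
  rw [Ty.so_opn hD, Ty.sub_opn]
  · congr 1
    · simp [Term.sub]
    · exact Ty.sub_congr fun y hy =>
        Function.update_of_ne (by rintro rfl; exact hx (t.fv_so_subset hD hy)) _ _
  · intro y
    by_cases hy : y = x
    · subst hy
      simpa using hr
    · simpa [hy] using h.lc y

theorem sub_solve (hD : D.WS) {r : Term T} (hx : x ∉ t.fv) :
    (t.so D).sub (Function.update σ x r) = (t.so D).sub σ :=
  Ty.sub_congr fun y hy =>
    Function.update_of_ne (by rintro rfl; exact hx (t.fv_so_subset hD hy)) _ _

theorem genImp (h : Γ.Inst σ Γ') (hD : D.WS) (hx : x ∉ Γ.fv)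
    (hs : ((genImp x t c).so D).Sol Γ'.semS Γ'.sat σ) :
    (Ctx.corp Γ x t).Inst σ (.corp Γ' x ((t.so D).sub σ)) ∧
      (c.so D).Sol (Ctx.corp Γ' x ((t.so D).sub σ)).semS
        (Ctx.corp Γ' x ((t.so D).sub σ)).sat σ := by
  rw [genImp_so hD] at hs
  obtain ⟨h₁, h₂⟩ := hs.genImp h.lc (h.fresh x hx)
  exact ⟨h.corp hD hx h₁, h₂⟩

theorem genEx (h : Γ.Inst σ Γ') (hD : D.WS) (ht : t.IsBase) (hx : x ∉ t.fv)
    (hs : ((genEx x t c).so D).Sol Γ'.semS Γ'.sat σ) :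
    ∃ b p r, (t.so D).sub σ = .refine b p ∧ HasSort Γ'.semS [] r (.base b) ∧
      Γ'.Ent (p.opn 0 r) ∧ (Ctx.corp Γ x t).Inst (Function.update σ x r) Γ' ∧
      (c.so D).Sol Γ'.semS Γ'.sat (Function.update σ x r) := by
  obtain ⟨b, p, rfl⟩ := ht
  rw [genEx_so hD] at hs
  obtain ⟨r, hr, h₁, h₂, h₃⟩ := hs.genEx h.lc fun h' => hx (p.fv_so_subset hD h')
  exact ⟨b, _, r, rfl, hr, ⟨h.ews, h₁, h₂⟩, h.solve hr, h₃⟩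

end Ctx.Inst

theorem Ctx.TyOK.not_mem {D : SOSub T} {Γ : Ctx T} {t : Ty T} {x : Var} (h : Γ.TyOK D t)
    (hx : x ∉ Γ.fv) : x ∉ (t.so D).fv := by
  intro hx'
  obtain ⟨b, hb⟩ := h.mem_dom hx'
  simp [Ctx.sort_eq_none hx] at hb

/-! ## Soundness of algorithmic subtyping -/

theorem ASub.sound {D : SOSub T} (hD : D.WS) {Γ : Ctx T} {t u : Ty T} {c : Con T}
    (h : ASub Γ t u c) {σ : Var → Term T} {Γ' : Ctx T} (hi : Γ.Inst σ Γ') (hΓ : Γ.OK D)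
    (ht : Γ.TyOK D t) (hu : Γ.TyOK D u) (hs : (c.so D).Sol Γ'.semS Γ'.sat σ) :
    ∃ n, SSub n Γ' ((t.so D).sub σ) ((u.so D).sub σ) := by
  induction h generalizing σ Γ' with
  | @base Γ x b r₁ r₂ hx h₁ h₂ =>
    obtain ⟨hi', hs'⟩ := hi.genImp (t := .refine b r₁) (c := .prop (r₂.opn 0 (.fvar x))) hD hx hs
    refine ⟨0, .base (fun h => hx (hi.fv h)) (hi.not_mem_so (t := .refine b r₁) hD hx h₁)
      (hi.not_mem_so (t := .refine b r₂) hD hx h₂) ⟨hi'.ews, ?_⟩⟩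
    have key : ((r₂.opn 0 (.fvar x)).so D).sub σ = ((r₂.so D).sub σ).opn 0 (.fvar x) := by
      rw [Refn.so_opn hD, Refn.sub_opn hi.lc]
      simp [Term.sub, hi.fresh x hx]
    simp only [Con.so, Con.Sol, key] at hs'
    exact hs'
  | @all Γ a t₁ t₂ c ha h₁ h₂ _ ih =>
    obtain ⟨n, hn⟩ := ih (hi.tvar a) hΓ ht.all_body hu.all_body hs
    simp only [Ty.so_opnT, Ty.sub_opnT] at hn
    exact ⟨_, .all (fun h => ha (hi.ftv h)) (by rwa [Ty.ftv_sub, Ty.ftv_so])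
      (by rwa [Ty.ftv_sub, Ty.ftv_so]) hn⟩
  | alpha => exact ⟨0, .alpha⟩
  | @funIL Γ z t₁ t₁' t₂ c hz h₁ h₂ _ ih =>
    simp only [Ty.fv, Set.mem_union, not_or] at h₁
    have hn := Ctx.not_mem_names hz
    obtain ⟨b, p, r, he, hr, hp, hi', hs'⟩ := hi.genEx hD (Ty.isBase_so.1 ht.1) h₁.1 hs
    obtain ⟨n, hm⟩ := ih hi' ⟨hΓ, hn, ht.2.1⟩ (ht.ifn_body hD hn) (hu.weaken hn _) hs'
    rw [hi.opn_solve hD hr.lc h₁.2, Ctx.Inst.sub_solve hD h₂] at hm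
    simp only [Ty.so, Ty.sub, he]
    exact ⟨_, .funIL hr hp hm⟩
  | @funIR Γ x t₁ t₂ t₂' c hx h₁ h₂ _ ih =>
    obtain ⟨hi', hs'⟩ := hi.genImp hD hx hs
    have hn := Ctx.not_mem_names hx
    obtain ⟨n, hm⟩ := ih hi' ⟨hΓ, hn, hu.2.1⟩ (ht.weaken hn _) (hu.ifn_body hD hn) hs'
    rw [hi.opn hD hx] at hm
    exact ⟨_, .funIR (fun h => hx (hi.fv h)) (hi.not_mem_so hD hx h₁)
      (hi.not_mem hx (Ctx.TyOK.not_mem hu.2.1 hx)) (hi.not_mem_so hD hx h₂) hi'.ews hm⟩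
  | @sigL Γ x t₁ t₁' t₂ c hx h₁ h₂ _ ih =>
    obtain ⟨hi', hs'⟩ := hi.genImp hD hx hs
    have hn := Ctx.not_mem_names hx
    obtain ⟨n, hm⟩ := ih hi' ⟨hΓ, hn, ht.2.1⟩ (ht.sig_body hD hn) (hu.weaken hn _) hs'
    rw [hi.opn hD hx] at hm
    exact ⟨_, .sigL (fun h => hx (hi.fv h)) (hi.not_mem hx (Ctx.TyOK.not_mem ht.2.1 hx))
      (hi.not_mem_so hD hx h₁) (hi.not_mem_so hD hx h₂) hi'.ews hm⟩
  | @sigR Γ z t₁ t₂ t₂' c hz h₁ h₂ _ ih =>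
    simp only [Ty.fv, Set.mem_union, not_or] at h₂
    have hn := Ctx.not_mem_names hz
    obtain ⟨b, p, r, he, hr, hp, hi', hs'⟩ := hi.genEx hD (Ty.isBase_so.1 hu.1) h₂.1 hs
    obtain ⟨n, hm⟩ := ih hi' ⟨hΓ, hn, hu.2.1⟩ (ht.weaken hn _) (hu.sig_body hD hn) hs'
    rw [hi.opn_solve hD hr.lc h₂.2, Ctx.Inst.sub_solve hD h₁] at hm
    simp only [Ty.so, Ty.sub, he]
    exact ⟨_, .sigR hr hp hm⟩
  | _ hx h₁ h₂ hd hc ih₁ ih₂ =>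
    obtain ⟨hi', hs'⟩ := hi.genImp hD hx hs.2
    have hn := Ctx.not_mem_names hx
    obtain ⟨n, hn₁⟩ := ih₁ hi hΓ hu.1 ht.1 hs.1
    obtain ⟨m, hm⟩ := ih₂ hi' ⟨hΓ, hn, hu.1⟩ (ht.fn_body hD hn hd.base?)
      (hu.fn_body hD hn rfl) hs'
    rw [hi.opn hD hx, hi.opn hD hx] at hm
    exact ⟨_, .fn (fun h => hx (hi.fv h)) (hi.not_mem hx (Ctx.TyOK.not_mem hu.1 hx))
      (hi.not_mem_so hD hx h₁) (hi.not_mem_so hD hx h₂) hi'.ews hn₁ hm⟩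

end IRT

namespace IRT

variable {T : Theory} {P : Type} {tc : P → Ty T}

namespace Expr

theorem fv_opn_subset (e : Expr T P) (k : ℕ) (x : Var) : (e.opn k x).fv ⊆ {x} ∪ e.fv := by
  have ht : ∀ (t : Ty T) k, (t.opn k (.fvar x)).fv ⊆ {x} ∪ t.fv := fun t k =>
    (t.fv_opn_subset k _).trans (Set.union_comm _ _).subset
  induction e generalizing k with
  | bvar i => by_cases h : i = k <;> simp [opn, h, fv]
  | lamB τ e ih | tabs e ih | tapp e τ ih => exact ih _
  | app e₁ e₂ h₁ h₂ | letB τ e₁ e₂ h₁ h₂ | unpack e₁ e₂ h₁ h₂ =>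
    simp only [opn, fv, Set.union_subset_iff]
    exact ⟨(h₁ _).trans (Set.union_subset_union_right _ Set.subset_union_left),
      (h₂ _).trans (Set.union_subset_union_right _ Set.subset_union_right)⟩
  | lamR t e ih | ilam t e ih =>
    simp only [opn, fv, Set.union_subset_iff]
    exact ⟨(ht t _).trans (Set.union_subset_union_right _ Set.subset_union_left),
      (ih _).trans (Set.union_subset_union_right _ Set.subset_union_right)⟩
  | letR t e₁ e₂ h₁ h₂ =>
    simp only [opn, fv, Set.union_subset_iff]
    refine ⟨⟨(ht t _).trans (Set.union_subset_union_right _ ?_),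
      (h₁ _).trans (Set.union_subset_union_right _ ?_)⟩,
      (h₂ _).trans (Set.union_subset_union_right _ Set.subset_union_right)⟩
    · exact Set.subset_union_left.trans Set.subset_union_left
    · exact Set.subset_union_right.trans Set.subset_union_left
  | _ => exact Set.subset_union_right

theorem fv_opnT (e : Expr T P) (k : ℕ) (a : TVar) : (e.opnT k a).fv = e.fv := by
  induction e generalizing k <;> simp [opnT, fv, Ty.fv_opnT, *]

end Expr

/-- A stronger refinement of the left-hand side. -/
theorem SSub.strengthen {n : ℕ} {Γ : Ctx T} {b : T.B} {r q : Refn T} {u : Ty T}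
    (h : SSub n Γ (.refine b r) u) (hq : q.WS Γ.semS [some b]) :
    SSub n Γ (.refine b (.and r q)) u := by
  have hfv : ∀ {Γ : Ctx T} {x : Var}, x ∉ Γ.fv → q.WS Γ.semS [some b] → x ∉ q.fv := by
    intro Γ x hx hq hx'
    obtain ⟨b, hb⟩ := hq.mem_dom hx'
    simp [Ctx.semS_eq_none hx] at hb
  generalize ht : Ty.refine b r = t at h
  induction h with
  | @base Γ v b r₁ r₂ hv h₁ h₂ h =>
    cases ht
    have hq' : (q.opn 0 (.fvar v)).WS (Function.update Γ.semS v (some b)) [] :=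
      (hq.mono_sort (Ctx.le_update hv _)).opn_zero fun _ hb => .fvar (by simpa using hb)
    refine .base hv (fun h => h.elim h₁ (hfv hv hq)) h₂ ⟨⟨h.1.1, h.1.2, hq'⟩, h.2.1, ?_⟩
    rintro _ ⟨ρ, hρ, a, rfl, hr, -⟩
    exact h.2.2 _ ⟨ρ, hρ, a, rfl, hr⟩
  | @funIR n Γ x t₁ t₂ t₂' hx h₁ h₂ h₃ hews _ ih =>
    cases ht
    exact .funIR hx (fun h => h.elim h₁ (hfv hx hq)) h₂ h₃ hews
      (ih (hq.mono_sort (Ctx.le_extS hx _)) rfl)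
  | sigR hr hp _ ih =>
    cases ht
    exact .sigR hr hp (ih hq rfl)
  | _ => cases ht

/-! ## Instances of contexts of programs -/

/-- `Γ'` is an instance of the well-formed context `Γ` with the same program variables. -/
structure Ctx.Real (D : SOSub T) (Γ : Ctx T) (σ : Var → Term T) (Γ' : Ctx T) : Prop where
  inst : Γ.Inst σ Γ'
  ok : Γ.OK D
  mem : ∀ x t, Γ.Mem x t → Γ'.Mem x ((t.so D).sub σ) ∧ σ x = .fvar x

theorem Ctx.Mem.fv_subset {Γ : Ctx T} {x : Var} {t : Ty T} (h : Γ.Mem x t) : t.fv ⊆ Γ.fv := by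
  induction h with
  | here => exact fun y hy => Or.inl (Or.inr hy)
  | corp _ ih | ghost _ ih => exact ih.trans Set.subset_union_right
  | tvar _ ih => exact ih

namespace Ctx.Real

variable {D : SOSub T} {Γ Γ' : Ctx T} {σ : Var → Term T} {x : Var} {t u : Ty T} {c : Con T}

theorem corp (h : Γ.Real D σ Γ') (hD : D.WS) (hx : x ∉ Γ.fv) (ht : Γ.TyOK D t)
    (hs : ((genImp x t c).so D).Sol Γ'.semS Γ'.sat σ) :
    (Ctx.corp Γ x t).Real D σ (.corp Γ' x ((t.so D).sub σ)) ∧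
      (c.so D).Sol (Ctx.corp Γ' x ((t.so D).sub σ)).semS
        (Ctx.corp Γ' x ((t.so D).sub σ)).sat σ := by
  obtain ⟨h₁, h₂⟩ := h.inst.genImp hD hx hs
  refine ⟨⟨h₁, ⟨h.ok, Ctx.not_mem_names hx, ht⟩, ?_⟩, h₂⟩
  rintro y s (_ | hm)
  · exact ⟨.here, h.inst.fresh x hx⟩
  · exact ⟨.corp (h.mem y s hm).1, (h.mem y s hm).2⟩

theorem ghost (h : Γ.Real D σ Γ') (hD : D.WS) (hx : x ∉ Γ.fv) (ht : Γ.TyOK D t)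
    (hs : ((genImp x t c).so D).Sol Γ'.semS Γ'.sat σ) :
    (Ctx.ghost Γ x t).Real D σ (.ghost Γ' x ((t.so D).sub σ)) ∧
      (c.so D).Sol (Ctx.ghost Γ' x ((t.so D).sub σ)).semS
        (Ctx.ghost Γ' x ((t.so D).sub σ)).sat σ := by
  obtain ⟨h₁, h₂⟩ := h.inst.genImp hD hx hs
  refine ⟨⟨h₁.ghost_ghost, ⟨h.ok, Ctx.not_mem_names hx, ht⟩, ?_⟩, h₂⟩
  rintro y s (_ | _ | hm)
  exact ⟨.ghost (h.mem y s hm).1, (h.mem y s hm).2⟩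

theorem tvar (h : Γ.Real D σ Γ') (a : TVar) : (Ctx.tvar Γ a).Real D σ (.tvar Γ' a) := by
  refine ⟨h.inst.tvar a, h.ok, ?_⟩
  rintro y s (_ | _ | _ | hm)
  exact ⟨.tvar (h.mem y s hm).1, (h.mem y s hm).2⟩

theorem genEx (h : Γ.Real D σ Γ') (hD : D.WS) (ht : t.IsBase) (hok : Γ.TyOK D t) (hx : x ∉ Γ.fv)
    (hxt : x ∉ t.fv) (hs : ((genEx x t c).so D).Sol Γ'.semS Γ'.sat σ) :
    ∃ r, r.LC ∧ HasType tc Γ'.forgetGhost r.toExpr ((t.so D).sub σ) ∧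
      (Ctx.ghost Γ x t).Real D (Function.update σ x r) Γ' ∧
      (c.so D).Sol Γ'.semS Γ'.sat (Function.update σ x r) := by
  obtain ⟨b, p, r, he, hr, hp, hi, hs'⟩ := h.inst.genEx hD ht hxt hs
  refine ⟨r, hr.lc, ?_, ⟨hi.ghost, ⟨h.ok, Ctx.not_mem_names hx, hok⟩, ?_⟩, hs'⟩
  · rw [he]
    exact .refine_of_ent h.inst.nodup hr hp
  · rintro y s (_ | _ | hm)
    obtain ⟨h₁, h₂⟩ := h.mem y s hm
    rw [Ctx.Inst.sub_solve hD fun hx' => hx (hm.fv_subset hx'), Function.update_of_ne]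
    · exact ⟨h₁, h₂⟩
    · rintro rfl
      exact hx hm.mem_fv

theorem annot (hw : Wf Γ t) (he : ∀ y ∈ t.fv, σ y = .fvar y) : (t.so D).sub σ = t := by
  rw [Ty.so_of_kvars hw.wfB.kvars, Ty.sub_eq_self he]

/-- The context of the body of an `unpack`. -/
theorem unpack {y : Var} (h : Γ.Real D σ Γ') (hD : D.WS) (hx : x ∉ Γ.fv) (hy : y ∉ Γ.fv)
    (hxy : x ≠ y) (ht : Γ.TyOK D (.sig t u)) (hyt : y ∉ (Ty.sig t u).fv)
    (hs : ((genImp x t (genImp y (u.opn 0 (.fvar x)) c)).so D).Sol Γ'.semS Γ'.sat σ) :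
    ∃ Γ₂, Γ₂ = Ctx.corp (.ghost Γ' x ((t.so D).sub σ)) y (((u.so D).sub σ).opn 0 (.fvar x)) ∧
      (Ctx.corp (.ghost Γ x t) y (u.opn 0 (.fvar x))).Real D σ Γ₂ ∧
      (c.so D).Sol Γ₂.semS Γ₂.sat σ := by
  obtain ⟨h₁, hs₁⟩ := h.ghost hD hx ht.2.1 hs
  have hyn : y ∉ (Ctx.ghost Γ x t).fv := by
    simp only [Ty.fv, Set.mem_union, not_or] at hyt
    rintro ((h | h) | h)
    · exact hxy h.symm
    · exact hyt.1 h
    · exact hy h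
  obtain ⟨h₂, hs₂⟩ := h₁.corp hD hyn (ht.sig_body hD (Ctx.not_mem_names hx)) hs₁
  exact ⟨_, by rw [h.inst.opn hD hx], h₂, hs₂⟩

end Ctx.Real

theorem HasType.closed_inst {D : SOSub T} {t : Ty T} {A : Set TVar} {σ : Var → Term T}
    (h : t.WfB (fun _ => none) A [] 0) : (t.so D).sub σ = t := by
  rw [Ty.so_of_kvars h.kvars, Ty.sub_eq_self]
  intro x hx
  obtain ⟨b, hb⟩ := h.mem_dom hx
  simp at hb

theorem Ctx.Inst.opn_var {D : SOSub T} {Γ Γ' : Ctx T} {σ : Var → Term T} {y : Var}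
    (h : Γ.Inst σ Γ') (hD : D.WS) (hy : σ y = .fvar y) (t : Ty T) :
    ((t.opn 0 (.fvar y)).so D).sub σ = ((t.so D).sub σ).opn 0 (.fvar y) := by
  rw [Ty.so_opn hD, Ty.sub_opn h.lc]
  simp [Term.sub, hy]

/-- An argument that is a variable may be named by a fresh variable that equals it. -/
theorem AppType.of_var {D : SOSub T} (hD : D.WS) {Γ Γ' : Ctx T} {σ : Var → Term T}
    (h : Γ.Real D σ Γ') {y : Var} {tx : Ty T} {c : Con T} (hc : Check tc Γ (.fvar y) tx c)
    (htx : Γ.TyOK D tx) (hs : (c.so D).Sol Γ'.semS Γ'.sat σ) {t u : Ty T} {n : ℕ}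
    (hu : SSub n Γ' (t.opn 0 (.fvar y)) u) (hw : Wf Γ' u) :
    AppType tc Γ' (.fn ((tx.so D).sub σ) t) (.fvar y) u := by
  obtain ⟨ty, w, c', hm, hw', ha, rfl⟩ := hc.fvar_inv
  obtain ⟨hm', hσ⟩ := h.mem y ty hm
  obtain ⟨hty, hsort⟩ := hm.ok h.ok
  have hN := h.inst.nodup
  have main : ∃ te n, HasType tc Γ' (.fvar y) te ∧ SSub n Γ' te ((tx.so D).sub σ) ∧
      (∀ y' ∉ Γ'.fv, (Ctx.corp Γ' y' te).EWS) ∧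
      ∀ b, Γ'.semS y = some b → ∃ r, te = selfTy b r y := by
    by_cases hb : ty.IsBase
    · obtain ⟨b, r, rfl⟩ := hb
      have hwok : Γ.TyOK D w := by
        obtain rfl | ⟨b', r', he, rfl⟩ := hw'
        · exact hty
        · cases he
          exact ⟨hty, HasSort.eq (.bvar rfl) (.fvar hsort)⟩
      obtain ⟨n, hn⟩ := ha.sound hD h.inst h.ok hwok htx hs.2
      simp only [Ty.so, Ty.sub] at hm'
      have hsem := hm'.semS hN
      have hq : (Refn.pred (.eq b (.bvar 0) (.fvar y))).WS Γ'.semS [some b] :=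
        HasSort.eq (.bvar rfl) (.fvar hsem)
      have hr := hm'.refine_WS h.inst.ews hN
      refine ⟨selfTy b _ y, n, .base hm', ?_, fun y' hy' => ⟨h.inst.ews, ?_⟩, fun b' hb' => ?_⟩
      · obtain rfl | ⟨b', r', he, rfl⟩ := hw'
        · exact hn.strengthen hq
        · cases he
          simpa [selfTy, Ty.so, Ty.sub, Refn.so, Refn.sub, Term.eq, Term.sub, hσ] using hn
      · exact ((show (Refn.and _ _).WS Γ'.semS [some b] from ⟨hr, hq⟩).mono_sort
          (Ctx.le_update hy' _)).opn_zero fun _ hb => .fvar (by simpa using hb)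
      · rw [hsem] at hb'
        cases hb'
        exact ⟨_, rfl⟩
    · obtain rfl | ⟨b, r, he, -⟩ := hw'
      · obtain ⟨n, hn⟩ := ha.sound hD h.inst h.ok hty htx hs.2
        have hb' : ¬ ((w.so D).sub σ).IsBase := by rwa [Ty.isBase_sub, Ty.isBase_so]
        refine ⟨_, n, .var hm', hn, fun y' _ => ⟨h.inst.ews, ?_⟩, fun b hb => ?_⟩
        · generalize (w.so D).sub σ = s at hb'
          cases s with
          | refine b r => exact (hb' ⟨b, r, rfl⟩).elim
          | _ => trivial
        · rw [hm'.semS_none hN hb'] at hb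
          cases hb
      · exact (hb ⟨b, r, he⟩).elim
  obtain ⟨te, n', h₁, h₂, h₃, h₄⟩ := main
  obtain ⟨y', hy'⟩ := exists_fresh (Γ'.fv_finite.union (te.fv_finite.union
    ((Ty.fn ((tx.so D).sub σ) t).fv_finite.union (u.fv_finite.union (Set.finite_singleton y)))))
  simp only [Set.mem_union, not_or, Set.mem_singleton_iff] at hy'
  obtain ⟨g₁, g₂, g₃, g₄, g₅⟩ := hy'
  have hmor := Mor.copy (y := y) g₁ (h₃ y' g₁) h₄
  refine .fun g₁ (by simpa [Expr.fv] using g₅) g₂ ?_ g₄ h₁ (h₂.subType hN)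
    ((hu.mor hmor (Ty.Rel.opn hmor.lc (Ty.Rel.refl (fun z => Or.inl rfl) t)
      (.fvar (Or.inr ⟨rfl, rfl⟩)) 0) (Ty.Rel.refl (fun z => Or.inl rfl) u)).subType ⟨hN, g₁⟩) hw
  simpa [Ty.fv] using g₃

end IRT

namespace IRT

variable {T : Theory} {P : Type} {tc : P → Ty T}

/-! ## Soundness of the typing algorithm -/

theorem forall_opn {σ : Var → Term T} {e : Expr T P} {k : ℕ} {x : Var}
    (he : ∀ y ∈ e.fv, σ y = .fvar y) (hx : σ x = .fvar x) :
    ∀ y ∈ (e.opn k x).fv, σ y = .fvar y := by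
  intro y hy
  rcases e.fv_opn_subset k x hy with hy | hy
  · rwa [Set.mem_singleton_iff.1 hy]
  · exact he y hy

mutual

theorem Check.sound {D : SOSub T} (hD : D.WS) (htc : ∀ p, Wf .nil (tc p)) {Γ : Ctx T}
    {e : Expr T P} {t : Ty T} {c : Con T} {σ : Var → Term T} {Γ' : Ctx T} :
    Check tc Γ e t c → Γ.Real D σ Γ' → (∀ y ∈ e.fv, σ y = .fvar y) → Γ.TyOK D t →
      (c.so D).Sol Γ'.semS Γ'.sat σ → HasType tc Γ' e ((t.so D).sub σ)
  | .sub h₁ h₂, h, he, ht, hs => by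
    obtain ⟨n, hn⟩ := h₂.sound hD h.inst h.ok (h₁.ok hD htc h.ok) ht hs.2
    exact .sub (h₁.sound hD htc h he hs.1) (hn.subType h.inst.nodup) (h.inst.wf ht)
  | .letBase hx _ hx₂ hxt hτ h₁ h₂ hf, h, he, ht, hs => by
    have hs' := (Ctx.TyOK.of_wfB hτ.wfB).fresh hD hf rfl
    obtain ⟨h', hsol⟩ := h.corp hD hx hs' hs.2
    refine .letBase (fun hx' => hx (h.inst.fv hx')) hx₂ (h.inst.not_mem_so hD hx hxt)
      (h₁.sound hD htc h (fun y hy => he y (Or.inl hy)) hs' hs.1)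
      (h₂.sound hD htc h' (forall_opn (fun y hy => he y (Or.inr hy)) (h.inst.fresh _ hx))
        (ht.weaken (Ctx.not_mem_names hx) _) hsol)
      (h.inst.wf ht) (h.inst.wf hs') ?_
    rw [Ty.forget_sub, Ty.forget_so, ← hf.forget, STy.forget_toTy]
  | .letReft hx _ hx₁ hx₂ hxt hw h₁ h₂, h, he, ht, hs => by
    have hs' := Ctx.TyOK.of_wfB (D := D) hw.wfB
    obtain ⟨h', hsol⟩ := h.corp hD hx hs' hs
    have ha := Ctx.Real.annot (D := D) hw fun y hy => he y (Or.inl (Or.inl hy))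
    have hn := Ctx.not_mem_names hx
    have g₁ := h₁.sound hD htc h' (forall_opn (fun y hy => he y (Or.inl (Or.inr hy)))
      (h.inst.fresh _ hx)) (hs'.weaken hn _) hsol.1
    have g₂ := h₂.sound hD htc h' (forall_opn (fun y hy => he y (Or.inr hy))
      (h.inst.fresh _ hx)) (ht.weaken hn _) hsol.2
    have g₃ := h.inst.wf hs'
    rw [ha] at g₁ g₂ g₃
    exact .letReft (fun hx' => hx (h.inst.fv hx')) hx₁ hx₂ (h.inst.not_mem_so hD hx hxt) g₁ g₂ g₃
      (h.inst.wf ht)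
  | .app h₁ h₂, h, he, ht, hs =>
    .app (h₁.sound hD htc h (fun y hy => he y (Or.inl hy)) hs.1)
      (h₂.sound hD htc h (fun y hy => he y (Or.inr hy)) (h₁.ok hD htc h.ok) ht hs.2)
  | .tabs ha hae hat h₁, h, he, ht, hs => by
    have g := h₁.sound hD htc (h.tvar _) (by rwa [Expr.fv_opnT]) ht.all_body hs
    rw [Ty.so_opnT, Ty.sub_opnT] at g
    exact .tabs (fun h' => ha (h.inst.ftv h')) hae (by rwa [Ty.ftv_sub, Ty.ftv_so]) g
  | .unpack hx hy hxy hxs hys hxe hye hxt hyt h₁ h₂, h, he, ht, hs => by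
    have hok := h₁.ok hD htc h.ok
    obtain ⟨Γ₂, rfl, h', hsol⟩ := h.unpack hD hx hy hxy hok hys hs.2
    exact .unpack (fun h' => hx (h.inst.fv h')) (fun h' => hy (h.inst.fv h')) hxy
      (h.inst.not_mem_so (t := .sig _ _) hD hx hxs) (h.inst.not_mem_so (t := .sig _ _) hD hy hys)
      hxe hye (h.inst.not_mem_so hD hx hxt) (h.inst.not_mem_so hD hy hyt)
      (h₁.sound hD htc h (fun y hy => he y (Or.inl hy)) hs.1)
      (h₂.sound hD htc h' (forall_opn (forall_opn (fun y hy => he y (Or.inr hy))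
        (h.inst.fresh _ hx)) (h.inst.fresh _ hy))
        ((ht.weaken (Ctx.not_mem_names hx) _).weaken (Γ := .ghost _ _ _) h'.ok.2.1 _) hsol)
      (h.inst.wf ht)

theorem Synth.sound {D : SOSub T} (hD : D.WS) (htc : ∀ p, Wf .nil (tc p)) {Γ : Ctx T}
    {e : Expr T P} {t : Ty T} {c : Con T} {σ : Var → Term T} {Γ' : Ctx T} :
    Synth tc Γ e t c → Γ.Real D σ Γ' → (∀ y ∈ e.fv, σ y = .fvar y) →
      (c.so D).Sol Γ'.semS Γ'.sat σ → HasType tc Γ' e ((t.so D).sub σ)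
  | .tabs ha hae hat h₁, h, he, hs => by
    have g := h₁.sound hD htc (h.tvar _) (by rwa [Expr.fv_opnT]) hs
    rw [Ty.so_opnT, Ty.sub_opnT] at g
    exact .tabs (fun h' => ha (h.inst.ftv h')) hae (by rwa [Ty.ftv_sub, Ty.ftv_so]) g
  | .tapp hτ h₁ hf, h, he, hs => by
    have hs' := (Ctx.TyOK.of_wfB hτ.wfB).fresh hD hf rfl
    rw [Ty.so_opnT, Ty.sub_opnT]
    refine .tapp (h₁.sound hD htc h he hs) (h.inst.wf hs') ?_
    rw [Ty.forget_sub, Ty.forget_so, ← hf.forget, STy.forget_toTy]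
  | .con, h, he, hs => by
    rw [HasType.closed_inst (t := Const.ty _) (A := ∅) (FSort.exactTy_wfB .con)]
    exact .con
  | .prim, h, he, hs => by
    rw [HasType.closed_inst (htc _).wfB]
    exact .prim
  | .base hm, h, he, hs => by
    obtain ⟨h₁, h₂⟩ := h.mem _ _ hm
    simpa [selfTy, Ty.so, Ty.sub, Refn.so, Refn.sub, Term.eq, Term.sub, h₂]
      using HasType.base (tc := tc) h₁
  | .var hm, h, he, hs => .var (h.mem _ _ hm).1
  | .absBase hx hxs hxe hxt hτ h₁ hf, h, he, hs => by
    have hs' := (Ctx.TyOK.of_wfB hτ.wfB).fresh hD hf rfl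
    obtain ⟨h', hsol⟩ := h.corp hD hx hs' hs
    have g := h₁.sound hD htc h' (forall_opn he (h.inst.fresh _ hx)) hsol
    rw [h.inst.opn hD hx] at g
    refine .absBase (fun h' => hx (h.inst.fv h')) hxe (h.inst.not_mem_so hD hx hxt) g
      (h.inst.wf hs') ?_
    rw [Ty.forget_sub, Ty.forget_so, ← hf.forget, STy.forget_toTy]
  | .absReft hx hxs hxe hxt hw h₁, h, he, hs => by
    have hs' := Ctx.TyOK.of_wfB (D := D) hw.wfB
    obtain ⟨h', hsol⟩ := h.corp hD hx hs' hs
    have ha := Ctx.Real.annot (D := D) hw fun y hy => he y (Or.inl hy)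
    have g := h₁.sound hD htc h' (forall_opn (fun y hy => he y (Or.inr hy))
      (h.inst.fresh _ hx)) hsol
    have g' := h.inst.wf hs'
    rw [h.inst.opn hD hx] at g
    simp only [Ty.so, Ty.sub]
    rw [ha] at g g' ⊢
    exact .absReft (fun h' => hx (h.inst.fv h')) hxe (h.inst.not_mem_so hD hx hxt) g g'
  | .app h₁ h₂, h, he, hs =>
    .app (h₁.sound hD htc h (fun y hy => he y (Or.inl hy)) hs.1)
      (h₂.sound hD htc h (fun y hy => he y (Or.inr hy)) (h₁.ok hD htc h.ok) hs.2).1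
  | .absI hx hxs hxe hxt hw hb h₁, h, he, hs => by
    have hs' := Ctx.TyOK.of_wfB (D := D) hw.wfB
    obtain ⟨h', hsol⟩ := h.ghost hD hx hs' hs
    have ha := Ctx.Real.annot (D := D) hw fun y hy => he y (Or.inl hy)
    have g := h₁.sound hD htc h' (forall_opn (fun y hy => he y (Or.inr hy))
      (h.inst.fresh _ hx)) hsol
    rw [h.inst.opn hD hx] at g
    simp only [Ty.so, Ty.sub]
    rw [ha] at g ⊢
    exact .absI (fun h' => hx (h.inst.fv h')) hxe (h.inst.not_mem_so hD hx hxt) g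
  | .unpack hx hy hxy hxs hys hxe hye hxt hyt h₁ h₂ h₃ hf, h, he, hs => by
    have hok := h₁.ok hD htc h.ok
    obtain ⟨Γ₂, rfl, h', hsol⟩ := h.unpack hD hx hy hxy hok hys hs.2
    have hok₂ := h₂.ok hD htc h'.ok
    have ht := hok₂.fresh hD hf rfl
    have ht' := fun u v => (ht.weaken (Ctx.not_mem_names hx) u).weaken (Γ := .ghost _ _ _) h'.ok.2.1 v
    obtain ⟨n, hn⟩ := h₃.sound hD h'.inst h'.ok hok₂ (ht' _ _) hsol.2
    exact .unpack (fun h' => hx (h.inst.fv h')) (fun h' => hy (h.inst.fv h')) hxy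
      (h.inst.not_mem_so (t := .sig _ _) hD hx hxs) (h.inst.not_mem_so (t := .sig _ _) hD hy hys)
      hxe hye (h.inst.not_mem_so hD hx hxt) (h.inst.not_mem_so hD hy hyt)
      (h₁.sound hD htc h (fun y hy => he y (Or.inl hy)) hs.1)
      (.sub (h₂.sound hD htc h' (forall_opn (forall_opn (fun y hy => he y (Or.inr hy))
        (h.inst.fresh _ hx)) (h.inst.fresh _ hy)) hsol.1)
        (hn.subType h'.inst.nodup) (h'.inst.wf (ht' _ _)))
      (h.inst.wf ht)
  | .letBase hx _ hx₂ hxt hτ h₁ h₂ h₃ hf hf', h, he, hs => by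
    have hs' := (Ctx.TyOK.of_wfB hτ.wfB).fresh hD hf rfl
    obtain ⟨h', hsol⟩ := h.corp hD hx hs' hs.2
    have hok₂ := h₂.ok hD htc h'.ok
    have ht := hok₂.fresh hD hf' rfl
    have ht' := ht.weaken (Ctx.not_mem_names hx)
    obtain ⟨n, hn⟩ := h₃.sound hD h'.inst h'.ok hok₂ (ht' _) hsol.2
    refine .letBase (fun hx' => hx (h.inst.fv hx')) hx₂ (h.inst.not_mem_so hD hx hxt)
      (h₁.sound hD htc h (fun y hy => he y (Or.inl hy)) hs' hs.1)
      (.sub (h₂.sound hD htc h' (forall_opn (fun y hy => he y (Or.inr hy)) (h.inst.fresh _ hx))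
        hsol.1) (hn.subType h'.inst.nodup) (h'.inst.wf (ht' _)))
      (h.inst.wf ht) (h.inst.wf hs') ?_
    rw [Ty.forget_sub, Ty.forget_so, ← hf.forget, STy.forget_toTy]
  | .letReft hx _ hx₁ hx₂ hxt hw h₁ h₂ h₃ hf, h, he, hs => by
    have hs' := Ctx.TyOK.of_wfB (D := D) hw.wfB
    obtain ⟨h', hsol⟩ := h.corp hD hx hs' hs
    have ha := Ctx.Real.annot (D := D) hw fun y hy => he y (Or.inl (Or.inl hy))
    have hn := Ctx.not_mem_names hx
    have hok₂ := h₂.ok hD htc h'.ok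
    have ht := hok₂.fresh hD hf rfl
    have ht' := ht.weaken hn
    obtain ⟨n, hsub⟩ := h₃.sound hD h'.inst h'.ok hok₂ (ht' _) hsol.2.2
    have g₁ := h₁.sound hD htc h' (forall_opn (fun y hy => he y (Or.inl (Or.inr hy)))
      (h.inst.fresh _ hx)) (hs'.weaken hn _) hsol.1
    have g₂ := HasType.sub (h₂.sound hD htc h' (forall_opn (fun y hy => he y (Or.inr hy))
      (h.inst.fresh _ hx)) hsol.2.1) (hsub.subType h'.inst.nodup) (h'.inst.wf (ht' _))
    have g₃ := h.inst.wf hs'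
    rw [ha] at g₁ g₂ g₃
    exact .letReft (fun hx' => hx (h.inst.fv hx')) hx₁ hx₂ (h.inst.not_mem_so hD hx hxt) g₁ g₂ g₃
      (h.inst.wf ht)

theorem SpineCheck.sound {D : SOSub T} (hD : D.WS) (htc : ∀ p, Wf .nil (tc p)) {Γ : Ctx T}
    {t : Ty T} {e : Expr T P} {t' : Ty T} {c : Con T} {σ : Var → Term T} {Γ' : Ctx T} :
    SpineCheck tc Γ t e t' c → Γ.Real D σ Γ' → (∀ y ∈ e.fv, σ y = .fvar y) → Γ.TyOK D t →
      Γ.TyOK D t' → (c.so D).Sol Γ'.semS Γ'.sat σ →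
      AppType tc Γ' ((t.so D).sub σ) e ((t'.so D).sub σ)
  | .funVar h₁ h₂, h, he, ht, ht', hs => by
    obtain ⟨n, hn⟩ := h₂.sound hD h.inst h.ok (ht.opn_fvar hD (h₁.fvar_sort h.ok)) ht' hs.2
    rw [h.inst.opn_var hD (he _ rfl)] at hn
    exact .of_var hD h h₁ ht.1 hs.1 hn (h.inst.wf ht')
  | .ifun hz hzt hze hzt' h₁, h, he, ht, ht', hs => by
    simp only [Ty.fv, Set.mem_union, not_or] at hzt
    have hn := Ctx.not_mem_names hz
    obtain ⟨r, hr, g₁, h', hsol⟩ := h.genEx (tc := tc) hD (Ty.isBase_so.1 ht.1) ht.2.1 hz hzt.1 hs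
    have g₂ := h₁.sound hD htc h' (fun y hy => by
      rw [Function.update_of_ne (by rintro rfl; exact hze hy)]
      exact he y hy) (ht.ifn_body hD hn) (ht'.weaken hn _) hsol
    rw [h.inst.opn_solve hD hr hzt.2, Ctx.Inst.sub_solve hD hzt'] at g₂
    exact .ifun g₂ g₁
  | .fun hy hyt hye hyte hyt' h₁ h₂ h₃, h, he, ht, ht', hs => by
    have hte := h₁.ok hD htc h.ok
    have hn := Ctx.not_mem_names hy
    obtain ⟨h', hsol⟩ := h.corp hD hy hte hs.2.2
    obtain ⟨n, g₂⟩ := h₂.sound hD h.inst h.ok hte ht.1 hs.2.1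
    obtain ⟨m, g₃⟩ := h₃.sound hD h'.inst.ghost_corp h'.ok (ht.fn_body hD hn h₂.base?)
      (ht'.weaken hn _) hsol
    rw [h.inst.opn hD hy] at g₃
    exact .fun (fun h' => hy (h.inst.fv h')) hye (h.inst.not_mem_so hD hy hyte)
      (h.inst.not_mem_so (t := .fn _ _) hD hy hyt) (h.inst.not_mem_so hD hy hyt')
      (h₁.sound hD htc h he hs.1) (g₂.subType h.inst.nodup) (g₃.subType h'.inst.nodup)
      (h.inst.wf ht')

/-- The synthesized type may be replaced by a supertype. -/
theorem SpineSynth.sound {D : SOSub T} (hD : D.WS) (htc : ∀ p, Wf .nil (tc p)) {Γ : Ctx T}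
    {t : Ty T} {e : Expr T P} {t' : Ty T} {c : Con T} {σ : Var → Term T} {Γ' : Ctx T} :
    SpineSynth tc Γ t e t' c → Γ.Real D σ Γ' → (∀ y ∈ e.fv, σ y = .fvar y) → Γ.TyOK D t →
      (c.so D).Sol Γ'.semS Γ'.sat σ →
      AppType tc Γ' ((t.so D).sub σ) e ((t'.so D).sub σ) ∧
      ∀ n u, t'.sk = u.sk → SSub n Γ' ((t'.so D).sub σ) u → Wf Γ' u →
        AppType tc Γ' ((t.so D).sub σ) e u
  | .funVar h₁, h, he, ht, hs => by
    rw [h.inst.opn_var hD (he _ rfl)]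
    exact ⟨.funVar (h₁.sound hD htc h he ht.1 hs), fun n u _ hn hw =>
      .of_var hD h h₁ ht.1 hs hn hw⟩
  | .fun hy hyt hye hyte hyt' h₁ h₂ h₃ hf, h, he, ht, hs => by
    have hte := h₁.ok hD htc h.ok
    have ht' := hf.wfB hD (ht.shp_opn _ Γ.sort)
    have hn := Ctx.not_mem_names hy
    obtain ⟨h', hsol⟩ := h.corp hD hy hte hs.2.2
    obtain ⟨n, g₂⟩ := h₂.sound hD h.inst h.ok hte ht.1 hs.2.1
    obtain ⟨m, g₃⟩ := h₃.sound hD h'.inst.ghost_corp h'.ok (ht.fn_body hD hn h₂.base?)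
      (Ctx.TyOK.weaken ht' hn _) hsol
    have hyΓ := fun h' => hy (h.inst.fv h')
    have main : ∀ n u, Wf Γ' u →
        SSub n (.corp Γ' _ _) (((Ty.opn 0 _ _).so D).sub σ) u →
        AppType tc Γ' (((Ty.fn _ _).so D).sub σ) _ u := fun n u hw hu => by
      rw [h.inst.opn hD hy] at hu
      refine .fun hyΓ hye (h.inst.not_mem_so hD hy hyte)
        (h.inst.not_mem_so (t := .fn _ _) hD hy hyt) ?_
        (h₁.sound hD htc h he hs.1) (g₂.subType h.inst.nodup) (hu.subType h'.inst.nodup) hw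
      intro hyu
      obtain ⟨b, hb⟩ := hw.wfB.mem_dom hyu
      simp [Ctx.sort_eq_none hyΓ] at hb
    refine ⟨main _ _ (h.inst.wf ht') g₃, fun n u hsk hu hw => ?_⟩
    obtain ⟨k, hk⟩ := g₃.trans h'.inst.ews (hu.mor (Mor.weaken hyΓ h'.inst.ews)
      (.refl idE_refl _) (.refl idE_refl _))
      (by rw [Ty.sk_sub, Ty.sk_so, Ty.sk_sub, Ty.sk_so, hf.sk]) (by rwa [Ty.sk_sub, Ty.sk_so])
    exact main _ _ hw hk
  | .ifun hz hzt hze hzs h₁ h₂ hf, h, he, ht, hs => by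
    simp only [Ty.fv, Set.mem_union, not_or] at hzt
    have hn := Ctx.not_mem_names hz
    obtain ⟨r, hr, g₁, h', hsol⟩ := h.genEx (tc := tc) hD (Ty.isBase_so.1 ht.1) ht.2.1 hz hzt.1 hs
    have htb := ht.ifn_body hD hn
    obtain ⟨-, g₂⟩ := h₁.sound hD htc h' (fun y hy => by
      rw [Function.update_of_ne (by rintro rfl; exact hze hy)]
      exact he y hy) htb hsol.1
    have hok := h₁.ok hD htc h'.ok htb
    have hok' := hok.fresh hD hf rfl
    obtain ⟨n, g₃⟩ := h₂.sound hD h'.inst h'.ok hok (hok'.weaken hn _) hsol.2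
    rw [h.inst.opn_solve hD hr hzt.2] at g₂
    rw [Ctx.Inst.sub_solve hD hzs] at g₃
    refine ⟨.ifun (g₂ n _ (by rw [Ty.sk_sub, Ty.sk_so, hf.sk]) g₃ (h.inst.wf hok')) g₁,
      fun m u hsk hu hw => ?_⟩
    obtain ⟨k, hk⟩ := g₃.trans h.inst.ews hu
      (by rw [Ty.sk_sub, Ty.sk_so, Ty.sk_sub, Ty.sk_so, hf.sk]) (by rwa [Ty.sk_sub, Ty.sk_so])
    exact .ifun (g₂ k u (hf.sk.trans hsk) hk hw) g₁

end

end IRT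

namespace IRT

variable {T : Theory}

/-! ## Application of second-order assignments -/

theorem Ty.applySO_so (Δ : SOAssign T) (t : Ty T) :
    (t.applySO Δ).so (SOAssign.total []) = t.so Δ.total := by
  induction Δ generalizing t with
  | nil => rfl
  | cons kr Δ ih => rw [Ty.applySO, ih, Ty.soSubst_so]

theorem Ty.applySO_eq {Δ : SOAssign T} {t : Ty T} (h : (t.applySO Δ).kvars = ∅) :
    t.applySO Δ = t.so Δ.total := by
  rw [← Ty.applySO_so, Ty.so_of_kvars h]

theorem Refn.kvars_soSubst {D : SOSub T} {p : Refn T} (h : (p.so D).kvars = ∅) (κ : KVar T)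
    (r : Term T) : (p.soSubst κ r).kvars ⊆ p.kvars \ {κ} := by
  induction p with
  | pred => simp [soSubst, kvars]
  | kapp κ' as =>
    by_cases hl : as.length = κ'.sorts.length
    · by_cases hk : κ' = κ
      · subst hk
        simp [soSubst, kvars, hl]
      · simp [soSubst, kvars, hk]
    · simp [so, kvars, hl] at h
  | and p q hp hq =>
    simp only [so, kvars, Set.union_empty_iff] at h
    simp only [soSubst, kvars, Set.union_sdiff_distrib]
    exact Set.union_subset_union (hp h.1) (hq h.2)

theorem Ty.kvars_soSubst {D : SOSub T} {t : Ty T} (h : (t.so D).kvars = ∅) (κ : KVar T)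
    (r : Term T) : (t.soSubst κ r).kvars ⊆ t.kvars \ {κ} := by
  induction t with
  | refine b p => exact Refn.kvars_soSubst h κ r
  | fn t s ht hs | ifn t s ht hs | sig t s ht hs =>
    simp only [so, kvars, Set.union_empty_iff] at h
    simp only [soSubst, kvars, Set.union_sdiff_distrib]
    exact Set.union_subset_union (ht h.1) (hs h.2)
  | bvar | fvar => exact Set.empty_subset _
  | all t ih => exact ih h

theorem Ty.kvars_applySO {Δ : SOAssign T} {t : Ty T} (h : (t.so Δ.total).kvars = ∅)
    (ht : t.kvars ⊆ Δ.dom) : (t.applySO Δ).kvars = ∅ := by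
  induction Δ generalizing t with
  | nil => exact Set.subset_empty_iff.1 fun κ hκ => by simpa [SOAssign.dom] using ht hκ
  | cons kr Δ ih =>
    obtain ⟨κ, r⟩ := kr
    refine ih (by rwa [Ty.soSubst_so]) fun κ' hκ' => ?_
    obtain ⟨h₁, h₂⟩ := Ty.kvars_soSubst h κ r hκ'
    obtain ⟨r', hr'⟩ := ht h₁
    rcases List.mem_cons.1 hr' with hr' | hr'
    · exact (h₂ (congrArg Prod.fst hr')).elim
    · exact ⟨r', hr'⟩

namespace Ctx

theorem soSubst_so (κ : KVar T) (r : Term T) (Δ : SOAssign T) (Γ : Ctx T) :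
    (Γ.soSubst κ r).so Δ.total = Γ.so (SOAssign.total ((κ, r) :: Δ)) := by
  induction Γ <;> simp [soSubst, so, Ty.soSubst_so, *]

theorem applySO_so (Δ : SOAssign T) (Γ : Ctx T) :
    (Γ.applySO Δ).so (SOAssign.total []) = Γ.so Δ.total := by
  induction Δ generalizing Γ with
  | nil => rfl
  | cons kr Δ ih => rw [Ctx.applySO, ih, Ctx.soSubst_so]

end Ctx

theorem WfCtx.so_eq {Γ : Ctx T} (h : WfCtx Γ) (D : SOSub T) : Γ.so D = Γ := by
  induction h with
  | nil => rfl
  | corp _ _ hw ih | ghost _ _ hw ih => rw [Ctx.so, ih, Ty.so_of_kvars hw.wfB.kvars]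
  | tvar _ _ ih => rw [Ctx.so, ih]

theorem WfCtx.applySO_eq {Γ : Ctx T} {Δ : SOAssign T} (h : WfCtx (Γ.applySO Δ)) :
    Γ.applySO Δ = Γ.so Δ.total := by
  rw [← Ctx.applySO_so, h.so_eq]

namespace Ctx

theorem sort_so (D : SOSub T) (Γ : Ctx T) : (Γ.so D).sort = Γ.sort := by
  induction Γ <;> simp [so, sort, Ty.forget_so, *]

theorem tdom_so (D : SOSub T) (Γ : Ctx T) : (Γ.so D).tdom = Γ.tdom := by
  induction Γ <;> simp [so, tdom, *]

theorem ftv_so (D : SOSub T) (Γ : Ctx T) : (Γ.so D).ftv = Γ.ftv := by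
  induction Γ <;> simp [so, ftv, Ty.ftv_so, *]

theorem fv_so_subset {D : SOSub T} (hD : D.WS) (Γ : Ctx T) : (Γ.so D).fv ⊆ Γ.fv := by
  induction Γ with
  | nil => exact subset_rfl
  | corp Γ x t ih | ghost Γ x t ih =>
    exact Set.union_subset_union (Set.union_subset_union_right _ (t.fv_so_subset hD)) ih
  | tvar Γ a ih => exact ih

theorem Mem.so {Γ : Ctx T} {x : Var} {t : Ty T} (h : Γ.Mem x t) (D : SOSub T) :
    (Γ.so D).Mem x (t.so D) := by
  induction h with
  | here => exact .here
  | corp _ ih => exact .corp ih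
  | ghost _ ih => exact .ghost ih
  | tvar _ ih => exact .tvar ih

theorem tyOK_of_wf {D : SOSub T} {Γ : Ctx T} {t : Ty T} (h : Wf (Γ.so D) (t.so D)) :
    Γ.TyOK D t := by
  have := h.wfB
  rwa [sort_so, tdom_so] at this

theorem ok_of_wfCtx {D : SOSub T} {Γ : Ctx T} (h : WfCtx (Γ.so D)) : Γ.OK D := by
  induction Γ with
  | nil => trivial
  | corp Γ x t ih =>
    cases h with
    | corp h hx hw =>
      exact ⟨ih h, fun hx' => hx (names_subset_fv _ (by rwa [names_so])), tyOK_of_wf hw⟩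
  | ghost Γ x t ih =>
    cases h with
    | ghost h hx hw =>
      exact ⟨ih h, fun hx' => hx (names_subset_fv _ (by rwa [names_so])), tyOK_of_wf hw⟩
  | tvar Γ a ih =>
    cases h with
    | tvar h => exact ih h

theorem nodup_of_wfCtx {Γ : Ctx T} (h : WfCtx Γ) : Γ.Nodup := by
  induction h with
  | nil => trivial
  | corp _ hx _ ih | ghost _ hx _ ih => exact ⟨ih, hx⟩
  | tvar _ _ ih => exact ih

theorem embed_distinct {D : SOSub T} {Γ : Ctx T} (hΓ : Γ.OK D) {c : Con T}
    (hc : c.Distinct Γ.names) : (Γ.embed c).Distinct ∅ := by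
  induction Γ generalizing c with
  | nil => exact hc
  | corp Γ x t ih =>
    rw [embed_corp]
    exact ih hΓ.1 (genImp_distinct hΓ.2.1 subset_rfl hc)
  | ghost Γ x t ih =>
    rw [embed_ghost]
    exact ih hΓ.1 (genImp_distinct hΓ.2.1 subset_rfl hc)
  | tvar Γ a ih => exact ih hΓ hc

/-- A valid constraint has a solution in which no existential variable is free. -/
theorem real_of_valid {Γ : Ctx T} {c : Con T} {Δ : SOAssign T} {Ψ : FOAssign T} (hΔ : Δ.WS)
    (hv : Valid Δ Ψ (Γ.embed c)) (hΨ : Ψ.WS (Γ.embed c)) (hΓ : WfCtx (Γ.applySO Δ))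
    (hc : c.Distinct Γ.fv) : Γ.Real Δ.total .fvar (Γ.applySO Δ) ∧
      (c.so Δ.total).Sol (Γ.applySO Δ).semS (Γ.applySO Δ).sat .fvar := by
  have hD := SOAssign.total_WS hΔ
  have hN := nodup_of_wfCtx hΓ
  have he := hΓ.applySO_eq
  rw [he] at hΓ hN ⊢
  have hok := ok_of_wfCtx hΓ
  have hs := hv.sol hΔ hΨ (embed_distinct hok (hc.anti Γ.names_subset_fv))
  rw [embed_so hD] at hs
  obtain ⟨hE, hs⟩ := hs.embed
  refine ⟨⟨⟨fun x => show (Term.fvar x).LC from trivial, fun _ _ => rfl, fun _ => Or.inl rfl, Γ.fv_so_subset hD,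
    (Γ.ftv_so _).subset, (Γ.tdom_so _).symm.subset, fun x b hx => .fvar ?_, hN, hE⟩, hok,
    fun x t hm => ⟨?_, rfl⟩⟩, hs⟩
  · rwa [sort_so]
  · rw [Ty.sub_fvar]
    exact hm.so _

end Ctx

end IRT
theorem mainTheorem1 (T : IRT.Theory) (P : Type) (tc : P → IRT.Ty T)
    (htc : ∀ p, IRT.Wf IRT.Ctx.nil (tc p))
    (Δ : IRT.SOAssign T) (hΔ : Δ.WS) (Ψ : IRT.FOAssign T) :
    (∀ (Γ : IRT.Ctx T) (e : IRT.Expr T P) (t : IRT.Ty T) (c : IRT.Con T),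
      IRT.Synth tc Γ e t c → IRT.Valid Δ Ψ (Γ.embed c) → Ψ.WS (Γ.embed c) →
      Γ.kvars ∪ t.kvars ⊆ Δ.dom → IRT.WfCtx (Γ.applySO Δ) →
      IRT.HasType tc (Γ.applySO Δ) e (t.applySO Δ)) ∧
    (∀ (Γ : IRT.Ctx T) (e : IRT.Expr T P) (t : IRT.Ty T) (c : IRT.Con T),
      IRT.Check tc Γ e t c → IRT.Valid Δ Ψ (Γ.embed c) → Ψ.WS (Γ.embed c) →
      Γ.kvars ∪ t.kvars ⊆ Δ.dom → IRT.WfCtx (Γ.applySO Δ) →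
      IRT.Wf (Γ.applySO Δ) (t.applySO Δ) →
      IRT.HasType tc (Γ.applySO Δ) e (t.applySO Δ)) ∧
    (∀ (Γ : IRT.Ctx T) (t : IRT.Ty T) (e : IRT.Expr T P) (t' : IRT.Ty T) (c : IRT.Con T),
      IRT.SpineSynth tc Γ t e t' c → IRT.Valid Δ Ψ (Γ.embed c) → Ψ.WS (Γ.embed c) →
      Γ.kvars ∪ t.kvars ∪ t'.kvars ⊆ Δ.dom → IRT.WfCtx (Γ.applySO Δ) →
      IRT.Wf (Γ.applySO Δ) (t.applySO Δ) →
      IRT.AppType tc (Γ.applySO Δ) (t.applySO Δ) e (t'.applySO Δ)) ∧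
    (∀ (Γ : IRT.Ctx T) (t : IRT.Ty T) (e : IRT.Expr T P) (t' : IRT.Ty T) (c : IRT.Con T),
      IRT.SpineCheck tc Γ t e t' c → IRT.Valid Δ Ψ (Γ.embed c) → Ψ.WS (Γ.embed c) →
      Γ.kvars ∪ t.kvars ∪ t'.kvars ⊆ Δ.dom → IRT.WfCtx (Γ.applySO Δ) →
      IRT.Wf (Γ.applySO Δ) (t.applySO Δ) → IRT.Wf (Γ.applySO Δ) (t'.applySO Δ) →
      IRT.AppType tc (Γ.applySO Δ) (t.applySO Δ) e (t'.applySO Δ)) ∧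
    (∀ (Γ : IRT.Ctx T) (t₁ t₂ : IRT.Ty T) (c : IRT.Con T),
      IRT.ASub Γ t₁ t₂ c → IRT.Valid Δ Ψ (Γ.embed c) → Ψ.WS (Γ.embed c) →
      Γ.kvars ⊆ Δ.dom → IRT.WfCtx (Γ.applySO Δ) →
      IRT.Wf (Γ.applySO Δ) (t₁.applySO Δ) → IRT.Wf (Γ.applySO Δ) (t₂.applySO Δ) →
      IRT.SubType tc (Γ.applySO Δ) (t₁.applySO Δ) (t₂.applySO Δ)) := by
  have hD := IRT.SOAssign.total_WS hΔ
  have hok : ∀ (Γ : IRT.Ctx T) (t : IRT.Ty T), IRT.WfCtx (Γ.applySO Δ) →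
      IRT.Wf (Γ.applySO Δ) (t.applySO Δ) →
      Γ.TyOK Δ.total t ∧ t.applySO Δ = (t.so Δ.total).sub .fvar := by
    intro Γ t hΓ ht
    have he := IRT.Ty.applySO_eq ht.wfB.kvars
    rw [he, hΓ.applySO_eq] at ht
    exact ⟨IRT.Ctx.tyOK_of_wf ht, by rw [IRT.Ty.sub_fvar, he]⟩
  have hcov : ∀ (Γ : IRT.Ctx T) (t : IRT.Ty T), Γ.TyOK Δ.total t → t.kvars ⊆ Δ.dom →
      t.applySO Δ = (t.so Δ.total).sub .fvar := by
    intro Γ t ht hk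
    rw [IRT.Ty.sub_fvar, IRT.Ty.applySO_eq (IRT.Ty.kvars_applySO ht.kvars hk)]
  refine ⟨fun Γ e t c h hv hΨ hk hΓ => ?_, fun Γ e t c h hv hΨ hk hΓ ht => ?_,
    fun Γ t e t' c h hv hΨ hk hΓ ht => ?_, fun Γ t e t' c h hv hΨ hk hΓ ht ht' => ?_,
    fun Γ t₁ t₂ c h hv hΨ hk hΓ h₁ h₂ => ?_⟩ <;>
    obtain ⟨hr, hs⟩ := IRT.Ctx.real_of_valid hΔ hv hΨ hΓ h.distinct
  · rw [hcov Γ t (h.ok hD htc hr.ok) (Set.subset_union_right.trans hk)]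
    exact h.sound hD htc hr (fun _ _ => rfl) hs
  · obtain ⟨ht, he⟩ := hok Γ t hΓ ht
    rw [he]
    exact h.sound hD htc hr (fun _ _ => rfl) ht hs
  · obtain ⟨ht, he⟩ := hok Γ t hΓ ht
    rw [he, hcov Γ t' (h.ok hD htc hr.ok ht) (Set.subset_union_right.trans hk)]
    exact (h.sound hD htc hr (fun _ _ => rfl) ht hs).1
  · obtain ⟨ht, he⟩ := hok Γ t hΓ ht
    obtain ⟨ht', he'⟩ := hok Γ t' hΓ ht'
    rw [he, he']
    exact h.sound hD htc hr (fun _ _ => rfl) ht ht' hs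
  · obtain ⟨h₁, e₁⟩ := hok Γ t₁ hΓ h₁
    obtain ⟨h₂, e₂⟩ := hok Γ t₂ hΓ h₂
    rw [e₁, e₂]
    obtain ⟨n, hn⟩ := h.sound hD hr.inst hr.ok h₁ h₂ hs
    exact hn.subType hr.inst.nodup
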